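/- **Setting.** Let $V$ be a real 6-dimensional vector space. The space $V\oplus V^*$ acts on forms by $(v+\xi)\cdot\rho=\iota(v)\rho+\xi\wedge\rho$. This makes $\Lambda^{ev}V^*$ and $\Lambda^{od}V^*$, after untwisting by $(\Lambda^6V)^{1/2}$, into the two half-spin representations $\sigma$ of $\mathfrak{so}(V\oplus V^*)$. They carry the skew pairing $$\langle\varphi,\psi\rangle=\sum_m(-1)^m\varphi_{2m}\wedge\psi_{6-2m}\quad\text{or}\quad \sum_m(-1)^m\varphi_{2m+1}\wedge\psi_{6-2m-1}\ \in\Lambda^6V^*.$$ After a choice of volume element, which identifies $\Lambda^6V^*$ with $\mathbf R$, let $\mu(\rho)\in\mathfrak{so}(V\oplus V^*)$ be the moment map, $\operatorname{tr}(\mu(\rho)a)=\tfrac12\langle\sigma(a)\rho,\rho\rangle$. Put $q(\rho)=4\operatorname{tr}\mu(\rho)^2$ and, on the open set $U=\{q<0\}$, $\phi(\rho)=\sqrt{-q(\rho)/3}$. Let $X(\rho)=\hat\rho$ be the Hamiltonian vector field of $\phi$ on $U$, i.e. $\langle\hat\rho,\dot\rho\rangle=D\phi_\rho(\dot\rho)$,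 and let $J=DX$, an almost complex structure on $U$ which depends only on the orientation of $V$. Let $M$ be a smooth 6-manifold and $\varphi$ a closed complex form on $M$, of even or of odd degree, that defines a generalized Calabi–Yau structure (it is a pure spinor and $\langle\varphi,\bar\varphi\rangle\neq0$ at each point). Let $\rho=\operatorname{Re}\varphi$, orient $M$ by $-i\langle\varphi,\bar\varphi\rangle$, and let $J$ act on $\Omega^{ev}(M)$ or $\Omega^{od}(M)$ (the parity of $\varphi$) pointwise as the operator $J$ at $\rho_x$. One says that $(M,\varphi)$ *satisfies the $dd^J$-lemma* if for every smooth real form $\tau$ of parity opposite to $\varphi$ $$dJd\tau=0\ \Longrightarrow\ d\tau=d(\iota(X)\rho+\xi\wedge\rho)\ \text{ for some smooth vector field }X\text{ and smooth real 1-form }\xi.$$ **Proposition.** The $dd^J$-lemma holds in each of the following cases. a) $M$ is a complex 3-manifold with a nowhere vanishing holomorphic 3-form $\Omega$, $\varphi=\Omega$, and $M$ satisfies the $\partial\bar\partial$-lemma: every smooth complex form $\alpha$ which is $d$-exact and satisfies $\partial\alpha=\bar\partial\alpha=0$ is of the form $\alpha=\partial\bar\partial\gamma$ with $\gamma$ smooth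 (so $\alpha=0$ if $\alpha$ has degree $1$). b) $M$ is a compact symplectic 6-manifold with symplectic form $\omega$, $\varphi=\exp(i\omega)$, and $M$ satisfies the strong Lefschetz condition that the map $[a]\mapsto[\omega\wedge a]$, $H^2(M,\mathbf R)\to H^4(M,\mathbf R)$, is an isomorphism. -/

import Mathlib

open scoped Manifold ContDiff

noncomputable section

namespace GenCY

/-! ### Linear algebra: exterior forms on a real vector space -/

section LinearAlgebra

variable {V : Type*} [NormedAddCommGroup V] [NormedSpace ℝ V]
variable {F : Type*} [NormedField F] [NormedAlgebra ℝ F]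

/-- The exterior product `α ∧ β` of two forms (sum over shuffles, so that
`(ξ ∧ η)(v, w) = ξ(v) η(w) - ξ(w) η(v)` for `1`-forms). -/
def wedge {k l : ℕ} (α : V [⋀^Fin k]→L[ℝ] F) (β : V [⋀^Fin l]→L[ℝ] F) :
    V [⋀^Fin (k + l)]→L[ℝ] F :=
  { ((LinearMap.mul' ℝ F).compAlternatingMap
      (α.toAlternatingMap.domCoprod β.toAlternatingMap)).domDomCongr finSumFinEquiv with
    cont := by
      have key : ∀ σ : Equiv.Perm.ModSumCongr (Fin k) (Fin l),
          Continuous fun v : Fin (k + l) → V => LinearMap.mul' ℝ F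
            (AlternatingMap.domCoprod.summand α.toAlternatingMap β.toAlternatingMap σ
              fun i => v (finSumFinEquiv i)) := by
        intro σ
        induction σ using Quotient.inductionOn' with
        | h σ =>
          have h1 : Continuous fun v : Fin (k + l) → V =>
              α fun i => v (finSumFinEquiv (σ (Sum.inl i))) :=
            α.cont.comp (continuous_pi fun i => continuous_apply _)
          have h2 : Continuous fun v : Fin (k + l) → V =>
              β fun i => v (finSumFinEquiv (σ (Sum.inr i))) :=
            β.cont.comp (continuous_pi fun i => continuous_apply _)
          rcases Int.units_eq_one_or (Equiv.Perm.sign σ) with hs | hs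
          · refine (h1.mul h2).congr fun v => ?_
            simp [AlternatingMap.domCoprod.summand_mk'', hs]
          · refine (h1.mul h2).neg.congr fun v => ?_
            simp [AlternatingMap.domCoprod.summand_mk'', hs]
      have := continuous_finsetSum Finset.univ fun σ _ => key σ
      refine this.congr fun v => ?_
      simp [AlternatingMap.domCoprod_apply, Function.comp_def] }

/-- The exterior product `ξ ∧ α` with a covector `ξ` on the left:
`(ξ ∧ α)(v₀, …, vₖ) = ∑ (-1)ⁱ ξ(vᵢ) α(v₀, …, v̂ᵢ, …, vₖ)`. -/
def covectorWedge {k : ℕ} (ξ : V →L[ℝ] ℝ) (α : V [⋀^Fin k]→L[ℝ] ℝ) :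
    V [⋀^Fin (k + 1)]→L[ℝ] ℝ :=
  ContinuousAlternatingMap.alternatizeUncurryFin (ξ.smulRight α)

/-- Transport of a form along an equality of degrees. -/
def castDeg {k l : ℕ} (h : k = l) (α : V [⋀^Fin k]→L[ℝ] F) : V [⋀^Fin l]→L[ℝ] F :=
  h ▸ α

variable (V F) in
/-- Exterior forms of mixed degree, `⨁ₖ Λᵏ V*` with values in `F`: the sum of the two
(untwisted) half-spin spaces `Λᵉᵛ V*` and `Λᵒᵈ V*` of `V ⊕ V*`.  Here `V` is always of finite
dimension, so that all but finitely many summands vanish. -/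
abbrev Spinor : Type _ := ∀ k : ℕ, V [⋀^Fin k]→L[ℝ] F

/-- Powers `B ∧ ⋯ ∧ B` of a `2`-form. -/
def wedgePow (B : V [⋀^Fin 2]→L[ℝ] F) : ∀ m : ℕ, V [⋀^Fin (2 * m)]→L[ℝ] F
  | 0 => ContinuousAlternatingMap.constOfIsEmpty ℝ V (Fin 0) 1
  | m + 1 => wedge (wedgePow B m) B

/-- `exp B = 1 + B + B²/2 + ⋯` for a `2`-form `B`. -/
def expForm (B : V [⋀^Fin 2]→L[ℝ] F) : Spinor V F := fun k =>
  if h : 2 * (k / 2) = k then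
    castDeg h (((Nat.factorial (k / 2) : ℝ)⁻¹) • wedgePow B (k / 2))
  else 0

/-- The Clifford action `(v + ξ) · ρ = ι(v) ρ + ξ ∧ ρ` of `V ⊕ V*` on forms. -/
def clifford (w : V × (V →L[ℝ] ℝ)) (ρ : Spinor V ℝ) : Spinor V ℝ
  | 0 => (ρ 1).curryLeft w.1
  | k + 1 => (ρ (k + 2)).curryLeft w.1 + covectorWedge w.2 (ρ k)

/-- The action on spinors of the element
`a : x ↦ B(w₂, x) w₁ - B(w₁, x) w₂` of the Lie algebra `𝔰𝔬(V ⊕ V*)`, where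
`B(v + ξ, v' + ξ') = ξ(v') + ξ'(v)`.  In the Clifford algebra this is `½ (w₁ w₂ - w₂ w₁)`.
Such elements span the Lie algebra. -/
def spinAction (w₁ w₂ : V × (V →L[ℝ] ℝ)) (ρ : Spinor V ℝ) : Spinor V ℝ :=
  (1 / 2 : ℝ) • (clifford w₁ (clifford w₂ ρ) - clifford w₂ (clifford w₁ ρ))

/-- The invariant bilinear form on forms on a six-dimensional space, with values in `Λ⁶ V*`:
`⟨φ, ψ⟩ = ∑ₘ (-1)ᵐ φ_{2m} ∧ ψ_{6-2m}` on even forms and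
`⟨φ, ψ⟩ = ∑ₘ (-1)ᵐ φ_{2m+1} ∧ ψ_{6-2m-1}` on odd forms; even and odd forms are orthogonal. -/
def mukai (φ ψ : Spinor V F) : V [⋀^Fin 6]→L[ℝ] F :=
  ∑ k : Fin 7, ((-1 : ℝ) ^ ((k : ℕ) / 2)) •
    castDeg (Nat.add_sub_of_le (Nat.le_of_lt_succ k.isLt)) (wedge (φ k) (ψ (6 - k)))

/-- The complex conjugate of a complex form. -/
def conjForm {k : ℕ} (α : V [⋀^Fin k]→L[ℝ] ℂ) : V [⋀^Fin k]→L[ℝ] ℂ :=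
  (Complex.conjCLE : ℂ →L[ℝ] ℂ).compContinuousAlternatingMap α

/-- The real part of a complex form. -/
def reForm {k : ℕ} (α : V [⋀^Fin k]→L[ℝ] ℂ) : V [⋀^Fin k]→L[ℝ] ℝ :=
  Complex.reCLM.compContinuousAlternatingMap α

/-- The imaginary part of a complex form. -/
def imForm {k : ℕ} (α : V [⋀^Fin k]→L[ℝ] ℂ) : V [⋀^Fin k]→L[ℝ] ℝ :=
  Complex.imCLM.compContinuousAlternatingMap α

/-- A real form regarded as a complex form. -/
def ofRealForm {k : ℕ} (α : V [⋀^Fin k]→L[ℝ] ℝ) : V [⋀^Fin k]→L[ℝ] ℂ :=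
  Complex.ofRealCLM.compContinuousAlternatingMap α

section Six

variable [FiniteDimensional ℝ V] [hV : Fact (Module.finrank ℝ V = 6)]

variable (V) in
/-- An auxiliary basis of the six-dimensional space `V`; nothing below depends on the choice. -/
def sixBasis : Module.Basis (Fin 6) ℝ V := Module.finBasisOfFinrankEq ℝ V hV.out

/-- The real-valued pairing obtained from `mukai` by identifying `Λ⁶ V*` with `ℝ` by means of a
volume element `ε ≠ 0`: the number `c` with `⟨φ, ψ⟩ = c ε`. -/
def pairing (ε : V [⋀^Fin 6]→L[ℝ] ℝ) (φ ψ : Spinor V ℝ) : ℝ :=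
  mukai φ ψ (sixBasis V) / ε (sixBasis V)

/-- The moment map `μ(ρ)(a) = ½ ⟨σ(a) ρ, ρ⟩` of the spin representation, evaluated on the element
`a` of `𝔰𝔬(V ⊕ V*)` attached to `w₁, w₂` as in `spinAction`. -/
def moment (ε : V [⋀^Fin 6]→L[ℝ] ℝ) (ρ : Spinor V ℝ) (w₁ w₂ : V × (V →L[ℝ] ℝ)) : ℝ :=
  1 / 2 * pairing ε (spinAction w₁ w₂ ρ) ρ

variable (V) in
/-- The basis of `V ⊕ V*` formed by a basis of `V` and its dual basis. With respect to `B`,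
the element with index `i` is dual to the element with index `i.swap`. -/
def wittBasis : Fin 6 ⊕ Fin 6 → V × (V →L[ℝ] ℝ)
  | Sum.inl i => (sixBasis V i, 0)
  | Sum.inr i => (0, LinearMap.toContinuousLinearMap ((sixBasis V).coord i))

/-- The matrix, in the basis `wittBasis`, of the moment map regarded as the endomorphism
`μ ∈ 𝔰𝔬(V ⊕ V*)` with `tr (μ a) = μ(ρ)(a)` for all `a`. For the `a` attached to `w₁, w₂` one has
`tr (μ a) = 2 B(μ w₁, w₂)`, whence the factor `½`. -/
def momentMatrix (ε : V [⋀^Fin 6]→L[ℝ] ℝ) (ρ : Spinor V ℝ) :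
    Matrix (Fin 6 ⊕ Fin 6) (Fin 6 ⊕ Fin 6) ℝ :=
  Matrix.of fun i j => 1 / 2 * moment ε ρ (wittBasis V j) (wittBasis V i.swap)

/-- The invariant quartic `q(ρ) = 4 tr μ(ρ)²`, with the normalization for which
`q(α + β) = 3 ⟨α, β⟩²` for pure `α`, `β`. -/
def quartic (ε : V [⋀^Fin 6]→L[ℝ] ℝ) (ρ : Spinor V ℝ) : ℝ :=
  4 * (momentMatrix ε ρ * momentMatrix ε ρ).trace

/-- The function `ϕ(ρ) = √(-q(ρ)/3)`, of interest on the open set `U = {q < 0}`. -/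
def volFun (ε : V [⋀^Fin 6]→L[ℝ] ℝ) (ρ : Spinor V ℝ) : ℝ :=
  √(-quartic ε ρ / 3)

/-- The Hamiltonian vector field `X(ρ) = ρ̂` of `ϕ` on `U`: the spinor with
`⟨X(ρ), σ⟩ = Dϕ_ρ(σ)` for all `σ` (it is unique as the pairing is nondegenerate). It is tangent
to the half-spin spaces, since these are orthogonal and preserved by the spin action. -/
def hatMap (ε : V [⋀^Fin 6]→L[ℝ] ℝ) (ρ : Spinor V ℝ) : Spinor V ℝ :=
  Function.invFun (fun X : Spinor V ℝ => fun σ : Spinor V ℝ => pairing ε X σ)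
    (fun σ => lineDeriv ℝ (volFun ε) ρ σ)

/-- The complex structure `J = DX` on `U`, at the point `ρ`, applied to the tangent vector `σ`. -/
def cplxStr (ε : V [⋀^Fin 6]→L[ℝ] ℝ) (ρ σ : Spinor V ℝ) : Spinor V ℝ := fun k =>
  lineDeriv ℝ (fun r : Spinor V ℝ => hatMap ε r k) ρ σ

/-- The real volume element `-i ⟨φ, φ̄⟩` attached to a complex spinor `φ` (`⟨φ, φ̄⟩` is purely
imaginary because the pairing is skew). -/
def volOf (φ : Spinor V ℂ) : V [⋀^Fin 6]→L[ℝ] ℝ :=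
  imForm (mukai φ fun k => conjForm (φ k))

end Six

end LinearAlgebra

/-! ### Differential forms on manifolds

In Mathlib the tangent space of `M` at every point is (by definition) the model space `E`,
identified with it by the preferred chart at that point. -/

section Forms

/-- Differential `k`-forms (without smoothness) with values in `F` on a manifold modelled on `E`;
they are `𝕜`-multilinear on each tangent space. -/
abbrev Form (𝕜 E M F : Type*) [NontriviallyNormedField 𝕜] [NormedAddCommGroup E] [NormedSpace 𝕜 E]
    [NormedAddCommGroup F] [NormedSpace 𝕜 F] (k : ℕ) : Type _ :=
  M → E [⋀^Fin k]→L[𝕜] F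

variable {𝕜 E M F : Type*} [NontriviallyNormedField 𝕜] [NormedAddCommGroup E] [NormedSpace 𝕜 E]
  [TopologicalSpace M] [ChartedSpace E M] [NormedAddCommGroup F] [NormedSpace 𝕜 F]

/-- The expression of a form in the preferred chart at `x`: its pull-back by the inverse of
that chart. -/
def chartRep {k : ℕ} (x : M) (α : Form 𝕜 E M F k) (y : E) : E [⋀^Fin k]→L[𝕜] F :=
  (α ((chartAt E x).symm y)).compContinuousLinearMap
    (mfderiv 𝓘(𝕜, E) 𝓘(𝕜, E) (chartAt E x).symm y : E →L[𝕜] E)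

/-- A form is of class `Cⁿ` if all its expressions in charts are. -/
def IsCn (n : ℕ∞ω) {k : ℕ} (α : Form 𝕜 E M F k) : Prop :=
  ∀ x : M, ContDiffOn 𝕜 n (chartRep x α) (chartAt E x).target

/-- The exterior derivative: computed in the chart at `x` and pulled back to `M`. -/
def extD {k : ℕ} (α : Form 𝕜 E M F k) : Form 𝕜 E M F (k + 1) := fun x =>
  (extDeriv (chartRep x α) (chartAt E x x)).compContinuousLinearMap
    (mfderiv 𝓘(𝕜, E) 𝓘(𝕜, E) (chartAt E x) x : E →L[𝕜] E)

end Forms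

section Mixed

/-- Differential forms of mixed degree on a real manifold modelled on `E`. -/
abbrev MixedForm (E M F : Type*) [NormedAddCommGroup E] [NormedSpace ℝ E]
    [NormedAddCommGroup F] [NormedSpace ℝ F] : Type _ :=
  ∀ k : ℕ, Form ℝ E M F k

variable {E M F : Type*} [NormedAddCommGroup E] [NormedSpace ℝ E]
  [TopologicalSpace M] [ChartedSpace E M] [NormedAddCommGroup F] [NormedSpace ℝ F]

/-- The exterior derivative on forms of mixed degree. -/
def mixedD (τ : MixedForm E M F) : MixedForm E M F
  | 0 => 0
  | k + 1 => extD (τ k)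

/-- `p = 0`: even forms, `p = 1`: odd forms. -/
def HasParity (p : ℕ) (τ : MixedForm E M F) : Prop :=
  ∀ k, k % 2 ≠ p % 2 → τ k = 0

/-- The form of mixed degree with only one component. -/
def ofDegree {k : ℕ} (α : Form ℝ E M F k) : MixedForm E M F := Pi.single k α

variable [FiniteDimensional ℝ E] [Fact (Module.finrank ℝ E = 6)]

/-- The operator `J` on forms of mixed degree defined by the structure `φ`: at each point it is the
complex structure `J` at `ρ = Re φ`, for the orientation with `-i⟨φ, φ̄⟩ > 0`. -/
def opJ (φ : MixedForm E M ℂ) (σ : MixedForm E M ℝ) : MixedForm E M ℝ := fun k x =>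
  cplxStr (volOf fun j => φ j x) (fun j => reForm (φ j x)) (fun j => σ j x) k

/-- The form `(X + ξ) · ρ = ι(X) ρ + ξ ∧ ρ` with `ρ = Re φ`. -/
def infAction (X : M → E) (ξ : Form ℝ E M ℝ 1) (φ : MixedForm E M ℂ) : MixedForm E M ℝ :=
  fun k x => clifford (X x, (ContinuousAlternatingMap.ofSubsingleton ℝ E ℝ (0 : Fin 1)).symm (ξ x))
    (fun j => reForm (φ j x)) k

/-- The `dd^J`-lemma for a generalized Calabi-Yau structure `φ` of parity `p` on a six-manifold:
for `τ` of parity opposite to `φ`, if `d J dτ = 0` then `dτ = d(ι(X)ρ + ξ ∧ ρ)` for some vector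
field `X` and `1`-form `ξ`. -/
def DDJLemma [IsManifold 𝓘(ℝ, E) ∞ M] (p : ℕ) (φ : MixedForm E M ℂ) : Prop :=
  ∀ τ : MixedForm E M ℝ, HasParity (p + 1) τ → (∀ k, IsCn ∞ (τ k)) →
    mixedD (opJ φ (mixedD τ)) = 0 →
    ∃ (X : ∀ x : M, TangentSpace 𝓘(ℝ, E) x) (ξ : Form ℝ E M ℝ 1),
      ContMDiff 𝓘(ℝ, E) 𝓘(ℝ, E).tangent ∞
        (fun x => (⟨x, X x⟩ : TangentBundle 𝓘(ℝ, E) M)) ∧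
      IsCn ∞ ξ ∧ mixedD τ = mixedD (infAction (fun x => (X x : E)) ξ φ)

end Mixed

/-! ### Complex manifolds -/

section Complex

variable {E M : Type*} [NormedAddCommGroup E] [NormedSpace ℂ E]
  [TopologicalSpace M] [ChartedSpace E M]

/-- A complex manifold is a real smooth manifold. -/
instance isManifold_real [IsManifold 𝓘(ℂ, E) ω M] : IsManifold 𝓘(ℝ, E) ∞ M := by
  apply isManifold_of_contDiffOn
  intro e e' he he'
  have h : e.symm.trans e' ∈ contDiffGroupoid ω 𝓘(ℂ, E) := HasGroupoid.compatible he he'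
  have h3 := (mem_groupoid_of_pregroupoid.mp h).1
  have h4 : ContDiffOn ℂ ω (e.symm.trans e') (e.symm.trans e').source := by
    simpa [contDiffPregroupoid] using h3
  have h5 : ContDiffOn ℝ ∞ (e.symm.trans e') (e.symm.trans e').source :=
    (h4.restrict_scalars ℝ).of_le le_top
  simpa using h5

instance fact_finrank_real [h : Fact (Module.finrank ℂ E = 3)] :
    Fact (Module.finrank ℝ E = 6) :=
  ⟨by rw [finrank_real_of_complex, h.out]⟩

/-- `α(c v₁, …, c vₖ)` for a complex number `c`. -/
def scaleArgs (c : ℂ) {k : ℕ} (α : E [⋀^Fin k]→L[ℝ] ℂ) : E [⋀^Fin k]→L[ℝ] ℂ :=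
  α.compContinuousLinearMap (c • ContinuousLinearMap.id ℝ E)

/-- The operator `d^c = C⁻¹ d C`, where `(C α)(v₁, …, vₖ) = α(i v₁, …, i vₖ)` is multiplication by
`i^{p-q}` on forms of type `(p, q)`. On a complex manifold `d^c = i (∂̄ - ∂)`. -/
def dc {k : ℕ} (α : Form ℝ E M ℂ k) : Form ℝ E M ℂ (k + 1) := fun x =>
  scaleArgs (-Complex.I) (extD (fun y => scaleArgs Complex.I (α y)) x)

/-- The operator `∂ = ½ (d + i d^c)`, the component of type `(1, 0)` of `d`. -/
def del {k : ℕ} (α : Form ℝ E M ℂ k) : Form ℝ E M ℂ (k + 1) :=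
  (1 / 2 : ℂ) • (extD α + Complex.I • dc α)

/-- The operator `∂̄ = ½ (d - i d^c)`, the component of type `(0, 1)` of `d`. -/
def delbar {k : ℕ} (α : Form ℝ E M ℂ k) : Form ℝ E M ℂ (k + 1) :=
  (1 / 2 : ℂ) • (extD α - Complex.I • dc α)

variable (E M) in
/-- The `∂∂̄`-lemma: in every degree, a smooth form `α` which is `d`-exact and satisfies
`∂α = 0 = ∂̄α` is of the form `∂∂̄γ`. In degree `1`, where `γ` would have degree `-1`, this means
`α = 0`; in degree `0` there is nothing to say. -/
def DelDelbarLemma : Prop :=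
  (∀ β : Form ℝ E M ℂ 0, IsCn ∞ β → del (extD β) = 0 → delbar (extD β) = 0 → extD β = 0) ∧
  ∀ (k : ℕ) (β : Form ℝ E M ℂ (k + 1)), IsCn ∞ β →
    del (extD β) = 0 → delbar (extD β) = 0 →
    ∃ γ : Form ℝ E M ℂ k, IsCn ∞ γ ∧ extD β = del (delbar γ)

/-- A holomorphic `k`-form: a section of `Λ^{k,0}`, i.e. a form which is `ℂ`-multilinear at each
point, whose expressions in the holomorphic charts are holomorphic (complex analytic). -/
def IsHolomorphicForm {k : ℕ} (Ω : Form ℂ E M ℂ k) : Prop := IsCn ω Ω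

/-- The real-multilinear complex-valued form underlying a holomorphic form. -/
def toRealForm {k : ℕ} (Ω : Form ℂ E M ℂ k) : Form ℝ E M ℂ k := fun x =>
  (Ω x).restrictScalars ℝ

end Complex

/-! ### Symplectic manifolds -/

section Symplectic

variable {E M : Type*} [NormedAddCommGroup E] [NormedSpace ℝ E]
  [TopologicalSpace M] [ChartedSpace E M]

/-- A symplectic form: a smooth closed nondegenerate `2`-form. -/
structure IsSymplectic (w : Form ℝ E M ℝ 2) : Prop where
  smooth : IsCn ∞ w
  closed : extD w = 0
  nondegenerate : ∀ (x : M) (u : E), (∀ v : E, w x ![u, v] = 0) → u = 0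

/-- A closed smooth form. -/
def IsClosedForm {k : ℕ} (α : Form ℝ E M ℝ k) : Prop := IsCn ∞ α ∧ extD α = 0

/-- An exact form (of positive degree). -/
def IsExactForm {k : ℕ} (α : Form ℝ E M ℝ (k + 1)) : Prop :=
  ∃ β : Form ℝ E M ℝ k, IsCn ∞ β ∧ extD β = α

/-- The strong Lefschetz condition on a symplectic six-manifold: the map
`[a] ↦ [w ∧ a]` from `H²(M, ℝ)` to `H⁴(M, ℝ)` is injective and surjective. -/
structure StrongLefschetz (w : Form ℝ E M ℝ 2) : Prop where
  injective : ∀ a : Form ℝ E M ℝ 2, IsClosedForm a →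
    IsExactForm (k := 3) (fun x => (wedge (w x) (a x) : E [⋀^Fin (2 + 2)]→L[ℝ] ℝ)) → IsExactForm a
  surjective : ∀ b : Form ℝ E M ℝ 4, IsClosedForm b →
    ∃ a : Form ℝ E M ℝ 2, IsClosedForm a ∧
      IsExactForm (k := 3) (fun x => b x - (wedge (w x) (a x) : E [⋀^Fin (2 + 2)]→L[ℝ] ℝ))

/-- The form `φ = exp (i w)` of a symplectic form `w`. -/
def expI (w : Form ℝ E M ℝ 2) : MixedForm E M ℂ := fun k x =>
  expForm (Complex.I • ofRealForm (w x)) k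

end Symplectic

end GenCY

end

/-! Write φ = ρ + iρ'. Everything pointwise rests on one description of `J`. Purity provides a skew
complex structure j on V ⊕ V* with (jw)ρ = -wρ' and (jw)ρ' = wρ (`IsPurePair`). The moment map of ρ
is then a multiple of j, and the differential of q at ρ is a multiple of ⟨ρ', ·⟩; for the volume
element -i⟨φ, φ̄⟩ = 2⟨ρ', ρ⟩ this gives ρ̂ = ρ'. As q is homogeneous and invariant under 𝔰𝔬(V ⊕ V*),
the map ρ ↦ ρ̂ is equivariant, whence J(w₁w₂ρ) = w₁w₂ρ' (`IsPurePair.cplxStr_clifford_clifford`).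
The spinors w₁w₂ρ span the half-spin space, so this determines `J` in both cases.

Case a. Let C multiply all arguments of a form by i (`rot`) and let D be the corresponding
derivation (`rotDeriv`); on type (p, q) they are i^(p-q) and i(p-q). On odd forms J = -½(D + C)
(`cplxStr_holSpinor`). The commutator rule D dτ = d Dτ - d^c τ turns dJdτ = 0, for τ of even degree,
into d C d(τ + Cτ) = 0. The ∂∂̄-lemma gives d(τ + Cτ) = dd^c ν with ν real, and then dτ = dη for η =
½(τ - Cτ + d^c ν - C d^c ν), which satisfies Cη = -η. In degree 2 such a form has type (2,0) + (0,2)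
and is ι(X)ρ; in degree 4 it has type (3,1) + (1,3) and is ξ ∧ ρ. Uniqueness of X and ξ at each
point makes them smooth. In degree 0 the ∂∂̄-lemma gives dτ = 0 directly.

Case b. Here ρ = 1 - ω²/2 and ρ' = ω - ω³/6. Write dτ₃ = γ ∧ ω and dτ₅ + ½ dτ₁ ∧ ω² = s ω³. The
components of J dτ in degrees 0 and 2 are -3s and -γ (`cplxStr_expForm_I`), so s is locally constant
and γ is closed. Since s ω³ is exact, so is s² ω³, and Stokes' theorem gives s = 0. Since γ ∧ ω is
exact, the Lefschetz condition gives γ = dη. With ξ = τ₁ and ι(X)ω = -η one has (X + ξ)ρ = τ₁ + η ∧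
ω - ½ τ₁ ∧ ω², whose derivative is dτ. -/

noncomputable section

namespace GenCY

/-! ### The exterior product: antisymmetrization and associativity with covectors. -/

section Wedge

variable {V : Type*} [NormedAddCommGroup V] [NormedSpace ℝ V]
variable {F : Type*} [NormedField F] [NormedAlgebra ℝ F]

theorem castDeg_apply {k l : ℕ} (h : k = l) (α : V [⋀^Fin k]→L[ℝ] F) (v : Fin l → V) :
    castDeg h α v = α (fun i => v (Fin.cast h i)) := by
  subst h; rfl

/-- The sum over all permutations counts each shuffle k! l! times. The degree `N` is kept free so
that changes of degree are absorbed into `Fin.cast`. -/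
theorem wedge_perm_sum {k l N : ℕ} (h : k + l = N) (α : V [⋀^Fin k]→L[ℝ] F)
    (β : V [⋀^Fin l]→L[ℝ] F) (v : Fin N → V) :
    (k.factorial * l.factorial) • castDeg h (wedge α β) v =
      ∑ σ : Equiv.Perm (Fin N), Equiv.Perm.sign σ •
        (α (fun i => v (σ (Fin.cast h (Fin.castAdd l i)))) *
          β (fun i => v (σ (Fin.cast h (Fin.natAdd k i))))) := by
  subst h
  have key := congrArg (fun m => LinearMap.mul' ℝ F (m fun i => v (finSumFinEquiv i)))
    (MultilinearMap.domCoprod_alternization_eq α.toAlternatingMap β.toAlternatingMap)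
  simp only [Fintype.card_fin, MultilinearMap.alternatization_apply, map_sum] at key
  have h2 : LinearMap.mul' ℝ F (((k.factorial * l.factorial) •
      α.toAlternatingMap.domCoprod β.toAlternatingMap) fun i => v (finSumFinEquiv i)) =
      (k.factorial * l.factorial) • castDeg rfl (wedge α β) v := by
    rw [AlternatingMap.smul_apply, map_nsmul]
    rfl
  rw [← h2]
  refine Eq.trans key.symm ?_
  refine Fintype.sum_equiv finSumFinEquiv.permCongr _ _ fun σ => ?_
  rw [Equiv.Perm.sign_permCongr, map_zsmul_unit]
  congr 1
  simp [Equiv.permCongr_apply]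

/-- The permutation of `Fin (n + 1)` sending `0` to `p`, followed by the others through `e`. -/
theorem sum_perm_succ {A : Type*} [AddCommGroup A] {n : ℕ}
    (H : (Fin (n + 1) → Fin (n + 1)) → A) :
    ∑ σ : Equiv.Perm (Fin (n + 1)), Equiv.Perm.sign σ • H σ =
      ∑ p : Fin (n + 1), (-1 : ℤ) ^ (p : ℕ) • ∑ e : Equiv.Perm (Fin n), Equiv.Perm.sign e •
        H (Fin.cons p (fun i => p.succAbove (e i))) := by
  -- `p.cycleRange.symm` sends 0 to p, preserves the order of the other entries and has sign (-1)^p.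
  -- Composed with the permutations fixing 0 it reaches every permutation once.
  let f : Fin (n + 1) × Equiv.Perm (Fin n) → Equiv.Perm (Fin (n + 1)) := fun q =>
    q.1.cycleRange.symm * Equiv.Perm.decomposeFin.symm (0, q.2)
  have f0 : ∀ q, f q 0 = q.1 := fun q => by simp [f]
  have fs : ∀ q i, f q (Fin.succ i) = q.1.succAbove (q.2 i) := fun q i => by simp [f]
  have hinj : Function.Injective f := by
    rintro ⟨p, e⟩ ⟨p', e'⟩ hq
    have h0 : p = p' := by simpa only [f0] using congrArg (fun g : Equiv.Perm _ => g 0) hq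
    subst h0
    refine Prod.ext rfl (Equiv.ext fun i => ?_)
    apply p.succAbove_right_injective
    simpa only [fs] using congrArg (fun g : Equiv.Perm _ => g i.succ) hq
  have hbij : Function.Bijective f := by
    rw [Fintype.bijective_iff_injective_and_card]
    refine ⟨hinj, ?_⟩
    simp [Fintype.card_perm, Nat.factorial_succ]
  rw [← Function.Bijective.sum_comp hbij, Fintype.sum_prod_type]
  refine Finset.sum_congr rfl fun p _ => ?_
  rw [Finset.smul_sum]
  refine Finset.sum_congr rfl fun e _ => ?_
  have hs : Equiv.Perm.sign (f (p, e)) = (-1) ^ (p : ℕ) * Equiv.Perm.sign e := by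
    simp [f, Fin.sign_cycleRange]
  have hfun : (f (p, e) : Fin (n + 1) → Fin (n + 1)) =
      Fin.cons p (fun i => p.succAbove (e i)) := by
    funext i
    refine Fin.cases ?_ (fun i => ?_) i
    · simp [f0]
    · simp [fs]
  rw [hs, hfun, Units.smul_def, Units.smul_def, ← mul_smul]
  simp

/-- The exterior product of a real covector with a form with values in `F`. -/
def cwedge {k : ℕ} (ξ : V →L[ℝ] ℝ) (α : V [⋀^Fin k]→L[ℝ] F) : V [⋀^Fin (k + 1)]→L[ℝ] F :=
  ContinuousAlternatingMap.alternatizeUncurryFin (ξ.smulRight α)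

theorem cwedge_apply {k : ℕ} (ξ : V →L[ℝ] ℝ) (α : V [⋀^Fin k]→L[ℝ] F) (v : Fin (k + 1) → V) :
    cwedge ξ α v = ∑ p : Fin (k + 1), (-1 : ℤ) ^ (p : ℕ) • ξ (v p) • α (p.removeNth v) := by
  simp [cwedge, ContinuousAlternatingMap.alternatizeUncurryFin_apply]

theorem sum_perm_mul_right {A : Type*} [AddCommGroup A] {n : ℕ} (τ : Equiv.Perm (Fin n))
    (H : (Fin n → Fin n) → A) :
    ∑ σ : Equiv.Perm (Fin n), Equiv.Perm.sign σ • H (σ ∘ τ) =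
      Equiv.Perm.sign τ • ∑ σ : Equiv.Perm (Fin n), Equiv.Perm.sign σ • H σ := by
  rw [Finset.smul_sum]
  refine Fintype.sum_equiv (Equiv.mulRight τ) _ _ fun σ => ?_
  simp only [Equiv.coe_mulRight, Equiv.Perm.sign_mul, Equiv.Perm.coe_mul, smul_smul]
  rw [mul_comm (Equiv.Perm.sign σ), ← mul_assoc, Int.units_mul_self, one_mul]

/-- The one case of associativity that is needed: forms of positive degree are sums of products
`cwedge ξ γ`, so the other rules follow from it by induction on the degree. Multiplied by (k+1)! l!,
both sides become k + 1 times the antisymmetrization of ξ ⊗ α ⊗ β. -/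
theorem cwedge_wedge {k l : ℕ} (ξ : V →L[ℝ] ℝ) (α : V [⋀^Fin k]→L[ℝ] F)
    (β : V [⋀^Fin l]→L[ℝ] F) :
    castDeg (Nat.succ_add k l) (wedge (cwedge ξ α) β) = cwedge ξ (wedge α β) := by
  ext v
  have hN : k + 1 + l = k + l + 1 := Nat.succ_add k l
  let H : (Fin (k + l + 1) → Fin (k + l + 1)) → F := fun s => ξ (v (s 0)) •
    (α (fun i => v (s (Fin.succ (Fin.castAdd l i)))) *
      β (fun i => v (s (Fin.succ (Fin.natAdd k i)))))
  have h1 : ((k + 1).factorial * l.factorial) • castDeg hN (wedge (cwedge ξ α) β) v =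
      (k + 1) • ∑ σ : Equiv.Perm (Fin (k + l + 1)), Equiv.Perm.sign σ • H σ := by
    rw [wedge_perm_sum]
    simp only [cwedge_apply, Finset.sum_mul, Finset.smul_sum]
    rw [Finset.sum_comm]
    -- Precomposing with the cycle that brings position p to the front shows that each of the k + 1
    -- terms of ξ ∧ α contributes the same sum.
    have : ∀ p : Fin (k + 1), ∑ σ : Equiv.Perm (Fin (k + l + 1)), Equiv.Perm.sign σ •
        (((-1 : ℤ) ^ (p : ℕ) • ξ (v (σ (Fin.cast hN (Fin.castAdd l p)))) •
          α (p.removeNth fun i => v (σ (Fin.cast hN (Fin.castAdd l i))))) *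
          β (fun i => v (σ (Fin.cast hN (Fin.natAdd (k + 1) i))))) =
        ∑ σ : Equiv.Perm (Fin (k + l + 1)), Equiv.Perm.sign σ • H σ := by
      intro p
      let q : Fin (k + l + 1) := Fin.cast hN (Fin.castAdd l p)
      have hq : (q : ℕ) = p := rfl
      have hc := sum_perm_mul_right q.cycleRange.symm H
      have hsg : Equiv.Perm.sign q.cycleRange.symm • (Equiv.Perm.sign q.cycleRange.symm •
          ∑ σ : Equiv.Perm (Fin (k + l + 1)), Equiv.Perm.sign σ • H σ) =
          ∑ σ : Equiv.Perm (Fin (k + l + 1)), Equiv.Perm.sign σ • H σ := by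
        rw [smul_smul, Int.units_mul_self, one_smul]
      rw [← hsg, ← hc, Finset.smul_sum]
      refine Finset.sum_congr rfl fun σ _ => ?_
      have hsgn : Equiv.Perm.sign q.cycleRange.symm = (-1) ^ (p : ℕ) := by
        rw [Equiv.Perm.sign_symm, Fin.sign_cycleRange, hq]
      have e0 : q.cycleRange.symm 0 = q := Fin.cycleRange_symm_zero q
      have e1 : ∀ i, q.cycleRange.symm (Fin.succ (Fin.castAdd l i)) =
          Fin.cast hN (Fin.castAdd l (p.succAbove i)) := by
        intro i
        rw [Fin.cycleRange_symm_succ]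
        ext
        simp only [Fin.succAbove, Fin.lt_def, Fin.val_castSucc, hq, Fin.val_castAdd,
          Fin.val_cast]
        split_ifs <;> simp
      have e2 : ∀ i, q.cycleRange.symm (Fin.succ (Fin.natAdd k i)) =
          Fin.cast hN (Fin.natAdd (k + 1) i) := by
        intro i
        rw [Fin.cycleRange_symm_succ]
        ext
        have : ¬ (k + (i : ℕ) < p) := by omega
        simp only [Fin.succAbove, Fin.lt_def, Fin.val_castSucc, hq, Fin.val_natAdd, this,
          Fin.val_cast, Fin.val_succ, if_false]
        omega
      have hH : H (σ ∘ q.cycleRange.symm) = ξ (v (σ q)) •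
          (α (p.removeNth fun i => v (σ (Fin.cast hN (Fin.castAdd l i)))) *
          β (fun i => v (σ (Fin.cast hN (Fin.natAdd (k + 1) i))))) := by
        simp only [H, Function.comp, e0, e1, e2]
        rfl
      rw [hH, hsgn, smul_comm]
      simp [Units.smul_def, q, mul_assoc, mul_left_comm]
    rw [Finset.sum_congr rfl fun p _ => this p]
    simp only [Finset.sum_const, Finset.card_univ, Fintype.card_fin, ← Finset.smul_sum]
  -- Grouping the permutations by their value at 0 turns the antisymmetrization into ξ ∧ (α ∧ β).
  have h2 := sum_perm_succ H
  have h3 : ∀ p : Fin (k + l + 1), ∑ e : Equiv.Perm (Fin (k + l)), Equiv.Perm.sign e •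
      H (Fin.cons p (fun i => p.succAbove (e i))) =
      (k.factorial * l.factorial) • (ξ (v p) • wedge α β (p.removeNth v)) := by
    intro p
    have := wedge_perm_sum rfl α β (p.removeNth v)
    rw [smul_comm]
    change _ = ξ (v p) • (k.factorial * l.factorial) • (castDeg rfl (wedge α β)) (p.removeNth v)
    rw [this, Finset.smul_sum]
    refine Finset.sum_congr rfl fun e _ => ?_
    rw [smul_comm]
    rfl
  rw [h2, Finset.sum_congr rfl fun p _ => congrArg _ (h3 p)] at h1
  have h4 : cwedge ξ (wedge α β) v =
      ∑ p : Fin (k + l + 1), (-1 : ℤ) ^ (p : ℕ) • (ξ (v p) • wedge α β (p.removeNth v)) :=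
    cwedge_apply ξ (wedge α β) v
  have h5 : ((k + 1).factorial * l.factorial) • castDeg hN (wedge (cwedge ξ α) β) v =
      ((k + 1).factorial * l.factorial) • cwedge ξ (wedge α β) v := by
    rw [h1, h4, Nat.factorial_succ, mul_assoc, mul_smul]
    congr 1
    rw [Finset.smul_sum]
    exact Finset.sum_congr rfl fun p _ => smul_comm _ _ _
  have hne : (((k + 1).factorial * l.factorial : ℕ) : ℝ) ≠ 0 := by positivity
  rw [← Nat.cast_smul_eq_nsmul ℝ, ← Nat.cast_smul_eq_nsmul ℝ] at h5
  exact smul_right_injective F hne h5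

end Wedge

end GenCY

end

/-! ### Rules of the exterior product: induction on forms, commutation, contraction. -/

noncomputable section

namespace GenCY

section WedgeAlgebra

variable {V : Type*} [NormedAddCommGroup V] [NormedSpace ℝ V]
variable {F : Type*} [NormedField F] [NormedAlgebra ℝ F]

@[simp] theorem form_smul_zero {k : ℕ} (c : ℝ) : c • (0 : V [⋀^Fin k]→L[ℝ] F) = 0 :=
  smul_zero (A := V [⋀^Fin k]→L[ℝ] F) c

@[simp] theorem form_zero_smul {k : ℕ} (α : V [⋀^Fin k]→L[ℝ] F) : (0 : ℝ) • α = 0 :=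
  zero_smul ℝ α

theorem form_neg_smul {k : ℕ} (c : ℝ) (α : V [⋀^Fin k]→L[ℝ] F) : (-c) • α = -(c • α) :=
  neg_smul c α

@[simp] theorem form_zero_apply {k : ℕ} (v : V) :
    (0 : V [⋀^Fin (k + 1)]→L[ℝ] F).curryLeft v = 0 := by
  ext; rfl

theorem wedge_apply_eq_sum {k l : ℕ} (α : V [⋀^Fin k]→L[ℝ] F)
    (β : V [⋀^Fin l]→L[ℝ] F) (v : Fin (k + l) → V) :
    wedge α β v = ((k.factorial * l.factorial : ℕ) : ℝ)⁻¹ •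
      ∑ σ : Equiv.Perm (Fin (k + l)), Equiv.Perm.sign σ •
        (α (fun i => v (σ (Fin.castAdd l i))) * β (fun i => v (σ (Fin.natAdd k i)))) := by
  have h := wedge_perm_sum rfl α β v
  rw [← Nat.cast_smul_eq_nsmul ℝ] at h
  rw [eq_inv_smul_iff₀ (by positivity)]
  exact h

theorem wedge_add_left {k l : ℕ} (α α' : V [⋀^Fin k]→L[ℝ] F) (β : V [⋀^Fin l]→L[ℝ] F) :
    wedge (α + α') β = wedge α β + wedge α' β := by
  ext v
  simp [wedge_apply_eq_sum, add_mul, Finset.sum_add_distrib]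

theorem wedge_add_right {k l : ℕ} (α : V [⋀^Fin k]→L[ℝ] F) (β β' : V [⋀^Fin l]→L[ℝ] F) :
    wedge α (β + β') = wedge α β + wedge α β' := by
  ext v
  simp [wedge_apply_eq_sum, mul_add, Finset.sum_add_distrib]

theorem wedge_smul_left {k l : ℕ} {S : Type*} [Monoid S] [DistribMulAction S F]
    [ContinuousConstSMul S F] [SMulCommClass ℝ S F] [IsScalarTower S F F]
    (c : S) (α : V [⋀^Fin k]→L[ℝ] F) (β : V [⋀^Fin l]→L[ℝ] F) :
    wedge (c • α) β = c • wedge α β := by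
  ext v
  simp only [wedge_apply_eq_sum, ContinuousAlternatingMap.smul_apply, smul_mul_assoc,
    smul_comm _ c, Finset.smul_sum]

theorem wedge_smul_right {k l : ℕ} {S : Type*} [Monoid S] [DistribMulAction S F]
    [ContinuousConstSMul S F] [SMulCommClass ℝ S F] [SMulCommClass S F F]
    (c : S) (α : V [⋀^Fin k]→L[ℝ] F) (β : V [⋀^Fin l]→L[ℝ] F) :
    wedge α (c • β) = c • wedge α β := by
  ext v
  simp only [wedge_apply_eq_sum, ContinuousAlternatingMap.smul_apply, mul_smul_comm,
    smul_comm _ c, Finset.smul_sum]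

/-- The exterior product as a bilinear map. -/
def wedgeₗ (k l : ℕ) : (V [⋀^Fin k]→L[ℝ] F) →ₗ[ℝ] (V [⋀^Fin l]→L[ℝ] F) →ₗ[ℝ]
    V [⋀^Fin (k + l)]→L[ℝ] F :=
  LinearMap.mk₂ ℝ wedge wedge_add_left wedge_smul_left wedge_add_right wedge_smul_right

theorem wedgeₗ_apply {k l : ℕ} (α : V [⋀^Fin k]→L[ℝ] F) (β : V [⋀^Fin l]→L[ℝ] F) :
    wedgeₗ k l α β = wedge α β := rfl

theorem wedge_zero_right' {k l : ℕ} (α : V [⋀^Fin k]→L[ℝ] F) :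
    wedge α (0 : V [⋀^Fin l]→L[ℝ] F) = 0 := (wedgeₗ k l α).map_zero

theorem zero_wedge {k l : ℕ} (β : V [⋀^Fin l]→L[ℝ] F) :
    wedge (0 : V [⋀^Fin k]→L[ℝ] F) β = 0 := LinearMap.map_zero₂ (wedgeₗ k l) β

theorem wedge_neg_right {k l : ℕ} (α : V [⋀^Fin k]→L[ℝ] F) (β : V [⋀^Fin l]→L[ℝ] F) :
    wedge α (-β) = -wedge α β := (wedgeₗ k l α).map_neg β

theorem wedge_neg_left {k l : ℕ} (α : V [⋀^Fin k]→L[ℝ] F) (β : V [⋀^Fin l]→L[ℝ] F) :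
    wedge (-α) β = -wedge α β := LinearMap.map_neg₂ (wedgeₗ k l) α β

theorem wedge_sub_left {k l : ℕ} (α α' : V [⋀^Fin k]→L[ℝ] F) (β : V [⋀^Fin l]→L[ℝ] F) :
    wedge (α - α') β = wedge α β - wedge α' β := LinearMap.map_sub₂ (wedgeₗ k l) α α' β

theorem wedge_compContinuousLinearMap {V' : Type*} [NormedAddCommGroup V'] [NormedSpace ℝ V']
    {k l : ℕ} (α : V [⋀^Fin k]→L[ℝ] F) (β : V [⋀^Fin l]→L[ℝ] F) (A : V' →L[ℝ] V) :
    (wedge α β).compContinuousLinearMap A =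
      wedge (α.compContinuousLinearMap A) (β.compContinuousLinearMap A) := by
  ext v
  simp [wedge_apply_eq_sum, Function.comp_def]

theorem comp_wedge {F' : Type*} [NormedField F'] [NormedAlgebra ℝ F'] {k l : ℕ} (f : F →L[ℝ] F')
    (hf : ∀ x y, f (x * y) = f x * f y) (α : V [⋀^Fin k]→L[ℝ] F) (β : V [⋀^Fin l]→L[ℝ] F) :
    f.compContinuousAlternatingMap (wedge α β) =
      wedge (f.compContinuousAlternatingMap α) (f.compContinuousAlternatingMap β) := by
  ext v
  simp only [wedge_apply_eq_sum, ContinuousLinearMap.compContinuousAlternatingMap_coe,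
    Function.comp_apply, map_smul, map_sum, map_zsmul, Units.smul_def, hf]

theorem wedge_of_degree_zero {l : ℕ} (α : V [⋀^Fin 0]→L[ℝ] F) (β : V [⋀^Fin l]→L[ℝ] F) :
    castDeg (Nat.zero_add l) (wedge α β) = α 0 • β := by
  ext v
  have h := wedge_perm_sum (Nat.zero_add l) α β v
  have h2 : ∀ σ : Equiv.Perm (Fin l), Equiv.Perm.sign σ •
      (α (fun i => v (σ (Fin.cast (Nat.zero_add l) (Fin.castAdd l i)))) *
          β (fun i => v (σ (Fin.cast (Nat.zero_add l) (Fin.natAdd 0 i))))) = α 0 * β v := by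
    intro σ
    have e1 : (fun i : Fin 0 => v (σ (Fin.cast (Nat.zero_add l) (Fin.castAdd l i)))) = 0 :=
      Subsingleton.elim _ _
    have e2 : (fun i => v (σ (Fin.cast (Nat.zero_add l) (Fin.natAdd 0 i)))) = v ∘ σ := by
      funext i
      simp
    have e3 : β (v ∘ σ) = Equiv.Perm.sign σ • β v := β.toAlternatingMap.map_perm v σ
    rw [e1, e2, e3, mul_smul_comm, smul_smul, Int.units_mul_self, one_smul]
  rw [Finset.sum_congr rfl fun σ _ => h2 σ] at h
  simp only [Nat.factorial_zero, one_mul, Finset.sum_const, Finset.card_univ, Fintype.card_perm,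
    Fintype.card_fin] at h
  rw [← Nat.cast_smul_eq_nsmul ℝ, ← Nat.cast_smul_eq_nsmul ℝ] at h
  have := smul_right_injective F (show (l.factorial : ℝ) ≠ 0 by positivity) h
  simpa using this

theorem castDeg_castDeg {k l m : ℕ} (h : k = l) (h' : l = m) (α : V [⋀^Fin k]→L[ℝ] F) :
    castDeg h' (castDeg h α) = castDeg (h.trans h') α := by subst h h'; rfl

theorem castDeg_rfl {k : ℕ} (h : k = k) (α : V [⋀^Fin k]→L[ℝ] F) : castDeg h α = α := rfl

theorem castDeg_add {k l : ℕ} (h : k = l) (α β : V [⋀^Fin k]→L[ℝ] F) :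
    castDeg h (α + β) = castDeg h α + castDeg h β := by subst h; rfl

theorem castDeg_smul {k l : ℕ} (h : k = l) (c : ℝ) (α : V [⋀^Fin k]→L[ℝ] F) :
    castDeg h (c • α) = c • castDeg h α := by subst h; rfl

theorem castDeg_neg {k l : ℕ} (h : k = l) (α : V [⋀^Fin k]→L[ℝ] F) :
    castDeg h (-α) = -castDeg h α := by subst h; rfl

theorem castDeg_zero {k l : ℕ} (h : k = l) :
    castDeg h (0 : V [⋀^Fin k]→L[ℝ] F) = 0 := by subst h; rfl

theorem cwedge_castDeg {k l : ℕ} (h : k = l) (ξ : V →L[ℝ] ℝ) (α : V [⋀^Fin k]→L[ℝ] F) :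
    cwedge ξ (castDeg h α) = castDeg (congrArg (· + 1) h) (cwedge ξ α) := by subst h; rfl

theorem wedge_castDeg_left {k k' l : ℕ} (h : k = k') (α : V [⋀^Fin k]→L[ℝ] F)
    (β : V [⋀^Fin l]→L[ℝ] F) :
    wedge (castDeg h α) β = castDeg (congrArg (· + l) h) (wedge α β) := by subst h; rfl

theorem curryLeft_castDeg {k l : ℕ} (h : k = l) (α : V [⋀^Fin (k + 1)]→L[ℝ] F) (v : V) :
    (castDeg (congrArg (· + 1) h) α).curryLeft v = castDeg h (α.curryLeft v) := by
  subst h; rfl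

theorem curryLeft_castDeg' {k l : ℕ} (h : k + 1 = l + 1) (α : V [⋀^Fin (k + 1)]→L[ℝ] F) (v : V) :
    (castDeg h α).curryLeft v = castDeg (Nat.succ_injective h) (α.curryLeft v) :=
  curryLeft_castDeg (Nat.succ_injective h) α v

theorem curryLeft_add_apply {k : ℕ} (α β : V [⋀^Fin (k + 1)]→L[ℝ] F) (v : V) :
    (α + β).curryLeft v = α.curryLeft v + β.curryLeft v := rfl

theorem curryLeft_smul_apply {k : ℕ} (c : ℝ) (α : V [⋀^Fin (k + 1)]→L[ℝ] F) (v : V) :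
    (c • α).curryLeft v = c • α.curryLeft v := rfl

theorem cwedge_add {k : ℕ} (ξ : V →L[ℝ] ℝ) (α β : V [⋀^Fin k]→L[ℝ] F) :
    cwedge ξ (α + β) = cwedge ξ α + cwedge ξ β := by
  ext v; simp [cwedge_apply, Finset.sum_add_distrib]

theorem cwedge_smul {k : ℕ} (c : ℝ) (ξ : V →L[ℝ] ℝ) (α : V [⋀^Fin k]→L[ℝ] F) :
    cwedge ξ (c • α) = c • cwedge ξ α := by
  ext v
  simp only [cwedge_apply, ContinuousAlternatingMap.smul_apply, Finset.smul_sum]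
  exact Finset.sum_congr rfl fun p _ => by
    rw [smul_comm (ξ (v p)) c, smul_comm _ c]

theorem add_cwedge {k : ℕ} (ξ η : V →L[ℝ] ℝ) (α : V [⋀^Fin k]→L[ℝ] F) :
    cwedge (ξ + η) α = cwedge ξ α + cwedge η α := by
  ext v; simp [cwedge_apply, Finset.sum_add_distrib, add_smul]

theorem smul_cwedge {k : ℕ} (c : ℝ) (ξ : V →L[ℝ] ℝ) (α : V [⋀^Fin k]→L[ℝ] F) :
    cwedge (c • ξ) α = c • cwedge ξ α := by
  ext v
  simp only [cwedge_apply, ContinuousAlternatingMap.smul_apply, Finset.smul_sum, smul_apply,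
    smul_assoc]
  exact Finset.sum_congr rfl fun p _ => smul_comm _ c _

/-- `ξ ∧ α` as a bilinear map. -/
def cwedgeₗ (k : ℕ) : (V →L[ℝ] ℝ) →ₗ[ℝ] (V [⋀^Fin k]→L[ℝ] F) →ₗ[ℝ] V [⋀^Fin (k + 1)]→L[ℝ] F :=
  LinearMap.mk₂ ℝ cwedge add_cwedge smul_cwedge cwedge_add cwedge_smul

theorem cwedgeₗ_apply {k : ℕ} (ξ : V →L[ℝ] ℝ) (α : V [⋀^Fin k]→L[ℝ] F) :
    cwedgeₗ k ξ α = cwedge ξ α := rfl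

theorem cwedge_neg {k : ℕ} (ξ : V →L[ℝ] ℝ) (α : V [⋀^Fin k]→L[ℝ] F) :
    cwedge ξ (-α) = -cwedge ξ α := (cwedgeₗ k ξ).map_neg α

theorem cwedge_sub {k : ℕ} (ξ : V →L[ℝ] ℝ) (α β : V [⋀^Fin k]→L[ℝ] F) :
    cwedge ξ (α - β) = cwedge ξ α - cwedge ξ β := (cwedgeₗ k ξ).map_sub α β

theorem cwedge_zero {k : ℕ} (ξ : V →L[ℝ] ℝ) : cwedge ξ (0 : V [⋀^Fin k]→L[ℝ] F) = 0 :=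
  (cwedgeₗ k ξ).map_zero

theorem curryLeft_cwedge_zero (ξ : V →L[ℝ] ℝ) (α : V [⋀^Fin 0]→L[ℝ] F) (v : V) :
    (cwedge ξ α).curryLeft v = ξ v • α := by
  ext u
  simp [cwedge_apply, Matrix.vecCons]

theorem curryLeft_cwedge {k : ℕ} (ξ : V →L[ℝ] ℝ) (α : V [⋀^Fin (k + 1)]→L[ℝ] F) (v : V) :
    (cwedge ξ α).curryLeft v = ξ v • α - cwedge ξ (α.curryLeft v) := by
  ext u
  simp only [ContinuousAlternatingMap.curryLeft_apply_apply, cwedge_apply,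
    ContinuousAlternatingMap.smul_apply, ContinuousAlternatingMap.sub_apply]
  rw [Fin.sum_univ_succ, sub_eq_add_neg, ← Finset.sum_neg_distrib]
  congr 1
  · simp [Fin.removeNth_zero]
  · refine Finset.sum_congr rfl fun p _ => ?_
    have : p.succ.removeNth (Matrix.vecCons v u) = Matrix.vecCons v (p.removeNth u) := by
      funext i
      refine Fin.cases ?_ (fun i => ?_) i
      · simp [Fin.removeNth]
      · simp [Fin.removeNth]
    rw [this]
    simp [pow_succ]

/-- Euler's identity: the operator ∑ eᵃ ∧ ι(e_a) counts the degree. -/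
theorem sum_cwedge_curryLeft {ι : Type*} [Fintype ι] [FiniteDimensional ℝ V]
    (b : Module.Basis ι ℝ V) {k : ℕ} (α : V [⋀^Fin (k + 1)]→L[ℝ] F) :
    ∑ a, cwedge (LinearMap.toContinuousLinearMap (b.coord a)) (α.curryLeft (b a)) =
      ((k : ℝ) + 1) • α := by
  ext v
  have h1 := congrArg (fun β => β v) (ContinuousAlternatingMap.alternatizeUncurryFin_curryLeft α)
  rw [ContinuousAlternatingMap.alternatizeUncurryFin_apply] at h1
  have h2 : ∀ p : Fin (k + 1), α.curryLeft (v p) (p.removeNth v) =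
      ∑ a, b.coord a (v p) • α.curryLeft (b a) (p.removeNth v) := by
    intro p
    conv_lhs => rw [← b.sum_repr (v p), map_sum, ContinuousAlternatingMap.sum_apply]
    exact Finset.sum_congr rfl fun a _ => by rw [map_smul]; rfl
  simp only [ContinuousAlternatingMap.sum_apply, cwedge_apply, LinearMap.coe_toContinuousLinearMap']
  rw [Finset.sum_comm]
  rw [ContinuousAlternatingMap.smul_apply, add_smul, one_smul, Nat.cast_smul_eq_nsmul]
  simp only [add_smul, one_smul, ContinuousAlternatingMap.add_apply,
    ContinuousAlternatingMap.smul_apply] at h1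
  rw [← h1]
  refine Finset.sum_congr rfl fun p _ => ?_
  rw [h2, Finset.smul_sum]

/-- Dividing Euler's identity by the degree exhibits a form as a sum of products ξ ∧ γ, so additive
properties need checking on such products only. -/
theorem form_induction [FiniteDimensional ℝ V] {k : ℕ}
    {P : (V [⋀^Fin (k + 1)]→L[ℝ] F) → Prop} (h0 : P 0)
    (hadd : ∀ α β, P α → P β → P (α + β)) (hw : ∀ ξ γ, P (cwedge ξ γ))
    (α : V [⋀^Fin (k + 1)]→L[ℝ] F) : P α := by
  have hb := sum_cwedge_curryLeft (Module.finBasis ℝ V) α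
  have hα : α = ∑ a, cwedge (((k : ℝ) + 1)⁻¹ •
      LinearMap.toContinuousLinearMap ((Module.finBasis ℝ V).coord a))
      (α.curryLeft (Module.finBasis ℝ V a)) := by
    simp only [smul_cwedge]
    rw [← Finset.smul_sum, hb, smul_smul, inv_mul_cancel₀ (by positivity), one_smul]
  rw [hα]
  exact Finset.sum_induction _ P hadd h0 fun a _ => hw _ _

theorem ext_curryLeft {k : ℕ} {α β : V [⋀^Fin (k + 1)]→L[ℝ] F}
    (h : ∀ v, α.curryLeft v = β.curryLeft v) : α = β := by
  ext u
  have := congrArg (fun γ => γ (Fin.tail u)) (h (u 0))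
  simpa [ContinuousAlternatingMap.curryLeft_apply_apply, Matrix.vecCons] using this

/-- A form of positive degree is determined by its contractions, and contraction lowers the degree:
hence an induction. -/
theorem cwedge_anticomm {k : ℕ} (ξ η : V →L[ℝ] ℝ) (α : V [⋀^Fin k]→L[ℝ] F) :
    cwedge ξ (cwedge η α) = -cwedge η (cwedge ξ α) := by
  rw [eq_neg_iff_add_eq_zero]
  induction k with
  | zero =>
    refine ext_curryLeft fun v => ?_
    rw [ContinuousAlternatingMap.curryLeft_add, add_apply, curryLeft_cwedge, curryLeft_cwedge,
      curryLeft_cwedge_zero, curryLeft_cwedge_zero, cwedge_smul, cwedge_smul,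
      ContinuousAlternatingMap.curryLeft_zero]
    simp
  | succ k ih =>
    refine ext_curryLeft fun v => ?_
    have := ih (α.curryLeft v)
    rw [ContinuousAlternatingMap.curryLeft_add, add_apply, curryLeft_cwedge, curryLeft_cwedge,
      curryLeft_cwedge, curryLeft_cwedge, cwedge_sub, cwedge_sub, cwedge_smul, cwedge_smul,
      ContinuousAlternatingMap.curryLeft_zero]
    simp only [zero_apply]
    rw [← this]
    abel

variable [FiniteDimensional ℝ V]

theorem wedge_cwedge {k l : ℕ} (ξ : V →L[ℝ] ℝ) (α : V [⋀^Fin k]→L[ℝ] F)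
    (β : V [⋀^Fin l]→L[ℝ] F) :
    wedge α (cwedge ξ β) = (-1 : ℝ) ^ k • cwedge ξ (wedge α β) := by
  induction k with
  | zero =>
    have h1 := wedge_of_degree_zero α (cwedge ξ β)
    have h2 := wedge_of_degree_zero α β
    have h3 : castDeg (Nat.zero_add (l + 1)) (cwedge ξ (wedge α β)) = cwedge ξ (α 0 • β) := by
      rw [← h2, cwedge_castDeg]
    rw [pow_zero, one_smul]
    have h4 : cwedge ξ (α 0 • β) = α 0 • cwedge ξ β := by
      ext v
      simp only [cwedge_apply, ContinuousAlternatingMap.smul_apply, Finset.smul_sum]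
      exact Finset.sum_congr rfl fun p _ => by rw [smul_comm (ξ (v p)) (α 0), smul_comm _ (α 0)]
    rw [h4, ← h1] at h3
    have h5 := congrArg (castDeg (Nat.zero_add (l + 1)).symm) h3
    rw [castDeg_castDeg, castDeg_castDeg] at h5
    exact h5.symm
  | succ k ih =>
    induction α using form_induction with
    | h0 => simp only [zero_wedge, cwedge_zero, form_smul_zero]
    | hadd α α' h h' => rw [wedge_add_left, wedge_add_left, cwedge_add, smul_add, h, h']
    | hw η γ =>
      have h1 := congrArg (castDeg (Nat.succ_add k (l + 1)).symm) (cwedge_wedge η γ (cwedge ξ β))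
      have h2 := congrArg (castDeg (Nat.succ_add k l).symm) (cwedge_wedge η γ β)
      rw [castDeg_castDeg, castDeg_rfl] at h1 h2
      rw [h1, h2, ih, cwedge_smul, cwedge_castDeg, cwedge_anticomm, pow_succ, castDeg_smul,
        castDeg_neg]
      module

theorem wedge_comm_of_degree_zero {k : ℕ} (α : V [⋀^Fin k]→L[ℝ] F) (β : V [⋀^Fin 0]→L[ℝ] F) :
    wedge α β = β 0 • α := by
  induction k with
  | zero =>
    have h := wedge_of_degree_zero α β
    rw [castDeg_rfl] at h
    rw [h]
    ext v
    simp [Subsingleton.elim v 0, mul_comm]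
  | succ k ih =>
    induction α using form_induction with
    | h0 => simp only [zero_wedge]; ext; simp
    | hadd α α' h h' => rw [wedge_add_left, h, h', smul_add]
    | hw η γ =>
      have h1 := congrArg (castDeg (Nat.succ_add k 0).symm) (cwedge_wedge η γ β)
      rw [castDeg_castDeg, castDeg_rfl, ih] at h1
      rw [h1]
      ext v
      rw [castDeg_rfl]
      simp only [cwedge_apply, ContinuousAlternatingMap.smul_apply, Finset.smul_sum]
      exact Finset.sum_congr rfl fun p _ => by rw [smul_comm (η (v p)) (β 0), smul_comm _ (β 0)]

theorem wedge_comm {k l : ℕ} (α : V [⋀^Fin k]→L[ℝ] F) (β : V [⋀^Fin l]→L[ℝ] F) :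
    castDeg (Nat.add_comm k l) (wedge α β) = (-1 : ℝ) ^ (k * l) • wedge β α := by
  induction k with
  | zero =>
    rw [wedge_comm_of_degree_zero, Nat.zero_mul, pow_zero, one_smul, ← wedge_of_degree_zero]
  | succ k ih =>
    induction α using form_induction with
    | h0 => simp only [zero_wedge, wedge_zero_right', form_smul_zero, castDeg_zero]
    | hadd α α' h h' => rw [wedge_add_left, wedge_add_right, castDeg_add, h, h', smul_add]
    | hw η γ =>
      have h1 := congrArg (castDeg (congrArg (· + 1) (Nat.add_comm k l))) (cwedge_wedge η γ β)
      rw [castDeg_castDeg, ← cwedge_castDeg (Nat.add_comm k l), ih, cwedge_smul] at h1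
      rw [wedge_cwedge, smul_smul]
      have h2 : (-1 : ℝ) ^ ((k + 1) * l) * (-1) ^ l = (-1) ^ (k * l) := by
        rw [← pow_add, show (k + 1) * l + l = k * l + 2 * l by ring, pow_add, pow_mul _ 2 l]
        simp
      rw [h2]
      exact h1

/-- Contraction is a graded derivation. The degrees k + 1 and l + 1 are those in which both
contractions exist; in the base case the factor left over has degree 0 and acts as a scalar. -/
theorem curryLeft_wedge {k l : ℕ} (α : V [⋀^Fin (k + 1)]→L[ℝ] F) (β : V [⋀^Fin (l + 1)]→L[ℝ] F)
    (v : V) :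
    (castDeg (Nat.succ_add k (l + 1)) (wedge α β)).curryLeft v =
      wedge (α.curryLeft v) β +
        (-1 : ℝ) ^ (k + 1) • castDeg (Nat.succ_add k l) (wedge α (β.curryLeft v)) := by
  induction k with
  | zero =>
    induction α using form_induction with
    | h0 => simp [zero_wedge, castDeg_zero]
    | hadd α α' h h' =>
      rw [wedge_add_left, castDeg_add, curryLeft_add_apply, h, h', curryLeft_add_apply,
        wedge_add_left, wedge_add_left, castDeg_add]
      module
    | hw η γ =>
      rw [cwedge_wedge, curryLeft_cwedge_zero, curryLeft_cwedge, wedge_smul_left, cwedge_wedge]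
      have h1 := congrArg (fun δ => ContinuousAlternatingMap.curryLeft δ v)
        (wedge_of_degree_zero γ β)
      rw [curryLeft_castDeg (Nat.zero_add l)] at h1
      have h2 : castDeg (Nat.zero_add l) ((wedge γ β).curryLeft v) =
          castDeg (Nat.zero_add l) (wedge γ (β.curryLeft v)) := by
        rw [h1, wedge_of_degree_zero]
        ext; rfl
      have h3 := congrArg (castDeg (Nat.zero_add l).symm) h2
      rw [castDeg_castDeg, castDeg_castDeg, castDeg_rfl, castDeg_rfl] at h3
      rw [h3]
      module
  | succ k ih =>
    induction α using form_induction with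
    | h0 => simp [zero_wedge, castDeg_zero]
    | hadd α α' h h' =>
      rw [wedge_add_left, castDeg_add, curryLeft_add_apply, h, h', curryLeft_add_apply,
        wedge_add_left, wedge_add_left, castDeg_add]
      module
    | hw η γ =>
      have hd : k + (l + 1) = k + 1 + l := (Nat.succ_add k l).symm
      have h1 : (wedge γ β).curryLeft v = castDeg hd
          ((castDeg (Nat.succ_add k (l + 1)) (wedge γ β)).curryLeft v) := by
        rw [curryLeft_castDeg', castDeg_castDeg, castDeg_rfl]
      have h2 := congrArg (castDeg (Nat.succ_add k (l + 1)).symm)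
        (cwedge_wedge η (γ.curryLeft v) β)
      rw [castDeg_castDeg, castDeg_rfl] at h2
      rw [cwedge_wedge, curryLeft_cwedge, h1, ih, curryLeft_cwedge, cwedge_wedge,
        wedge_sub_left, h2, wedge_smul_left, castDeg_add, castDeg_smul,
        castDeg_castDeg, castDeg_rfl, cwedge_add, cwedge_smul, cwedge_castDeg, pow_succ _ (k + 1)]
      module

end WedgeAlgebra

end GenCY

end

/-! ### The Clifford module of V ⊕ V* and its invariant pairing. -/

noncomputable section

namespace GenCY

section Spinors

variable {V : Type*} [NormedAddCommGroup V] [NormedSpace ℝ V]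

theorem clifford_zero (w : V × (V →L[ℝ] ℝ)) (ρ : Spinor V ℝ) :
    clifford w ρ 0 = (ρ 1).curryLeft w.1 := rfl

theorem clifford_succ (w : V × (V →L[ℝ] ℝ)) (ρ : Spinor V ℝ) (k : ℕ) :
    clifford w ρ (k + 1) = (ρ (k + 2)).curryLeft w.1 + cwedge w.2 (ρ k) := rfl

theorem curryLeft_curryLeft_anticomm {F : Type*} [NormedField F] [NormedAlgebra ℝ F] {k : ℕ}
    (α : V [⋀^Fin (k + 2)]→L[ℝ] F) (u v : V) :
    (α.curryLeft u).curryLeft v = -(α.curryLeft v).curryLeft u := by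
  have h := ContinuousAlternatingMap.curryLeft_same α (u + v)
  simp only [map_add, curryLeft_add_apply, ContinuousAlternatingMap.curryLeft_same, zero_add,
    add_zero] at h
  rw [eq_neg_iff_add_eq_zero, add_comm]
  simpa using h

/-- The invariant symmetric form on `V ⊕ V*`. -/
def wittForm : (V × (V →L[ℝ] ℝ)) →ₗ[ℝ] (V × (V →L[ℝ] ℝ)) →ₗ[ℝ] ℝ :=
  LinearMap.mk₂ ℝ (fun w w' => w.2 w'.1 + w'.2 w.1)
    (fun a b c => by simp; ring) (fun r a b => by simp; ring)
    (fun a b c => by simp; ring) (fun r a b => by simp; ring)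

theorem wittForm_apply (w w' : V × (V →L[ℝ] ℝ)) : wittForm w w' = w.2 w'.1 + w'.2 w.1 := rfl

theorem wittForm_comm (w w' : V × (V →L[ℝ] ℝ)) : wittForm w w' = wittForm w' w := by
  rw [wittForm_apply, wittForm_apply, add_comm]

/-- The Clifford action as a bilinear map. -/
def cliffordₗ : (V × (V →L[ℝ] ℝ)) →ₗ[ℝ] Spinor V ℝ →ₗ[ℝ] Spinor V ℝ :=
  LinearMap.mk₂ ℝ clifford
    (fun a b ρ => by
      funext k
      cases k with
      | zero => simp [clifford_zero]
      | succ k =>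
        simp only [clifford_succ, Pi.add_apply, Prod.fst_add, Prod.snd_add, map_add, add_cwedge]
        abel)
    (fun r a ρ => by
      funext k
      cases k with
      | zero => simp [clifford_zero]
      | succ k => simp [clifford_succ, smul_cwedge])
    (fun a ρ σ => by
      funext k
      cases k with
      | zero => simp [clifford_zero]
      | succ k =>
        simp only [clifford_succ, Pi.add_apply, cwedge_add, curryLeft_add_apply]
        abel)
    (fun r a ρ => by
      funext k
      cases k with
      | zero => simp [clifford_zero]
      | succ k => simp [clifford_succ, cwedge_smul])

theorem cliffordₗ_apply (w : V × (V →L[ℝ] ℝ)) (ρ : Spinor V ℝ) : cliffordₗ w ρ = clifford w ρ := rfl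

/-- Contractions anticommute, products with covectors anticommute, and the mixed terms leave ξ(v') +
ξ'(v). This is the Clifford relation. -/
theorem clifford_clifford_add (w w' : V × (V →L[ℝ] ℝ)) (ρ : Spinor V ℝ) :
    clifford w (clifford w' ρ) + clifford w' (clifford w ρ) = wittForm w w' • ρ := by
  funext k
  rw [Pi.add_apply, Pi.smul_apply, wittForm_apply, add_smul]
  match k with
  | 0 =>
    rw [clifford_zero, clifford_zero, clifford_succ, clifford_succ, curryLeft_add_apply,
      curryLeft_add_apply, curryLeft_cwedge_zero, curryLeft_cwedge_zero,
      curryLeft_curryLeft_anticomm]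
    abel
  | 1 =>
    rw [clifford_succ, clifford_succ, clifford_succ, clifford_succ, clifford_zero, clifford_zero,
      curryLeft_add_apply, curryLeft_add_apply, curryLeft_cwedge, curryLeft_cwedge,
      curryLeft_curryLeft_anticomm]
    abel
  | k + 2 =>
    rw [clifford_succ, clifford_succ, clifford_succ, clifford_succ, clifford_succ, clifford_succ,
      curryLeft_add_apply, curryLeft_add_apply, curryLeft_cwedge, curryLeft_cwedge,
      curryLeft_curryLeft_anticomm, cwedge_add, cwedge_add, cwedge_anticomm w.2]
    abel

section Dim

variable [FiniteDimensional ℝ V]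

theorem finiteDimensional_form {F : Type*} [NormedAddCommGroup F] [NormedSpace ℝ F]
    [FiniteDimensional ℝ F] (k : ℕ) : FiniteDimensional ℝ (V [⋀^Fin k]→L[ℝ] F) := by
  let f : (V [⋀^Fin k]→L[ℝ] F) →ₗ[ℝ] MultilinearMap ℝ (fun _ : Fin k => V) F :=
    { toFun := fun α => α.toMultilinearMap
      map_add' := fun _ _ => rfl
      map_smul' := fun _ _ => rfl }
  have hf : Function.Injective f := fun α β h => by
    ext v
    exact congrArg (fun m : MultilinearMap ℝ (fun _ : Fin k => V) F => m v) h
  exact FiniteDimensional.of_injective f hf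

theorem form_eq_zero_of_finrank_lt {F : Type*} [NormedField F] [NormedAlgebra ℝ F] {k : ℕ}
    (h : Module.finrank ℝ V < k) (α : V [⋀^Fin k]→L[ℝ] F) : α = 0 := by
  ext v
  exact α.toAlternatingMap.map_linearDependent v fun hv => by
    have := hv.fintype_card_le_finrank
    simp at this
    omega

end Dim

section Six

variable [FiniteDimensional ℝ V] [hV : Fact (Module.finrank ℝ V = 6)]

theorem form_eq_zero {F : Type*} [NormedField F] [NormedAlgebra ℝ F] {k : ℕ}
    (h : 6 < k) (α : V [⋀^Fin k]→L[ℝ] F) : α = 0 :=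
  form_eq_zero_of_finrank_lt (hV.out ▸ h) α

theorem finiteDimensional_spinor : FiniteDimensional ℝ (Spinor V ℝ) := by
  have : ∀ k, FiniteDimensional ℝ (V [⋀^Fin k]→L[ℝ] ℝ) := finiteDimensional_form
  let f : Spinor V ℝ →ₗ[ℝ] ∀ k : Fin 7, V [⋀^Fin (k : ℕ)]→L[ℝ] ℝ :=
    { toFun := fun ρ k => ρ k
      map_add' := fun _ _ => rfl
      map_smul' := fun _ _ => rfl }
  refine FiniteDimensional.of_injective f fun ρ σ h => ?_
  funext k
  by_cases hk : k < 7
  · exact congrFun h ⟨k, hk⟩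
  · rw [form_eq_zero (by omega) (ρ k), form_eq_zero (by omega) (σ k)]

omit [FiniteDimensional ℝ V] hV in
theorem mukai_eq {F : Type*} [NormedField F] [NormedAlgebra ℝ F] (φ ψ : Spinor V F) :
    mukai φ ψ = ((wedge (φ 0) (ψ 6) :) : V [⋀^Fin 6]→L[ℝ] F) + (wedge (φ 1) (ψ 5) :)
      - (wedge (φ 2) (ψ 4) :) - (wedge (φ 3) (ψ 3) :) + (wedge (φ 4) (ψ 2) :)
      + (wedge (φ 5) (ψ 1) :) - (wedge (φ 6) (ψ 0) :) := by
  simp only [mukai, Fin.sum_univ_seven]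
  norm_num
  simp [sub_eq_add_neg, castDeg, form_neg_smul]

/-- The product α ∧ β has degree 7 and vanishes, so the Leibniz rule for its contraction moves the
contraction from one factor to the other. -/
theorem wedge_curryLeft_top {F : Type*} [NormedField F] [NormedAlgebra ℝ F] {k l : ℕ}
    (h : k + (l + 1) = 6) (v : V) (α : V [⋀^Fin (k + 1)]→L[ℝ] F) (β : V [⋀^Fin (l + 1)]→L[ℝ] F) :
    castDeg h (wedge (α.curryLeft v) β) =
      (-1 : ℝ) ^ k • castDeg ((Nat.succ_add k l).trans h) (wedge α (β.curryLeft v)) := by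
  have h1 := curryLeft_wedge α β v
  rw [form_eq_zero (by omega) (castDeg _ (wedge α β)), form_zero_apply] at h1
  have h2 := congrArg (castDeg h) h1
  rw [castDeg_zero, castDeg_add, castDeg_smul, castDeg_castDeg, pow_succ] at h2
  rw [eq_neg_of_add_eq_zero_left h2.symm]
  module

omit hV in
theorem wedge_cwedge_swap {F : Type*} [NormedField F] [NormedAlgebra ℝ F] {k l n : ℕ}
    (h : k + (l + 1) = n) (ξ : V →L[ℝ] ℝ) (α : V [⋀^Fin k]→L[ℝ] F) (β : V [⋀^Fin l]→L[ℝ] F) :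
    castDeg ((Nat.succ_add k l).trans h) (wedge (cwedge ξ α) β) =
      (-1 : ℝ) ^ k • castDeg h (wedge α (cwedge ξ β)) := by
  subst h
  rw [cwedge_wedge, wedge_cwedge, castDeg_rfl, smul_smul, ← mul_pow]
  simp

/-- The signs in the pairing are those that make each element of V ⊕ V* self-adjoint. For vectors
this uses the vanishing of 7-forms, for covectors only the commutation of ξ past a factor. -/
theorem mukai_clifford (w : V × (V →L[ℝ] ℝ)) (φ ψ : Spinor V ℝ) :
    mukai (clifford w φ) ψ = mukai φ (clifford w ψ) := by
  have a0 := wedge_curryLeft_top (k := 0) (l := 5) rfl w.1 (φ 1) (ψ 6)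
  have a1 := wedge_curryLeft_top (k := 1) (l := 4) rfl w.1 (φ 2) (ψ 5)
  have a2 := wedge_curryLeft_top (k := 2) (l := 3) rfl w.1 (φ 3) (ψ 4)
  have a3 := wedge_curryLeft_top (k := 3) (l := 2) rfl w.1 (φ 4) (ψ 3)
  have a4 := wedge_curryLeft_top (k := 4) (l := 1) rfl w.1 (φ 5) (ψ 2)
  have a5 := wedge_curryLeft_top (k := 5) (l := 0) rfl w.1 (φ 6) (ψ 1)
  have b0 := wedge_cwedge_swap (k := 0) (l := 5) (n := 6) rfl w.2 (φ 0) (ψ 5)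
  have b1 := wedge_cwedge_swap (k := 1) (l := 4) (n := 6) rfl w.2 (φ 1) (ψ 4)
  have b2 := wedge_cwedge_swap (k := 2) (l := 3) (n := 6) rfl w.2 (φ 2) (ψ 3)
  have b3 := wedge_cwedge_swap (k := 3) (l := 2) (n := 6) rfl w.2 (φ 3) (ψ 2)
  have b4 := wedge_cwedge_swap (k := 4) (l := 1) (n := 6) rfl w.2 (φ 4) (ψ 1)
  have b5 := wedge_cwedge_swap (k := 5) (l := 0) (n := 6) rfl w.2 (φ 5) (ψ 0)
  simp only [castDeg_rfl] at a0 a1 a2 a3 a4 a5 b0 b1 b2 b3 b4 b5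
  rw [mukai_eq, mukai_eq]
  simp only [clifford_zero, clifford_succ _ _ 0, clifford_succ _ _ 1, clifford_succ _ _ 2,
    clifford_succ _ _ 3, clifford_succ _ _ 4, clifford_succ _ _ 5, wedge_add_left, wedge_add_right,
    Nat.reduceAdd, form_eq_zero (by norm_num : 6 < 7) (φ 7),
    form_eq_zero (by norm_num : 6 < 7) (ψ 7), form_zero_apply, zero_wedge, wedge_zero_right']
  ext v
  have c0 := congrArg (fun γ => γ v) a0
  have c1 := congrArg (fun γ => γ v) a1
  have c2 := congrArg (fun γ => γ v) a2
  have c3 := congrArg (fun γ => γ v) a3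
  have c4 := congrArg (fun γ => γ v) a4
  have c5 := congrArg (fun γ => γ v) a5
  have d0 := congrArg (fun γ => γ v) b0
  have d1 := congrArg (fun γ => γ v) b1
  have d2 := congrArg (fun γ => γ v) b2
  have d3 := congrArg (fun γ => γ v) b3
  have d4 := congrArg (fun γ => γ v) b4
  have d5 := congrArg (fun γ => γ v) b5
  norm_num at c0 c1 c2 c3 c4 c5 d0 d1 d2 d3 d4 d5 ⊢
  linarith

omit hV in
theorem mukai_skew (φ ψ : Spinor V ℝ) : mukai φ ψ = -mukai ψ φ := by
  have a0 := wedge_comm (φ 0) (ψ 6)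
  have a1 := wedge_comm (φ 1) (ψ 5)
  have a2 := wedge_comm (φ 2) (ψ 4)
  have a3 := wedge_comm (φ 3) (ψ 3)
  have a4 := wedge_comm (φ 4) (ψ 2)
  have a5 := wedge_comm (φ 5) (ψ 1)
  have a6 := wedge_comm (φ 6) (ψ 0)
  simp only [castDeg_rfl] at a0 a1 a2 a3 a4 a5 a6
  rw [mukai_eq, mukai_eq]
  ext v
  have c0 := congrArg (fun γ => γ v) a0
  have c1 := congrArg (fun γ => γ v) a1
  have c2 := congrArg (fun γ => γ v) a2
  have c3 := congrArg (fun γ => γ v) a3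
  have c4 := congrArg (fun γ => γ v) a4
  have c5 := congrArg (fun γ => γ v) a5
  have c6 := congrArg (fun γ => γ v) a6
  norm_num at c0 c1 c2 c3 c4 c5 c6 ⊢
  linarith

omit [FiniteDimensional ℝ V] hV in
theorem mukai_add_left {F : Type*} [NormedField F] [NormedAlgebra ℝ F] (φ φ' ψ : Spinor V F) :
    mukai (φ + φ') ψ = mukai φ ψ + mukai φ' ψ := by
  simp only [mukai_eq, Pi.add_apply, wedge_add_left]
  abel

omit [FiniteDimensional ℝ V] hV in
theorem mukai_smul_left {F : Type*} [NormedField F] [NormedAlgebra ℝ F] (c : ℝ)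
    (φ ψ : Spinor V F) : mukai (c • φ) ψ = c • mukai φ ψ := by
  simp only [mukai_eq, Pi.smul_apply, wedge_smul_left, smul_add, smul_sub]

omit [FiniteDimensional ℝ V] hV in
theorem mukai_add_right {F : Type*} [NormedField F] [NormedAlgebra ℝ F] (φ ψ ψ' : Spinor V F) :
    mukai φ (ψ + ψ') = mukai φ ψ + mukai φ ψ' := by
  simp only [mukai_eq, Pi.add_apply, wedge_add_right]
  abel

omit [FiniteDimensional ℝ V] hV in
theorem mukai_smul_right {F : Type*} [NormedField F] [NormedAlgebra ℝ F] (c : ℝ)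
    (φ ψ : Spinor V F) : mukai φ (c • ψ) = c • mukai φ ψ := by
  simp only [mukai_eq, Pi.smul_apply, wedge_smul_right, smul_add, smul_sub]

/-- The pairing as a bilinear map. -/
def pairingₗ (ε : V [⋀^Fin 6]→L[ℝ] ℝ) : Spinor V ℝ →ₗ[ℝ] Spinor V ℝ →ₗ[ℝ] ℝ :=
  LinearMap.mk₂ ℝ (pairing ε)
    (fun a b c => by simp [pairing, mukai_add_left, add_div])
    (fun r a b => by simp [pairing, mukai_smul_left, mul_div_assoc])
    (fun a b c => by simp [pairing, mukai_add_right, add_div])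
    (fun r a b => by simp [pairing, mukai_smul_right, mul_div_assoc])

theorem pairingₗ_apply (ε : V [⋀^Fin 6]→L[ℝ] ℝ) (φ ψ : Spinor V ℝ) :
    pairingₗ ε φ ψ = pairing ε φ ψ := rfl

theorem pairing_skew (ε : V [⋀^Fin 6]→L[ℝ] ℝ) (φ ψ : Spinor V ℝ) :
    pairing ε φ ψ = -pairing ε ψ φ := by
  rw [pairing, mukai_skew, pairing, ContinuousAlternatingMap.neg_apply, neg_div]

theorem pairing_clifford (ε : V [⋀^Fin 6]→L[ℝ] ℝ) (w : V × (V →L[ℝ] ℝ)) (φ ψ : Spinor V ℝ) :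
    pairing ε (clifford w φ) ψ = pairing ε φ (clifford w ψ) := by
  rw [pairing, mukai_clifford, pairing]

theorem form_six_eq_zero {F : Type*} [NormedField F] [NormedAlgebra ℝ F]
    {α : V [⋀^Fin 6]→L[ℝ] F} (h : α (sixBasis V) = 0) : α = 0 := by
  have : α.toAlternatingMap = 0 := by
    refine (sixBasis V).ext_alternating fun v hv => ?_
    let σ : Equiv.Perm (Fin 6) := Equiv.ofBijective v (Finite.injective_iff_bijective.1 hv)
    have h2 := α.toAlternatingMap.map_perm (sixBasis V) σ
    have h3 : α.toAlternatingMap (sixBasis V ∘ σ) = 0 := by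
      rw [h2]
      change Equiv.Perm.sign σ • α (sixBasis V) = 0
      rw [h, smul_zero]
    exact h3
  ext v
  exact congrArg (fun m : V [⋀^Fin 6]→ₗ[ℝ] F => m v) this

/-- Nondegeneracy, by induction on the degree: the component of degree 0 is detected by the volume
form, and a component of higher degree vanishes because its contractions do. The contractions
inherit the hypothesis because the Clifford action is self-adjoint. -/
theorem eq_zero_of_pairing_eq_zero {ε : V [⋀^Fin 6]→L[ℝ] ℝ} (hε : ε (sixBasis V) ≠ 0)
    {X : Spinor V ℝ} (h : ∀ χ, pairing ε X χ = 0) : X = 0 := by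
  funext k
  rw [Pi.zero_apply]
  induction k generalizing X with
  | zero =>
    have h1 := h (Pi.single 6 ε)
    rw [pairing, div_eq_zero_iff, or_iff_left hε, mukai_eq] at h1
    simp only [Pi.single_eq_same, Pi.single_eq_of_ne (by norm_num : (0 : ℕ) ≠ 6),
      Pi.single_eq_of_ne (by norm_num : (1 : ℕ) ≠ 6), Pi.single_eq_of_ne (by norm_num : (2 : ℕ) ≠ 6),
      Pi.single_eq_of_ne (by norm_num : (3 : ℕ) ≠ 6), Pi.single_eq_of_ne (by norm_num : (4 : ℕ) ≠ 6),
      Pi.single_eq_of_ne (by norm_num : (5 : ℕ) ≠ 6), wedge_zero_right'] at h1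
    have h2 : wedge (X 0) ε = X 0 0 • ε := wedge_of_degree_zero (X 0) ε
    have h3 : (wedge (X 0) ε) (sixBasis V) = X 0 0 * ε (sixBasis V) := by rw [h2]; rfl
    have h4 : X 0 0 = 0 := by
      have : (wedge (X 0) ε) (sixBasis V) = 0 := by simpa using h1
      rw [h3] at this
      exact (mul_eq_zero.1 this).resolve_right hε
    ext v
    rw [Subsingleton.elim v 0, h4]
    rfl
  | succ k ih =>
    refine ext_curryLeft fun v => ?_
    have h1 : ∀ χ, pairing ε (clifford (v, 0) X) χ = 0 := fun χ => by
      rw [pairing_clifford, h]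
    have h2 := ih h1
    cases k with
    | zero => exact h2
    | succ k =>
      rw [clifford_succ] at h2
      have h3 : cwedge (0 : V →L[ℝ] ℝ) (X k) = 0 := LinearMap.map_zero₂ (cwedgeₗ k) (X k)
      rw [h3, add_zero] at h2
      exact h2

theorem pairing_injective {ε : V [⋀^Fin 6]→L[ℝ] ℝ} (hε : ε (sixBasis V) ≠ 0) :
    Function.Injective fun X : Spinor V ℝ => fun σ : Spinor V ℝ => pairing ε X σ := by
  intro X Y h
  rw [← sub_eq_zero]
  refine eq_zero_of_pairing_eq_zero hε fun χ => ?_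
  rw [← pairingₗ_apply, map_sub, LinearMap.sub_apply, sub_eq_zero]
  exact congrFun h χ

theorem exists_pairing_eq {ε : V [⋀^Fin 6]→L[ℝ] ℝ} (hε : ε (sixBasis V) ≠ 0)
    (ℓ : Spinor V ℝ →ₗ[ℝ] ℝ) : ∃ X, ∀ χ, pairing ε X χ = ℓ χ := by
  have := finiteDimensional_spinor (V := V)
  have hinj : Function.Injective (pairingₗ ε) := fun X Y h =>
    pairing_injective hε (funext fun χ => congrArg (fun m : Spinor V ℝ →ₗ[ℝ] ℝ => m χ) h)
  have hsurj : Function.Surjective (pairingₗ ε) :=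
    (LinearMap.injective_iff_surjective_of_finrank_eq_finrank
      Subspace.dual_finrank_eq.symm).1 hinj
  obtain ⟨X, hX⟩ := hsurj ℓ
  exact ⟨X, fun χ => congrArg (fun m : Spinor V ℝ →ₗ[ℝ] ℝ => m χ) hX⟩

end Six

end Spinors

end GenCY

end

/-! ### The moment map, and the quartic as a trace form. -/

noncomputable section

namespace GenCY

attribute [local irreducible] pairing clifford

section Moment

variable {V : Type*} [NormedAddCommGroup V] [NormedSpace ℝ V]
variable [FiniteDimensional ℝ V] [hV : Fact (Module.finrank ℝ V = 6)]

/-- The index `i.swap` belongs to the dual basis element, so these are the coordinates of `w`. All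
later sums over the basis are contracted by means of this expansion. -/
theorem sum_wittForm_swap_basis (w : V × (V →L[ℝ] ℝ)) :
    ∑ i, wittForm (wittBasis V i.swap) w • wittBasis V i = w := by
  simp only [Fintype.sum_sum_type, Sum.swap_inl, Sum.swap_inr, wittBasis, wittForm_apply]
  refine Prod.ext ?_ ?_
  · simp only [Prod.fst_add, Prod.fst_sum, Prod.smul_fst, smul_zero, Finset.sum_const_zero,
      add_zero, map_zero]
    exact (sixBasis V).sum_repr w.1
  · simp only [Prod.snd_add, Prod.snd_sum, Prod.smul_snd, smul_zero, Finset.sum_const_zero,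
      zero_add, zero_apply]
    ext v
    have h : w.2 v = ∑ i, (sixBasis V).repr v i * w.2 (sixBasis V i) := by
      conv_lhs => rw [← (sixBasis V).sum_repr v, map_sum]
      simp
    rw [h]
    simp [mul_comm]

theorem sum_wittForm_swap_smul {A : Type*} [AddCommGroup A] [Module ℝ A]
    (L : (V × (V →L[ℝ] ℝ)) →ₗ[ℝ] A) (w : V × (V →L[ℝ] ℝ)) :
    ∑ i, wittForm (wittBasis V i.swap) w • L (wittBasis V i) = L w := by
  conv_rhs => rw [← sum_wittForm_swap_basis w]
  simp

theorem sum_wittForm_smul {A : Type*} [AddCommGroup A] [Module ℝ A]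
    (L : (V × (V →L[ℝ] ℝ)) →ₗ[ℝ] A) (w : V × (V →L[ℝ] ℝ)) :
    ∑ i, wittForm (wittBasis V i) w • L (wittBasis V i.swap) = L w := by
  rw [← sum_wittForm_swap_smul L w]
  exact Fintype.sum_equiv (Equiv.sumComm _ _) _ _ fun i => by simp

theorem sum_wittForm_mul (ℓ : (V × (V →L[ℝ] ℝ)) →ₗ[ℝ] ℝ) (w : V × (V →L[ℝ] ℝ)) :
    ∑ i, wittForm (wittBasis V i) w * ℓ (wittBasis V i.swap) = ℓ w := sum_wittForm_smul ℓ w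

theorem sum_wittForm_swap_mul (ℓ : (V × (V →L[ℝ] ℝ)) →ₗ[ℝ] ℝ) (w : V × (V →L[ℝ] ℝ)) :
    ∑ i, wittForm (wittBasis V i.swap) w * ℓ (wittBasis V i) = ℓ w := sum_wittForm_swap_smul ℓ w

/-- Bilinear forms on `V ⊕ V*`. -/
abbrev WittBilin (V : Type*) [NormedAddCommGroup V] [NormedSpace ℝ V] : Type _ :=
  (V × (V →L[ℝ] ℝ)) →ₗ[ℝ] (V × (V →L[ℝ] ℝ)) →ₗ[ℝ] ℝ

/-- The trace form `tr (f g)` of bilinear forms on `V ⊕ V*`. -/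
def wittTrace : WittBilin V →ₗ[ℝ] WittBilin V →ₗ[ℝ] ℝ :=
  LinearMap.mk₂ ℝ (fun f g => ∑ i, ∑ j, f (wittBasis V j) (wittBasis V i.swap) *
      g (wittBasis V i) (wittBasis V j.swap))
    (fun f f' g => by simp [add_mul, Finset.sum_add_distrib])
    (fun r f g => by simp only [Finset.mul_sum, mul_assoc, LinearMap.smul_apply, smul_eq_mul])
    (fun f g g' => by simp [mul_add, Finset.sum_add_distrib])
    (fun r f g => by simp only [Finset.mul_sum, mul_left_comm, LinearMap.smul_apply, smul_eq_mul])

theorem wittTrace_apply (f g : WittBilin V) : wittTrace f g =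
    ∑ i, ∑ j, f (wittBasis V j) (wittBasis V i.swap) * g (wittBasis V i) (wittBasis V j.swap) := rfl

theorem wittTrace_comm (f g : WittBilin V) : wittTrace f g = wittTrace g f := by
  rw [wittTrace_apply, wittTrace_apply, Finset.sum_comm]
  simp only [mul_comm]

/-- The trace form is invariant under the element of `𝔰𝔬(V ⊕ V*)` attached to `u₁, u₂`. -/
theorem wittTrace_invariant {u₁ u₂ : V × (V →L[ℝ] ℝ)} {f f' g g' : WittBilin V}
    (hf : ∀ w₁ w₂, f' w₁ w₂ = wittForm w₁ u₁ * f u₂ w₂ - wittForm w₁ u₂ * f u₁ w₂ +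
      wittForm w₂ u₁ * f w₁ u₂ - wittForm w₂ u₂ * f w₁ u₁)
    (hg : ∀ w₁ w₂, g' w₁ w₂ = wittForm w₁ u₁ * g u₂ w₂ - wittForm w₁ u₂ * g u₁ w₂ +
      wittForm w₂ u₁ * g w₁ u₂ - wittForm w₂ u₂ * g w₁ u₁) :
    wittTrace f g' + wittTrace f' g = 0 := by
  have A : ∀ (f : WittBilin V) (u : V × (V →L[ℝ] ℝ)) (ℓ : (V × (V →L[ℝ] ℝ)) →ₗ[ℝ] ℝ),
      ∑ i, ∑ j, f (wittBasis V j) (wittBasis V i.swap) *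
        (wittForm (wittBasis V i) u * ℓ (wittBasis V j.swap)) =
      ∑ j, f (wittBasis V j) u * ℓ (wittBasis V j.swap) := by
    intro f u ℓ
    rw [Finset.sum_comm]
    refine Finset.sum_congr rfl fun j _ => ?_
    rw [← sum_wittForm_mul (f (wittBasis V j)) u, Finset.sum_mul]
    exact Finset.sum_congr rfl fun i _ => by ring
  have B : ∀ (f : WittBilin V) (u : V × (V →L[ℝ] ℝ)) (ℓ : (V × (V →L[ℝ] ℝ)) →ₗ[ℝ] ℝ),
      ∑ i, ∑ j, f (wittBasis V j) (wittBasis V i.swap) *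
        (wittForm (wittBasis V j.swap) u * ℓ (wittBasis V i)) =
      ∑ i, f u (wittBasis V i.swap) * ℓ (wittBasis V i) := by
    intro f u ℓ
    refine Finset.sum_congr rfl fun i _ => ?_
    have h := sum_wittForm_swap_mul (f.flip (wittBasis V i.swap)) u
    simp only [LinearMap.flip_apply] at h
    rw [← h, Finset.sum_mul]
    exact Finset.sum_congr rfl fun j _ => by ring
  -- Summing out the basis leaves four single sums. They are permuted with opposite signs when f and
  -- g exchange roles, which is the cancellation claimed.
  have C : ∀ {f g g' : WittBilin V}, (∀ w₁ w₂, g' w₁ w₂ = wittForm w₁ u₁ * g u₂ w₂ -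
      wittForm w₁ u₂ * g u₁ w₂ + wittForm w₂ u₁ * g w₁ u₂ - wittForm w₂ u₂ * g w₁ u₁) →
      wittTrace f g' = (∑ j, f (wittBasis V j) u₁ * g u₂ (wittBasis V j.swap) -
        ∑ j, f (wittBasis V j) u₂ * g u₁ (wittBasis V j.swap)) +
        (∑ i, f u₁ (wittBasis V i.swap) * g (wittBasis V i) u₂ -
        ∑ i, f u₂ (wittBasis V i.swap) * g (wittBasis V i) u₁) := by
    intro f g g' hg
    have h1 := A f u₁ (g u₂)
    have h2 := A f u₂ (g u₁)
    have h3 := B f u₁ (g.flip u₂)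
    have h4 := B f u₂ (g.flip u₁)
    simp only [LinearMap.flip_apply] at h3 h4
    rw [← h1, ← h2, ← h3, ← h4, wittTrace_apply]
    simp only [← Finset.sum_sub_distrib, ← Finset.sum_add_distrib, hg]
    refine Finset.sum_congr rfl fun i _ => Finset.sum_congr rfl fun j _ => ?_
    ring
  rw [wittTrace_comm f' g, C hg, C hf]
  simp only [mul_comm (g _ _)]
  ring

variable (ε : V [⋀^Fin 6]→L[ℝ] ℝ)

/-- `(w₁, w₂) ↦ ⟨w₁ ρ, w₂ σ⟩`. -/
def cliffordForm : Spinor V ℝ →ₗ[ℝ] Spinor V ℝ →ₗ[ℝ] WittBilin V :=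
  LinearMap.mk₂ ℝ (fun ρ σ => (pairingₗ ε).compl₁₂ (cliffordₗ.flip ρ) (cliffordₗ.flip σ))
    (fun _ _ _ => by ext <;> simp) (fun _ _ _ => by ext <;> simp)
    (fun _ _ _ => by ext <;> simp) (fun _ _ _ => by ext <;> simp)

theorem cliffordForm_apply (ρ σ : Spinor V ℝ) (w₁ w₂ : V × (V →L[ℝ] ℝ)) :
    cliffordForm ε ρ σ w₁ w₂ = pairing ε (clifford w₁ ρ) (clifford w₂ σ) := rfl

/-- The polarized moment map. -/
def momentForm : Spinor V ℝ →ₗ[ℝ] Spinor V ℝ →ₗ[ℝ] WittBilin V :=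
  (1 / 2 : ℝ) • (cliffordForm ε + (cliffordForm ε).flip)

theorem momentForm_apply (ρ σ : Spinor V ℝ) (w₁ w₂ : V × (V →L[ℝ] ℝ)) :
    momentForm ε ρ σ w₁ w₂ = 1 / 2 * (pairing ε (clifford w₁ ρ) (clifford w₂ σ) +
      pairing ε (clifford w₁ σ) (clifford w₂ ρ)) := rfl

theorem momentForm_comm (ρ σ : Spinor V ℝ) : momentForm ε ρ σ = momentForm ε σ ρ := by
  rw [momentForm, LinearMap.smul_apply, LinearMap.smul_apply, LinearMap.smul_apply,
    LinearMap.smul_apply, LinearMap.add_apply, LinearMap.add_apply, LinearMap.add_apply,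
    LinearMap.add_apply, LinearMap.flip_apply, LinearMap.flip_apply, add_comm]

/-- Self-adjointness gives `moment` = -½⟨w₁ρ, w₂ρ⟩. Together with the factor ½ in `momentMatrix` the
constant is 4 · (1/4)² = 1/4. -/
theorem quartic_eq (ρ : Spinor V ℝ) :
    quartic ε ρ = 1 / 4 * wittTrace (momentForm ε ρ ρ) (momentForm ε ρ ρ) := by
  have hm : ∀ w₁ w₂, moment ε ρ w₁ w₂ = -(1 / 2) * momentForm ε ρ ρ w₁ w₂ := by
    intro w₁ w₂
    have h1 : pairing ε (spinAction w₁ w₂ ρ) ρ = 1 / 2 *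
        (pairing ε (clifford w₁ (clifford w₂ ρ)) ρ - pairing ε (clifford w₂ (clifford w₁ ρ)) ρ) := by
      simp only [← pairingₗ_apply, spinAction, map_smul, map_sub, LinearMap.sub_apply,
        LinearMap.smul_apply, smul_eq_mul]
    rw [moment, h1, pairing_clifford ε w₁ (clifford w₂ ρ) ρ,
      pairing_clifford ε w₂ (clifford w₁ ρ) ρ, momentForm_apply,
      pairing_skew ε (clifford w₂ ρ)]
    ring
  rw [quartic, wittTrace_apply, Matrix.trace, Finset.mul_sum, Finset.mul_sum]
  refine Finset.sum_congr rfl fun i _ => ?_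
  rw [Matrix.diag_apply, Matrix.mul_apply, Finset.mul_sum, Finset.mul_sum]
  refine Finset.sum_congr rfl fun j _ => ?_
  simp only [momentMatrix, Matrix.of_apply, hm]
  ring

end Moment
end GenCY

end

/-! ### The Hamiltonian field of √N, where N = -q/3, and its derivative. -/

noncomputable section

namespace GenCY

attribute [local irreducible] pairing clifford

section Hitchin

variable {V : Type*} [NormedAddCommGroup V] [NormedSpace ℝ V]

theorem clifford_add_left (w w' : V × (V →L[ℝ] ℝ)) (ρ : Spinor V ℝ) :
    clifford (w + w') ρ = clifford w ρ + clifford w' ρ := by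
  simp only [← cliffordₗ_apply, map_add, LinearMap.add_apply]

theorem clifford_smul_left (c : ℝ) (w : V × (V →L[ℝ] ℝ)) (ρ : Spinor V ℝ) :
    clifford (c • w) ρ = c • clifford w ρ := by
  simp only [← cliffordₗ_apply, map_smul, LinearMap.smul_apply]

theorem clifford_add (w : V × (V →L[ℝ] ℝ)) (ρ σ : Spinor V ℝ) :
    clifford w (ρ + σ) = clifford w ρ + clifford w σ := by
  simp only [← cliffordₗ_apply, map_add]

theorem clifford_sub (w : V × (V →L[ℝ] ℝ)) (ρ σ : Spinor V ℝ) :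
    clifford w (ρ - σ) = clifford w ρ - clifford w σ := by
  simp only [← cliffordₗ_apply, map_sub]

theorem clifford_neg (w : V × (V →L[ℝ] ℝ)) (ρ : Spinor V ℝ) :
    clifford w (-ρ) = -clifford w ρ := by
  simp only [← cliffordₗ_apply, map_neg]

theorem clifford_smul (c : ℝ) (w : V × (V →L[ℝ] ℝ)) (ρ : Spinor V ℝ) :
    clifford w (c • ρ) = c • clifford w ρ := by
  simp only [← cliffordₗ_apply, map_smul]

/-- The commutator of the Clifford actions of two elements. -/
def cliffordComm (u₁ u₂ : V × (V →L[ℝ] ℝ)) (r : Spinor V ℝ) : Spinor V ℝ :=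
  clifford u₁ (clifford u₂ r) - clifford u₂ (clifford u₁ r)

/-- Moving `w` past both factors by the Clifford relation: the commutator acts on V ⊕ V* as an
element of 𝔰𝔬(V ⊕ V*). -/
theorem clifford_cliffordComm (w u₁ u₂ : V × (V →L[ℝ] ℝ)) (r : Spinor V ℝ) :
    clifford w (cliffordComm u₁ u₂ r) = cliffordComm u₁ u₂ (clifford w r) +
      (2 * wittForm w u₁) • clifford u₂ r - (2 * wittForm w u₂) • clifford u₁ r := by
  have h1 := clifford_clifford_add w u₁ (clifford u₂ r)
  have h2 := clifford_clifford_add w u₂ (clifford u₁ r)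
  have h3 := congrArg (clifford u₁) (clifford_clifford_add w u₂ r)
  have h4 := congrArg (clifford u₂) (clifford_clifford_add w u₁ r)
  rw [clifford_add, clifford_smul] at h3 h4
  rw [cliffordComm, cliffordComm, clifford_sub, eq_sub_of_add_eq h1, eq_sub_of_add_eq h2,
    eq_sub_of_add_eq h3, eq_sub_of_add_eq h4]
  module

variable [FiniteDimensional ℝ V] [hV : Fact (Module.finrank ℝ V = 6)]
variable (ε : V [⋀^Fin 6]→L[ℝ] ℝ)

theorem pairing_add_left (φ φ' ψ : Spinor V ℝ) :
    pairing ε (φ + φ') ψ = pairing ε φ ψ + pairing ε φ' ψ := by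
  simp only [← pairingₗ_apply, map_add, LinearMap.add_apply]

theorem pairing_add_right (φ ψ ψ' : Spinor V ℝ) :
    pairing ε φ (ψ + ψ') = pairing ε φ ψ + pairing ε φ ψ' := by
  simp only [← pairingₗ_apply, map_add]

theorem pairing_sub_left (φ φ' ψ : Spinor V ℝ) :
    pairing ε (φ - φ') ψ = pairing ε φ ψ - pairing ε φ' ψ := by
  simp only [← pairingₗ_apply, map_sub, LinearMap.sub_apply]

theorem pairing_sub_right (φ ψ ψ' : Spinor V ℝ) :
    pairing ε φ (ψ - ψ') = pairing ε φ ψ - pairing ε φ ψ' := by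
  simp only [← pairingₗ_apply, map_sub]

theorem pairing_smul_left (c : ℝ) (φ ψ : Spinor V ℝ) :
    pairing ε (c • φ) ψ = c * pairing ε φ ψ := by
  simp only [← pairingₗ_apply, map_smul, LinearMap.smul_apply, smul_eq_mul]

theorem pairing_smul_right (c : ℝ) (φ ψ : Spinor V ℝ) :
    pairing ε φ (c • ψ) = c * pairing ε φ ψ := by
  simp only [← pairingₗ_apply, map_smul, smul_eq_mul]

theorem pairing_cliffordComm (u₁ u₂ : V × (V →L[ℝ] ℝ)) (φ ψ : Spinor V ℝ) :
    pairing ε (cliffordComm u₁ u₂ φ) ψ = -pairing ε φ (cliffordComm u₁ u₂ ψ) := by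
  rw [cliffordComm, cliffordComm, pairing_sub_left, pairing_sub_right]
  simp only [pairing_clifford]
  ring

/-- The quartic form obtained from the trace form and the polarized moment map. -/
def quarticForm (r s p q : Spinor V ℝ) : ℝ := wittTrace (momentForm ε r s) (momentForm ε p q)

theorem cliffordForm_cliffordComm (u₁ u₂ w₁ w₂ : V × (V →L[ℝ] ℝ)) (r s : Spinor V ℝ) :
    cliffordForm ε (cliffordComm u₁ u₂ r) s w₁ w₂ + cliffordForm ε r (cliffordComm u₁ u₂ s) w₁ w₂ =
      2 * (wittForm w₁ u₁ * cliffordForm ε r s u₂ w₂ - wittForm w₁ u₂ * cliffordForm ε r s u₁ w₂ +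
      wittForm w₂ u₁ * cliffordForm ε r s w₁ u₂ - wittForm w₂ u₂ * cliffordForm ε r s w₁ u₁) := by
  simp only [cliffordForm_apply, clifford_cliffordComm, pairing_add_left, pairing_sub_left,
    pairing_add_right, pairing_sub_right, pairing_smul_left, pairing_smul_right,
    pairing_cliffordComm]
  ring

/-- The action of 𝔰𝔬(V ⊕ V*) is skew for the pairing, so the moment form is equivariant, and the
trace form is invariant. Together they give the polarized infinitesimal invariance of the quartic.
-/
theorem quarticForm_invariant (u₁ u₂ : V × (V →L[ℝ] ℝ)) (r s p q : Spinor V ℝ) :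
    quarticForm ε (cliffordComm u₁ u₂ r) s p q + quarticForm ε r (cliffordComm u₁ u₂ s) p q +
      quarticForm ε r s (cliffordComm u₁ u₂ p) q + quarticForm ε r s p (cliffordComm u₁ u₂ q) =
      0 := by
  have key : ∀ r s w₁ w₂, ((1 / 2 : ℝ) • (momentForm ε (cliffordComm u₁ u₂ r) s +
      momentForm ε r (cliffordComm u₁ u₂ s))) w₁ w₂ =
      wittForm w₁ u₁ * momentForm ε r s u₂ w₂ - wittForm w₁ u₂ * momentForm ε r s u₁ w₂ +
      wittForm w₂ u₁ * momentForm ε r s w₁ u₂ - wittForm w₂ u₂ * momentForm ε r s w₁ u₁ := by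
    intro r s w₁ w₂
    have h1 := cliffordForm_cliffordComm ε u₁ u₂ w₁ w₂ r s
    have h2 := cliffordForm_cliffordComm ε u₁ u₂ w₁ w₂ s r
    simp only [cliffordForm_apply] at h1 h2
    simp only [LinearMap.smul_apply, LinearMap.add_apply, momentForm_apply, smul_eq_mul]
    linear_combination (1 / 4) * h1 + (1 / 4) * h2
  have h := wittTrace_invariant (key r s) (key p q)
  simp only [map_smul, map_add, LinearMap.smul_apply, LinearMap.add_apply, smul_eq_mul] at h
  simp only [quarticForm]
  linear_combination 2 * h

theorem quarticForm_swap_left (r s p q : Spinor V ℝ) :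
    quarticForm ε r s p q = quarticForm ε s r p q := by
  rw [quarticForm, momentForm_comm, quarticForm]

theorem quarticForm_swap_right (r s p q : Spinor V ℝ) :
    quarticForm ε r s p q = quarticForm ε r s q p := by
  rw [quarticForm, momentForm_comm ε p, quarticForm]

theorem quarticForm_swap (r s p q : Spinor V ℝ) :
    quarticForm ε r s p q = quarticForm ε p q r s := by
  rw [quarticForm, wittTrace_comm, quarticForm]

/-- The function `N = -q/3`, whose square root is `volFun`. -/
def normQuartic (r : Spinor V ℝ) : ℝ := -quartic ε r / 3

theorem normQuartic_eq (r : Spinor V ℝ) :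
    normQuartic ε r = -(1 / 12) * quarticForm ε r r r r := by
  rw [normQuartic, quartic_eq, quarticForm]
  ring

/-- The differential of `normQuartic`. -/
def normDeriv (r : Spinor V ℝ) : Spinor V ℝ →ₗ[ℝ] ℝ :=
  (-(1 / 3) : ℝ) • (wittTrace (momentForm ε r r)).comp (momentForm ε r)

theorem normDeriv_apply (r χ : Spinor V ℝ) :
    normDeriv ε r χ = -(1 / 3) * quarticForm ε r r r χ := rfl

/-- The second differential of `normQuartic`. -/
def normDeriv₂ (r σ : Spinor V ℝ) : Spinor V ℝ →ₗ[ℝ] ℝ :=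
  (-(1 / 3) : ℝ) • ((2 : ℝ) • (wittTrace (momentForm ε r σ)).comp (momentForm ε r) +
    (wittTrace (momentForm ε r r)).comp (momentForm ε σ))

theorem normDeriv₂_apply (r σ χ : Spinor V ℝ) : normDeriv₂ ε r σ χ =
    -(1 / 3) * (2 * quarticForm ε r σ r χ + quarticForm ε r r σ χ) := rfl

theorem normDeriv₂_comm (r σ χ : Spinor V ℝ) : normDeriv₂ ε r σ χ = normDeriv₂ ε r χ σ := by
  rw [normDeriv₂_apply, normDeriv₂_apply, quarticForm_swap ε r σ, quarticForm_swap_right ε r r σ]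

/-- Invariance of the differential of N: moving the base point along its orbit is compensated by
moving the argument. This makes ρ ↦ ρ̂ equivariant. -/
theorem normDeriv₂_cliffordComm (u₁ u₂ : V × (V →L[ℝ] ℝ)) (r χ : Spinor V ℝ) :
    normDeriv₂ ε r (cliffordComm u₁ u₂ r) χ = -normDeriv ε r (cliffordComm u₁ u₂ χ) := by
  rw [normDeriv₂_apply, normDeriv_apply]
  have h := quarticForm_invariant ε u₁ u₂ r r r χ
  have h2 := quarticForm_swap_left ε r (cliffordComm u₁ u₂ r) r χ
  linear_combination (-(1 / 3)) * h - (1 / 3) * h2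

theorem normDeriv₂_self (r χ : Spinor V ℝ) : normDeriv₂ ε r r χ = 3 * normDeriv ε r χ := by
  rw [normDeriv₂_apply, normDeriv_apply]
  ring

theorem hasDerivAt_normQuartic (r σ : Spinor V ℝ) :
    HasDerivAt (fun t : ℝ => normQuartic ε (r + t • σ)) (normDeriv ε r σ) 0 := by
  -- On a line N is a polynomial of degree 4, of which only the linear coefficient matters.
  have h : ∀ t : ℝ, normQuartic ε (r + t • σ) = -(1 / 12) * (quarticForm ε r r r r +
      t * (4 * quarticForm ε r r r σ) + t ^ 2 * (2 * quarticForm ε r r σ σ +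
      4 * quarticForm ε r σ r σ) + t ^ 3 * (4 * quarticForm ε r σ σ σ) +
      t ^ 4 * quarticForm ε σ σ σ σ) := by
    intro t
    rw [normQuartic_eq]
    simp only [quarticForm, map_add, map_smul, LinearMap.add_apply, LinearMap.smul_apply,
      smul_eq_mul, momentForm_comm ε σ r]
    rw [wittTrace_comm (momentForm ε r σ) (momentForm ε r r),
      wittTrace_comm (momentForm ε σ σ) (momentForm ε r r),
      wittTrace_comm (momentForm ε σ σ) (momentForm ε r σ)]
    ring
  simp only [h]
  have hp : ∀ a b c d e : ℝ, HasDerivAt (fun t : ℝ => a + t * b + t ^ 2 * c + t ^ 3 * d + t ^ 4 * e)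
      b 0 := by
    intro a b c d e
    have h1 := (((((hasDerivAt_id (0 : ℝ)).mul_const b).const_add a).add
      ((hasDerivAt_pow 2 (0 : ℝ)).mul_const c)).add
      ((hasDerivAt_pow 3 (0 : ℝ)).mul_const d)).add ((hasDerivAt_pow 4 (0 : ℝ)).mul_const e)
    refine h1.congr_deriv ?_
    simp
  refine ((hp _ _ _ _ _).const_mul (-(1 / 12) : ℝ)).congr_deriv ?_
  rw [normDeriv_apply]
  ring

variable {ε}

/-- The chain rule for √N produces the factor 1/(2√N), and by nondegeneracy the preimage selected by
`Function.invFun` is the only one. -/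
theorem hatMap_eq (hε : ε (sixBasis V) ≠ 0) {r X : Spinor V ℝ} (hr : 0 < normQuartic ε r)
    (hX : ∀ χ, pairing ε X χ = normDeriv ε r χ / (2 * √(normQuartic ε r))) :
    hatMap ε r = X := by
  have h : (fun σ => lineDeriv ℝ (volFun ε) r σ) = fun σ : Spinor V ℝ => pairing ε X σ := by
    funext σ
    rw [hX]
    have h0 : normQuartic ε (r + (0 : ℝ) • σ) ≠ 0 := by
      rw [zero_smul, add_zero]
      exact hr.ne'
    have h1 := ((hasDerivAt_normQuartic ε r σ).sqrt h0).deriv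
    rw [zero_smul, add_zero] at h1
    exact h1
  rw [hatMap, h]
  exact Function.leftInverse_invFun (pairing_injective hε) X

/-- Near ρ one has ρ̂ = G/(2√N), where G represents dN. At N = 1/16 the derivative has the
coefficients 1/(2√N) = 2 and -dN(σ)/(4N^(3/2)) = -16 dN(σ); inserting dN = ½⟨ρ', ·⟩ twice turns 16
into 4. -/
theorem pairing_cplxStr (hε : ε (sixBasis V) ≠ 0) {ρ ρ' : Spinor V ℝ}
    (hN : normQuartic ε ρ = 1 / 16) (hD : ∀ χ, normDeriv ε ρ χ = 1 / 2 * pairing ε ρ' χ)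
    (σ χ : Spinor V ℝ) : pairing ε (cplxStr ε ρ σ) χ =
      2 * normDeriv₂ ε ρ σ χ - 4 * pairing ε ρ' σ * pairing ε ρ' χ := by
  -- By nondegeneracy the coefficients of the cubic polynomial t ↦ dN at ρ + tσ are represented by
  -- spinors.
  obtain ⟨X₀, h₀⟩ := exists_pairing_eq hε (normDeriv ε ρ)
  obtain ⟨X₁, h₁⟩ := exists_pairing_eq hε (normDeriv₂ ε ρ σ)
  obtain ⟨X₂, h₂⟩ := exists_pairing_eq hε (normDeriv₂ ε σ ρ)
  obtain ⟨X₃, h₃⟩ := exists_pairing_eq hε (normDeriv ε σ)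
  have hexp : ∀ (t : ℝ) χ, normDeriv ε (ρ + t • σ) χ =
      pairing ε (X₀ + t • X₁ + t ^ 2 • X₂ + t ^ 3 • X₃) χ := by
    intro t χ
    simp only [pairing_add_left, pairing_smul_left, h₀, h₁, h₂, h₃, normDeriv_apply,
      normDeriv₂_apply]
    simp only [quarticForm, map_add, map_smul, LinearMap.add_apply, LinearMap.smul_apply,
      smul_eq_mul, momentForm_comm ε σ ρ]
    ring
  have hNd := hasDerivAt_normQuartic ε ρ σ
  have hev : ∀ᶠ t : ℝ in nhds 0, 0 < normQuartic ε (ρ + t • σ) := by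
    refine hNd.continuousAt.eventually (lt_mem_nhds ?_)
    beta_reduce
    rw [zero_smul, add_zero, hN]
    norm_num
  have hhat : ∀ᶠ t : ℝ in nhds 0, hatMap ε (ρ + t • σ) =
      (2 * √(normQuartic ε (ρ + t • σ)))⁻¹ • (X₀ + t • X₁ + t ^ 2 • X₂ + t ^ 3 • X₃) := by
    filter_upwards [hev] with t ht
    refine hatMap_eq hε ht fun χ => ?_
    rw [pairing_smul_left, hexp, div_eq_inv_mul]
  have hsq : √(1 / 16 : ℝ) = 1 / 4 := by
    rw [show (1 / 16 : ℝ) = (1 / 4) ^ 2 by norm_num]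
    exact Real.sqrt_sq (by norm_num)
  have hs : HasDerivAt (fun t : ℝ => (2 * √(normQuartic ε (ρ + t • σ)))⁻¹)
      (-(16 * normDeriv ε ρ σ)) 0 := by
    have h0 : normQuartic ε (ρ + (0 : ℝ) • σ) = 1 / 16 := by rw [zero_smul, add_zero, hN]
    have h1 := ((hNd.sqrt (by rw [h0]; norm_num)).const_mul 2).inv (by rw [h0, hsq]; norm_num)
    refine h1.congr_deriv ?_
    rw [h0, hsq]
    ring
  have hJ : cplxStr ε ρ σ = (2 : ℝ) • X₁ - (16 * normDeriv ε ρ σ) • X₀ := by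
    funext k
    have hp : HasDerivAt (fun t : ℝ => X₀ k + t • X₁ k + t ^ 2 • X₂ k + t ^ 3 • X₃ k) (X₁ k) 0 := by
      have h1 := ((((hasDerivAt_id (0 : ℝ)).smul_const (X₁ k)).const_add (X₀ k)).add
        ((hasDerivAt_pow 2 (0 : ℝ)).smul_const (X₂ k))).add
        ((hasDerivAt_pow 3 (0 : ℝ)).smul_const (X₃ k))
      refine h1.congr_deriv ?_
      simp
    have h2 := hs.smul hp
    have h3 : (fun t : ℝ => hatMap ε (ρ + t • σ) k) =ᶠ[nhds 0] fun t =>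
        (2 * √(normQuartic ε (ρ + t • σ)))⁻¹ •
          (X₀ k + t • X₁ k + t ^ 2 • X₂ k + t ^ 3 • X₃ k) := by
      filter_upwards [hhat] with t ht
      rw [ht]
      rfl
    have h4 := (h2.congr_of_eventuallyEq h3).deriv
    refine h4.trans ?_
    have h5 : (2 * √(normQuartic ε (ρ + (0 : ℝ) • σ)))⁻¹ = 2 := by
      rw [zero_smul, add_zero, hN, hsq]
      norm_num
    rw [h5, Pi.sub_apply, Pi.smul_apply, Pi.smul_apply]
    simp only [zero_smul, add_zero, zero_pow, ne_eq, OfNat.ofNat_ne_zero, not_false_eq_true]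
    module
  rw [hJ, pairing_sub_left, pairing_smul_left, pairing_smul_left, h₀, h₁, hD, hD]
  ring

end Hitchin

end GenCY

end

/-! ### Pure spinors: the moment map is j, and J(w₁w₂ρ) = w₁w₂ρ'. -/

noncomputable section

namespace GenCY

attribute [local irreducible] pairing clifford

section PurePair

variable {V : Type*} [NormedAddCommGroup V] [NormedSpace ℝ V]

/-- The real and imaginary part `ρ`, `ρ'` of a pure spinor which is annihilated by the
`-i`-eigenspace of a skew complex structure `j` on `V ⊕ V*`. -/
structure IsPurePair (ρ ρ' : Spinor V ℝ)
    (j : (V × (V →L[ℝ] ℝ)) →ₗ[ℝ] (V × (V →L[ℝ] ℝ))) : Prop where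
  skew : ∀ w w', wittForm (j w) w' = -wittForm w (j w')
  sq : ∀ w, j (j w) = -w
  left : ∀ w, clifford (j w) ρ = -clifford w ρ'
  right : ∀ w, clifford (j w) ρ' = clifford w ρ

variable [FiniteDimensional ℝ V] [hV : Fact (Module.finrank ℝ V = 6)]
variable (ε : V [⋀^Fin 6]→L[ℝ] ℝ)

variable (V) in
theorem wittForm_wittBasis (i : Fin 6 ⊕ Fin 6) :
    wittForm (wittBasis V i) (wittBasis V i.swap) = 1 := by
  rcases i with i | i <;> simp [wittBasis, wittForm_apply]

/-- Adding the same sum with its factors exchanged gives 12 times the identity, one unit for each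
basis element. The two sums agree after reindexing by `swap`. -/
theorem sum_clifford_clifford_swap (x : Spinor V ℝ) :
    ∑ i, clifford (wittBasis V i) (clifford (wittBasis V i.swap) x) = (6 : ℝ) • x := by
  have h : ∑ i, clifford (wittBasis V i) (clifford (wittBasis V i.swap) x) =
      ∑ i, clifford (wittBasis V i.swap) (clifford (wittBasis V i) x) :=
    Fintype.sum_equiv (Equiv.sumComm _ _) _ _ fun i => by simp
  have h2 : ∑ i, clifford (wittBasis V i) (clifford (wittBasis V i.swap) x) +
      ∑ i, clifford (wittBasis V i) (clifford (wittBasis V i.swap) x) = (12 : ℝ) • x := by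
    conv_lhs => rw [h]
    conv_lhs => arg 1; rw [← h]
    rw [← Finset.sum_add_distrib]
    simp only [clifford_clifford_add, wittForm_wittBasis, one_smul]
    rw [Finset.sum_const]
    simp only [Finset.card_univ, Fintype.card_sum, Fintype.card_fin]
    module
  rw [← two_smul ℝ] at h2
  calc _ = (1 / 2 : ℝ) • ((2 : ℝ) • ∑ i, clifford (wittBasis V i)
        (clifford (wittBasis V i.swap) x)) := by module
    _ = _ := by rw [h2]; module

/-- The quadratic Clifford element `∑ eᵢ j(eᵢ')` attached to an endomorphism `j`. -/
def cliffordQuad (j : (V × (V →L[ℝ] ℝ)) →ₗ[ℝ] (V × (V →L[ℝ] ℝ))) (x : Spinor V ℝ) :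
    Spinor V ℝ :=
  ∑ i, clifford (wittBasis V i) (clifford (j (wittBasis V i.swap)) x)

/-- After expansion of the values of j in the basis, both sides are double sums over the matrix of
j, and skewness is what transposing that matrix costs. -/
theorem sum_skew_swap {A : Type*} [AddCommGroup A] [Module ℝ A]
    {j : (V × (V →L[ℝ] ℝ)) →ₗ[ℝ] (V × (V →L[ℝ] ℝ))}
    (hj : ∀ w w', wittForm (j w) w' = -wittForm w (j w'))
    (Φ : (V × (V →L[ℝ] ℝ)) →ₗ[ℝ] (V × (V →L[ℝ] ℝ)) →ₗ[ℝ] A) :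
    ∑ i, Φ (j (wittBasis V i.swap)) (wittBasis V i) =
      -∑ i, Φ (wittBasis V i) (j (wittBasis V i.swap)) := by
  have h1 : ∀ i, Φ (j (wittBasis V i.swap)) (wittBasis V i) =
      ∑ k, wittForm (wittBasis V k.swap) (j (wittBasis V i.swap)) •
        Φ (wittBasis V k) (wittBasis V i) := by
    intro i
    exact (sum_wittForm_swap_smul (Φ.flip (wittBasis V i)) _).symm
  have h2 : ∀ k, Φ (wittBasis V k) (j (wittBasis V k.swap)) =
      ∑ i, wittForm (wittBasis V i.swap) (j (wittBasis V k.swap)) •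
        Φ (wittBasis V k) (wittBasis V i) := by
    intro k
    exact (sum_wittForm_swap_smul (Φ (wittBasis V k)) _).symm
  simp only [h1, h2]
  rw [Finset.sum_comm, ← Finset.sum_neg_distrib]
  refine Finset.sum_congr rfl fun k _ => ?_
  rw [← Finset.sum_neg_distrib]
  refine Finset.sum_congr rfl fun i _ => ?_
  rw [wittForm_comm, hj, neg_smul]

namespace IsPurePair

variable {ε} {ρ ρ' : Spinor V ℝ} {j : (V × (V →L[ℝ] ℝ)) →ₗ[ℝ] (V × (V →L[ℝ] ℝ))}
variable (hj : IsPurePair ρ ρ' j)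
include hj

/-- Up to scale `cliffordQuad j` is the action on spinors of j, regarded as an element of 𝔰𝔬(V ⊕
V*); its commutator with w is therefore a multiple of jw. -/
theorem cliffordQuad_clifford (w : V × (V →L[ℝ] ℝ)) (x : Spinor V ℝ) :
    cliffordQuad j (clifford w x) = clifford w (cliffordQuad j x) - (2 : ℝ) • clifford (j w) x := by
  have h1 : ∀ i, clifford (wittBasis V i) (clifford (j (wittBasis V i.swap)) (clifford w x)) =
      clifford w (clifford (wittBasis V i) (clifford (j (wittBasis V i.swap)) x)) -
      wittForm (wittBasis V i) w • clifford (j (wittBasis V i.swap)) x -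
      wittForm (wittBasis V i.swap) (j w) • clifford (wittBasis V i) x := by
    intro i
    have a1 := congrArg (clifford (wittBasis V i))
      (clifford_clifford_add (j (wittBasis V i.swap)) w x)
    have a2 := clifford_clifford_add (wittBasis V i) w (clifford (j (wittBasis V i.swap)) x)
    rw [clifford_add, clifford_smul, hj.skew] at a1
    rw [eq_sub_of_add_eq a1, eq_sub_of_add_eq a2]
    module
  have h2 := sum_wittForm_smul ((cliffordₗ.flip x).comp j) w
  have h3 := sum_wittForm_swap_smul (cliffordₗ.flip x) (j w)
  simp only [LinearMap.comp_apply, LinearMap.flip_apply, cliffordₗ_apply] at h2 h3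
  simp only [cliffordQuad, h1, Finset.sum_sub_distrib, h2, h3]
  simp only [← cliffordₗ_apply w, map_sum]
  module

theorem cliffordQuad_left : cliffordQuad j ρ = -(6 : ℝ) • ρ' := by
  simp only [cliffordQuad, hj.left, clifford_neg, Finset.sum_neg_distrib,
    sum_clifford_clifford_swap, neg_smul]

/-- Self-adjointness of the factors reverses their order; skewness of j restores the order with a
minus sign. -/
theorem pairing_cliffordQuad (x y : Spinor V ℝ) :
    pairing ε (cliffordQuad j x) y = -pairing ε x (cliffordQuad j y) := by
  have h := sum_skew_swap hj.skew
    (LinearMap.mk₂ ℝ (fun w₁ w₂ => pairing ε x (clifford w₁ (clifford w₂ y)))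
    (fun _ _ _ => by simp only [clifford_add_left, pairing_add_right])
    (fun _ _ _ => by simp only [clifford_smul_left, pairing_smul_right, smul_eq_mul])
    (fun _ _ _ => by simp only [clifford_add_left, clifford_add, pairing_add_right])
    (fun _ _ _ => by
      simp only [clifford_smul_left, clifford_smul, pairing_smul_right, smul_eq_mul]))
  simp only [LinearMap.mk₂_apply] at h
  simp only [cliffordQuad, ← pairingₗ_apply, map_sum, LinearMap.sum_apply]
  simp only [pairingₗ_apply, pairing_clifford, h]

theorem cliffordQuad_clifford_left (w : V × (V →L[ℝ] ℝ)) :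
    cliffordQuad j (clifford w ρ) = -(4 : ℝ) • clifford w ρ' := by
  rw [hj.cliffordQuad_clifford, hj.cliffordQuad_left, hj.left, clifford_smul]
  module

/-- The operator `cliffordQuad j` is skew for the pairing and sends wρ to -4wρ'. Applying it to
either argument of ⟨w₁ρ, w₂ρ⟩ gives the symmetry. -/
theorem pairing_clifford_symm (w₁ w₂ : V × (V →L[ℝ] ℝ)) :
    pairing ε (clifford w₁ ρ') (clifford w₂ ρ) = pairing ε (clifford w₂ ρ') (clifford w₁ ρ) := by
  have h := hj.pairing_cliffordQuad (ε := ε) (clifford w₁ ρ) (clifford w₂ ρ)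
  rw [hj.cliffordQuad_clifford_left, hj.cliffordQuad_clifford_left, pairing_smul_left,
    pairing_smul_right, pairing_skew ε (clifford w₁ ρ)] at h
  linarith

/-- This identifies the moment map of ρ with a multiple of j. The Clifford relation for w₁ and jw₂
is applied to ρ' and paired with ρ; both terms equal ⟨w₁ρ, w₂ρ⟩, because (jw₂)ρ' = w₂ρ and by
`pairing_clifford_symm`. -/
theorem pairing_clifford_clifford (w₁ w₂ : V × (V →L[ℝ] ℝ)) :
    pairing ε (clifford w₁ ρ) (clifford w₂ ρ) =
      1 / 2 * wittForm w₁ (j w₂) * pairing ε ρ ρ' := by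
  have h1 := congrArg (pairing ε ρ) (clifford_clifford_add w₁ (j w₂) ρ')
  rw [pairing_add_right, ← pairing_clifford ε w₁ ρ (clifford (j w₂) ρ'),
    ← pairing_clifford ε (j w₂) ρ (clifford w₁ ρ'), pairing_smul_right,
    pairing_skew ε (clifford (j w₂) ρ), hj.pairing_clifford_symm, ← pairing_skew, hj.right] at h1
  linarith

/-- Since the moment form of ρ is a multiple of j, its trace against the moment form of ρ and χ is a
pairing of χ with `cliffordQuad j ρ` = -6ρ'. -/
theorem normDeriv_eq (χ : Spinor V ℝ) :
    normDeriv ε ρ χ = -(pairing ε ρ ρ' * pairing ε ρ' χ) := by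
  have h1 : ∀ i, ∑ k, momentForm ε ρ ρ (wittBasis V k) (wittBasis V i.swap) *
      momentForm ε ρ χ (wittBasis V i) (wittBasis V k.swap) =
      1 / 2 * pairing ε ρ ρ' * momentForm ε ρ χ (wittBasis V i) (j (wittBasis V i.swap)) := by
    intro i
    rw [← sum_wittForm_mul (momentForm ε ρ χ (wittBasis V i)) (j (wittBasis V i.swap)),
      Finset.mul_sum]
    refine Finset.sum_congr rfl fun k _ => ?_
    rw [momentForm_apply ε ρ ρ, hj.pairing_clifford_clifford]
    ring
  have h2 : ∀ x y, ∑ i, pairing ε (clifford (wittBasis V i) x)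
      (clifford (j (wittBasis V i.swap)) y) = pairing ε x (cliffordQuad j y) := by
    intro x y
    simp only [cliffordQuad, pairing_clifford]
    simp only [← pairingₗ_apply, map_sum]
  rw [normDeriv_apply, quarticForm, wittTrace_apply]
  simp only [h1]
  simp only [momentForm_apply, ← Finset.mul_sum, Finset.sum_add_distrib, h2]
  rw [pairing_skew ε ρ (cliffordQuad j χ), hj.pairing_cliffordQuad, hj.cliffordQuad_left,
    pairing_smul_right, pairing_skew ε χ ρ']
  ring

section Normalized

variable (hρ : pairing ε ρ' ρ = 1 / 2)
include hρ

theorem normDeriv_eq_half (χ : Spinor V ℝ) : normDeriv ε ρ χ = 1 / 2 * pairing ε ρ' χ := by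
  rw [hj.normDeriv_eq, pairing_skew, hρ]
  ring

/-- By homogeneity 4N(ρ) = dN(ρ), which is ½⟨ρ', ρ⟩ = 1/4. -/
theorem normQuartic_eq_sixteenth : normQuartic ε ρ = 1 / 16 := by
  have h := hj.normDeriv_eq_half hρ ρ
  rw [normDeriv_apply, hρ] at h
  rw [normQuartic_eq]
  linarith

variable (hε : ε (sixBasis V) ≠ 0)
include hε

/-- Line derivatives are not additive in general; here `pairing_cplxStr` exhibits the value as
linear in σ. -/
theorem cplxStr_add (σ σ' : Spinor V ℝ) :
    cplxStr ε ρ (σ + σ') = cplxStr ε ρ σ + cplxStr ε ρ σ' := by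
  refine pairing_injective hε (funext fun χ => ?_)
  have h := pairing_cplxStr hε (hj.normQuartic_eq_sixteenth hρ) (hj.normDeriv_eq_half hρ)
  simp only [pairing_add_left, h, normDeriv₂_comm ε ρ _ χ, map_add, pairing_add_right]
  ring

theorem cplxStr_smul (c : ℝ) (σ : Spinor V ℝ) :
    cplxStr ε ρ (c • σ) = c • cplxStr ε ρ σ := by
  refine pairing_injective hε (funext fun χ => ?_)
  have h := pairing_cplxStr hε (hj.normQuartic_eq_sixteenth hρ) (hj.normDeriv_eq_half hρ)
  simp only [pairing_smul_left, h, normDeriv₂_comm ε ρ _ χ, map_smul, pairing_smul_right,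
    smul_eq_mul]
  ring

/-- Euler's relation: ρ ↦ ρ̂ is homogeneous of degree 1 and ρ̂ = ρ'. -/
theorem cplxStr_self : cplxStr ε ρ ρ = ρ' := by
  refine pairing_injective hε (funext fun χ => ?_)
  beta_reduce
  rw [pairing_cplxStr hε (hj.normQuartic_eq_sixteenth hρ) (hj.normDeriv_eq_half hρ),
    normDeriv₂_self, hj.normDeriv_eq_half hρ, hρ]
  ring

/-- The product w₁w₂ is half a commutator plus a scalar. On the commutator `J` is given by
equivariance; the rank-one term of `pairing_cplxStr` drops out because ⟨ρ', [w₁, w₂]ρ⟩ = 0. On the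
scalar, Jρ = ρ'. -/
theorem cplxStr_clifford_clifford (w₁ w₂ : V × (V →L[ℝ] ℝ)) :
    cplxStr ε ρ (clifford w₁ (clifford w₂ ρ)) = clifford w₁ (clifford w₂ ρ') := by
  have h1 : cplxStr ε ρ (cliffordComm w₁ w₂ ρ) = cliffordComm w₁ w₂ ρ' := by
    refine pairing_injective hε (funext fun χ => ?_)
    have h : pairing ε ρ' (cliffordComm w₁ w₂ ρ) = 0 := by
      rw [cliffordComm, pairing_sub_right, ← pairing_clifford ε w₁ ρ' (clifford w₂ ρ),
        ← pairing_clifford ε w₂ ρ' (clifford w₁ ρ), hj.pairing_clifford_symm, sub_self]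
    beta_reduce
    rw [pairing_cplxStr hε (hj.normQuartic_eq_sixteenth hρ) (hj.normDeriv_eq_half hρ),
      normDeriv₂_cliffordComm, hj.normDeriv_eq_half hρ, h, pairing_cliffordComm]
    ring
  have h2 : ∀ x : Spinor V ℝ, clifford w₁ (clifford w₂ x) =
      (1 / 2 : ℝ) • cliffordComm w₁ w₂ x + (1 / 2 * wittForm w₁ w₂) • x := by
    intro x
    rw [cliffordComm, eq_sub_of_add_eq' (clifford_clifford_add w₁ w₂ x)]
    module
  rw [h2, h2, hj.cplxStr_add hρ hε, hj.cplxStr_smul hρ hε, hj.cplxStr_smul hρ hε, h1,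
    hj.cplxStr_self hρ hε]

end Normalized

end IsPurePair

end PurePair

end GenCY

end

/-! ### The volume element of a complex spinor; multiplication of arguments by i. -/

noncomputable section

namespace GenCY

section VolumeForm

variable {V : Type*} [NormedAddCommGroup V] [NormedSpace ℝ V]

theorem imForm_wedge_conjForm {k l : ℕ} (α : V [⋀^Fin k]→L[ℝ] ℂ) (β : V [⋀^Fin l]→L[ℝ] ℂ) :
    imForm (wedge α (conjForm β)) =
      wedge (imForm α) (reForm β) - wedge (reForm α) (imForm β) := by
  ext v
  have h : imForm (wedge α (conjForm β)) v = (wedge α (conjForm β) v).im := rfl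
  rw [h, ContinuousAlternatingMap.sub_apply, wedge_apply_eq_sum, wedge_apply_eq_sum,
    wedge_apply_eq_sum, Complex.smul_im, ← smul_sub, ← Finset.sum_sub_distrib, Complex.im_sum]
  congr 1
  refine Finset.sum_congr rfl fun σ _ => ?_
  rw [← smul_sub]
  rcases Int.units_eq_one_or (Equiv.Perm.sign σ) with hs | hs <;>
    · simp [hs, imForm, reForm, conjForm, Complex.mul_im]
      ring

variable [FiniteDimensional ℝ V] [hV : Fact (Module.finrank ℝ V = 6)]

/-- Im⟨φ, φ̄⟩ = ⟨ρ', ρ⟩ - ⟨ρ, ρ'⟩ and the pairing is skew. With this volume element ⟨ρ', ρ⟩ is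
normalized to 1/2, the value assumed for pure pairs. -/
theorem volOf_eq (φ : Spinor V ℂ) : volOf φ =
    (2 : ℝ) • mukai (fun k => imForm (φ k)) (fun k => reForm (φ k)) := by
  have h : volOf φ = mukai (fun k => imForm (φ k)) (fun k => reForm (φ k)) -
      mukai (fun k => reForm (φ k)) (fun k => imForm (φ k)) := by
    rw [mukai_eq, mukai_eq, volOf, mukai_eq]
    have e : ∀ α β : V [⋀^Fin 6]→L[ℝ] ℂ, imForm (α + β) = imForm α + imForm β := fun α β => by
      ext; rfl
    have e' : ∀ α β : V [⋀^Fin 6]→L[ℝ] ℂ, imForm (α - β) = imForm α - imForm β := fun α β => by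
      ext; rfl
    have a0 : imForm ((wedge (φ 0) (conjForm (φ 6)) :) : V [⋀^Fin 6]→L[ℝ] ℂ) =
      ((wedge (imForm (φ 0)) (reForm (φ 6)) :) : V [⋀^Fin 6]→L[ℝ] ℝ) -
      (wedge (reForm (φ 0)) (imForm (φ 6)) :) := imForm_wedge_conjForm (φ 0) (φ 6)
    have a1 : imForm ((wedge (φ 1) (conjForm (φ 5)) :) : V [⋀^Fin 6]→L[ℝ] ℂ) =
      ((wedge (imForm (φ 1)) (reForm (φ 5)) :) : V [⋀^Fin 6]→L[ℝ] ℝ) -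
      (wedge (reForm (φ 1)) (imForm (φ 5)) :) := imForm_wedge_conjForm (φ 1) (φ 5)
    have a2 : imForm ((wedge (φ 2) (conjForm (φ 4)) :) : V [⋀^Fin 6]→L[ℝ] ℂ) =
      ((wedge (imForm (φ 2)) (reForm (φ 4)) :) : V [⋀^Fin 6]→L[ℝ] ℝ) -
      (wedge (reForm (φ 2)) (imForm (φ 4)) :) := imForm_wedge_conjForm (φ 2) (φ 4)
    have a3 : imForm ((wedge (φ 3) (conjForm (φ 3)) :) : V [⋀^Fin 6]→L[ℝ] ℂ) =
      ((wedge (imForm (φ 3)) (reForm (φ 3)) :) : V [⋀^Fin 6]→L[ℝ] ℝ) -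
      (wedge (reForm (φ 3)) (imForm (φ 3)) :) := imForm_wedge_conjForm (φ 3) (φ 3)
    have a4 : imForm ((wedge (φ 4) (conjForm (φ 2)) :) : V [⋀^Fin 6]→L[ℝ] ℂ) =
      ((wedge (imForm (φ 4)) (reForm (φ 2)) :) : V [⋀^Fin 6]→L[ℝ] ℝ) -
      (wedge (reForm (φ 4)) (imForm (φ 2)) :) := imForm_wedge_conjForm (φ 4) (φ 2)
    have a5 : imForm ((wedge (φ 5) (conjForm (φ 1)) :) : V [⋀^Fin 6]→L[ℝ] ℂ) =
      ((wedge (imForm (φ 5)) (reForm (φ 1)) :) : V [⋀^Fin 6]→L[ℝ] ℝ) -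
      (wedge (reForm (φ 5)) (imForm (φ 1)) :) := imForm_wedge_conjForm (φ 5) (φ 1)
    have a6 : imForm ((wedge (φ 6) (conjForm (φ 0)) :) : V [⋀^Fin 6]→L[ℝ] ℂ) =
      ((wedge (imForm (φ 6)) (reForm (φ 0)) :) : V [⋀^Fin 6]→L[ℝ] ℝ) -
      (wedge (reForm (φ 6)) (imForm (φ 0)) :) := imForm_wedge_conjForm (φ 6) (φ 0)
    simp only [e, e', a0, a1, a2, a3, a4, a5, a6]
    abel
  rw [h, mukai_skew (fun k => reForm (φ k)), two_smul, sub_neg_eq_add]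

theorem volOf_basis_ne_zero {φ : Spinor V ℂ}
    (h : mukai (fun k => imForm (φ k)) (fun k => reForm (φ k)) ≠ 0) :
    volOf φ (sixBasis V) ≠ 0 := fun h0 => h <| by
  have h1 := form_six_eq_zero h0
  rw [volOf_eq] at h1
  exact (smul_eq_zero.mp h1).resolve_left two_ne_zero

theorem pairing_volOf {φ : Spinor V ℂ}
    (h : mukai (fun k => imForm (φ k)) (fun k => reForm (φ k)) ≠ 0) :
    pairing (volOf φ) (fun k => imForm (φ k)) (fun k => reForm (φ k)) = 1 / 2 := by
  have h1 := volOf_basis_ne_zero h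
  rw [volOf_eq, ContinuousAlternatingMap.smul_apply, smul_eq_mul] at h1
  rw [pairing, volOf_eq, ContinuousAlternatingMap.smul_apply, smul_eq_mul]
  field_simp [right_ne_zero_of_mul h1]

end VolumeForm

section Rotation

variable {E : Type*} [NormedAddCommGroup E] [NormedSpace ℂ E]
variable {F : Type*} [NormedField F] [NormedAlgebra ℝ F]

variable (E) in
/-- Multiplication by `i` as a real linear map. -/
def mulI : E →L[ℝ] E := Complex.I • ContinuousLinearMap.id ℝ E

@[simp] theorem mulI_apply (v : E) : mulI E v = Complex.I • v := rfl

/-- The form `α(i v₁, …, i vₖ)`. -/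
def rot {k : ℕ} (α : E [⋀^Fin k]→L[ℝ] F) : E [⋀^Fin k]→L[ℝ] F :=
  α.compContinuousLinearMap (mulI E)

/-- The form `∑ⱼ α(v₁, …, i vⱼ, …, vₖ)`. -/
def rotDeriv : ∀ {k : ℕ}, (E [⋀^Fin k]→L[ℝ] F) → E [⋀^Fin k]→L[ℝ] F
  | 0, _ => 0
  | _ + 1, α => ContinuousAlternatingMap.alternatizeUncurryFin (α.curryLeft ∘L mulI E)

theorem rot_apply {k : ℕ} (α : E [⋀^Fin k]→L[ℝ] F) (v : Fin k → E) :
    rot α v = α fun i => Complex.I • v i := rfl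

theorem rot_add {k : ℕ} (α β : E [⋀^Fin k]→L[ℝ] F) : rot (α + β) = rot α + rot β := rfl

theorem rot_neg {k : ℕ} (α : E [⋀^Fin k]→L[ℝ] F) : rot (-α) = -rot α := rfl

theorem rot_sub {k : ℕ} (α β : E [⋀^Fin k]→L[ℝ] F) : rot (α - β) = rot α - rot β := rfl

theorem rot_smul {k : ℕ} (c : ℝ) (α : E [⋀^Fin k]→L[ℝ] F) : rot (c • α) = c • rot α := rfl

theorem rot_rot {k : ℕ} (α : E [⋀^Fin k]→L[ℝ] F) : rot (rot α) = (-1 : ℝ) ^ k • α := by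
  ext v
  have h := α.toMultilinearMap.map_smul_univ (fun _ => (-1 : ℝ)) v
  rw [Finset.prod_const, Finset.card_univ, Fintype.card_fin] at h
  rw [ContinuousAlternatingMap.smul_apply, rot_apply, rot_apply]
  refine Eq.trans ?_ h
  change α _ = α _
  congr 1
  funext i
  rw [smul_smul, Complex.I_mul_I, neg_one_smul, neg_one_smul]

theorem rot_cwedge {k : ℕ} (ξ : E →L[ℝ] ℝ) (α : E [⋀^Fin k]→L[ℝ] F) :
    rot (cwedge ξ α) = cwedge (ξ ∘L mulI E) (rot α) := by
  ext v
  rw [rot_apply, cwedge_apply, cwedge_apply]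
  rfl

theorem curryLeft_rot {k : ℕ} (α : E [⋀^Fin (k + 1)]→L[ℝ] F) (v : E) :
    (rot α).curryLeft v = rot (α.curryLeft (Complex.I • v)) := by
  ext u
  rw [rot_apply, ContinuousAlternatingMap.curryLeft_apply_apply,
    ContinuousAlternatingMap.curryLeft_apply_apply, rot_apply]
  congr 1
  funext i
  refine Fin.cases ?_ (fun i => ?_) i <;> rfl

theorem rotDeriv_zero' (α : E [⋀^Fin 0]→L[ℝ] F) : rotDeriv α = 0 := rfl

theorem rotDeriv_add {k : ℕ} (α β : E [⋀^Fin k]→L[ℝ] F) :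
    rotDeriv (α + β) = rotDeriv α + rotDeriv β := by
  cases k with
  | zero => exact (add_zero (0 : E [⋀^Fin 0]→L[ℝ] F)).symm
  | succ k =>
    ext v
    simp only [rotDeriv, ContinuousAlternatingMap.alternatizeUncurryFin_apply,
      ContinuousAlternatingMap.add_apply, ← Finset.sum_add_distrib, ← smul_add]
    rfl

theorem rotDeriv_smul {k : ℕ} (c : ℝ) (α : E [⋀^Fin k]→L[ℝ] F) :
    rotDeriv (c • α) = c • rotDeriv α := by
  cases k with
  | zero => exact (form_smul_zero c).symm
  | succ k =>
    ext v
    simp only [rotDeriv, ContinuousAlternatingMap.alternatizeUncurryFin_apply,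
      ContinuousAlternatingMap.smul_apply, Finset.smul_sum]
    refine Finset.sum_congr rfl fun i _ => ?_
    rw [smul_comm c]
    rfl

theorem rotDeriv_eq_sum [FiniteDimensional ℝ E] {ι : Type*} [Fintype ι] (b : Module.Basis ι ℝ E)
    {k : ℕ} (α : E [⋀^Fin (k + 1)]→L[ℝ] F) : rotDeriv α =
      ∑ a, cwedge (LinearMap.toContinuousLinearMap (b.coord a) ∘L mulI E) (α.curryLeft (b a)) := by
  ext v
  rw [ContinuousAlternatingMap.sum_apply]
  simp only [rotDeriv, ContinuousAlternatingMap.alternatizeUncurryFin_apply, cwedge_apply]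
  rw [Finset.sum_comm]
  refine Finset.sum_congr rfl fun i _ => ?_
  rw [← Finset.smul_sum]
  congr 1
  have h : mulI E (v i) = ∑ a, (b.repr (mulI E (v i))) a • b a := (b.sum_repr _).symm
  rw [ContinuousLinearMap.comp_apply, h, map_sum, ContinuousAlternatingMap.sum_apply]
  refine Finset.sum_congr rfl fun a _ => ?_
  rw [map_smul]
  rfl

end Rotation

end GenCY

end

/-! ### Rotation and the Clifford action; the pure pair of a holomorphic volume form. -/

noncomputable section

namespace GenCY

section RotationRules

variable {E : Type*} [NormedAddCommGroup E] [NormedSpace ℂ E]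
variable {F : Type*} [NormedField F] [NormedAlgebra ℝ F]

theorem sum_apply_smul_coord {E' : Type*} [NormedAddCommGroup E'] [NormedSpace ℝ E']
    [FiniteDimensional ℝ E'] {ι : Type*} [Fintype ι] (b : Module.Basis ι ℝ E') (ξ : E' →L[ℝ] ℝ) :
    ∑ a, ξ (b a) • LinearMap.toContinuousLinearMap (b.coord a) = ξ := by
  ext v
  have h : ξ v = ∑ a, (b.repr v) a * ξ (b a) := by
    conv_lhs => rw [← b.sum_repr v, map_sum]
    simp
  rw [h]
  simp [mul_comm]

theorem neg_cwedge {E' : Type*} [NormedAddCommGroup E'] [NormedSpace ℝ E'] {k : ℕ}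
    (ξ : E' →L[ℝ] ℝ) (α : E' [⋀^Fin k]→L[ℝ] F) : cwedge (-ξ) α = -cwedge ξ α :=
  LinearMap.map_neg₂ (cwedgeₗ _) _ α

variable (E) in
/-- The complex structure on `E ⊕ E*` given by multiplication by `i`. -/
def rotWitt : (E × (E →L[ℝ] ℝ)) →ₗ[ℝ] (E × (E →L[ℝ] ℝ)) where
  toFun w := (Complex.I • w.1, -(w.2 ∘L mulI E))
  map_add' w w' := by
    refine Prod.ext (smul_add _ _ _) ?_
    ext v
    simp [add_comm]
  map_smul' c w := by
    refine Prod.ext (smul_comm _ _ _) ?_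
    ext v
    simp

/-- Rotating the arguments replaces contraction with v by contraction with -iv, and the product with
ξ by that with ξ ∘ i; both are given by minus `rotWitt`. -/
theorem clifford_rot (w : E × (E →L[ℝ] ℝ)) (x : Spinor E ℝ) :
    (fun k => rot (clifford w x k)) = -clifford (rotWitt E w) (fun k => rot (x k)) := by
  have h2 : ∀ {k} (α : E [⋀^Fin (k + 1)]→L[ℝ] ℝ),
      α.curryLeft (Complex.I • Complex.I • w.1) = -α.curryLeft w.1 := fun α => by
    rw [smul_smul, Complex.I_mul_I, neg_one_smul, map_neg]
  funext k
  rw [Pi.neg_apply]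
  cases k with
  | zero =>
    simp only [clifford_zero, curryLeft_rot, rotWitt, LinearMap.coe_mk, AddHom.coe_mk, h2, rot_neg,
      neg_neg]
  | succ k =>
    simp only [clifford_succ, curryLeft_rot, rotWitt, LinearMap.coe_mk, AddHom.coe_mk, h2, rot_neg,
      rot_add, rot_cwedge, neg_cwedge]
    abel

variable [FiniteDimensional ℝ E]

theorem rotDeriv_cwedge {k : ℕ} (ξ : E →L[ℝ] ℝ) (α : E [⋀^Fin k]→L[ℝ] F) :
    rotDeriv (cwedge ξ α) = cwedge ξ (rotDeriv α) + cwedge (ξ ∘L mulI E) α := by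
  let b := Module.finBasis ℝ E
  have h : cwedge (ξ ∘L mulI E) α =
      ∑ a, ξ (b a) • cwedge (LinearMap.toContinuousLinearMap (b.coord a) ∘L mulI E) α := by
    conv_lhs => rw [← sum_apply_smul_coord b ξ]
    rw [ContinuousLinearMap.finsetSum_comp, ← cwedgeₗ_apply, map_sum, LinearMap.sum_apply]
    refine Finset.sum_congr rfl fun a _ => ?_
    rw [← smul_cwedge]
    rfl
  cases k with
  | zero =>
    have h0 : cwedge ξ (rotDeriv α) = 0 := cwedge_zero ξ
    have h1 : rotDeriv (cwedge ξ α) = cwedge (ξ ∘L mulI E) α := by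
      rw [h, rotDeriv_eq_sum b]
      exact Finset.sum_congr rfl fun a _ => by rw [curryLeft_cwedge_zero, cwedge_smul]
    rw [h1, h0]
    exact (zero_add (cwedge (ξ ∘L mulI E) α)).symm
  | succ k =>
    rw [h, rotDeriv_eq_sum b, rotDeriv_eq_sum b α, ← cwedgeₗ_apply ξ (∑ a, _), map_sum,
      ← Finset.sum_add_distrib]
    refine Finset.sum_congr rfl fun a _ => ?_
    rw [curryLeft_cwedge, cwedge_sub, cwedge_smul, cwedge_anticomm, cwedgeₗ_apply]
    abel

theorem curryLeft_rotDeriv {k : ℕ} (α : E [⋀^Fin (k + 1)]→L[ℝ] F) (v : E) :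
    (rotDeriv α).curryLeft v = rotDeriv (α.curryLeft v) + α.curryLeft (Complex.I • v) := by
  let b := Module.finBasis ℝ E
  have h : α.curryLeft (Complex.I • v) =
      ∑ a, (LinearMap.toContinuousLinearMap (b.coord a) ∘L mulI E) v • α.curryLeft (b a) := by
    conv_lhs => rw [← b.sum_repr (Complex.I • v), map_sum]
    refine Finset.sum_congr rfl fun a _ => ?_
    rw [map_smul]
    rfl
  have hs : ∀ {n m : ℕ} (g : Fin n → E [⋀^Fin (m + 1)]→L[ℝ] F),
      (∑ a, g a).curryLeft v = ∑ a, (g a).curryLeft v := by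
    intro n m g
    let L : (E [⋀^Fin (m + 1)]→L[ℝ] F) →+ E [⋀^Fin m]→L[ℝ] F :=
      { toFun := fun α => α.curryLeft v, map_zero' := rfl, map_add' := fun _ _ => rfl }
    exact map_sum L g _
  rw [rotDeriv_eq_sum b, hs, h]
  cases k with
  | zero =>
    rw [rotDeriv_zero', zero_add]
    exact Finset.sum_congr rfl fun a _ => curryLeft_cwedge_zero _ _ _
  | succ k =>
    rw [rotDeriv_eq_sum b, ← Finset.sum_add_distrib]
    refine Finset.sum_congr rfl fun a _ => ?_
    rw [curryLeft_cwedge, curryLeft_curryLeft_anticomm α (b a) v, cwedge_neg]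
    abel

/-- The infinitesimal counterpart of `clifford_rot`: passing the derivation through w differentiates
w. -/
theorem clifford_rotDeriv (w : E × (E →L[ℝ] ℝ)) (x : Spinor E ℝ) :
    (fun k => rotDeriv (clifford w x k)) =
      clifford w (fun k => rotDeriv (x k)) - clifford (rotWitt E w) x := by
  funext k
  rw [Pi.sub_apply]
  cases k with
  | zero =>
    simp only [clifford_zero, curryLeft_rotDeriv, rotDeriv_zero']
    simp [rotWitt]
  | succ k =>
    simp only [clifford_succ, rotDeriv_add, rotDeriv_cwedge, curryLeft_rotDeriv]
    simp only [rotWitt, LinearMap.coe_mk, AddHom.coe_mk, neg_cwedge]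
    abel

end RotationRules

section HolomorphicSpinor

variable {E : Type*} [NormedAddCommGroup E] [NormedSpace ℂ E]

/-- A complex multilinear form of degree `3` as a complex spinor. -/
def holSpinor (Ω : E [⋀^Fin 3]→L[ℂ] ℂ) : Spinor E ℂ := Pi.single 3 (Ω.restrictScalars ℝ)

/-- Its real part. -/
def holRe (Ω : E [⋀^Fin 3]→L[ℂ] ℂ) : Spinor E ℝ := fun k => reForm (holSpinor Ω k)

/-- Its imaginary part. -/
def holIm (Ω : E [⋀^Fin 3]→L[ℂ] ℂ) : Spinor E ℝ := fun k => imForm (holSpinor Ω k)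

theorem holSpinor_three (Ω : E [⋀^Fin 3]→L[ℂ] ℂ) : holSpinor Ω 3 = Ω.restrictScalars ℝ :=
  Pi.single_eq_same _ _

theorem holSpinor_of_ne (Ω : E [⋀^Fin 3]→L[ℂ] ℂ) {k : ℕ} (h : k ≠ 3) : holSpinor Ω k = 0 :=
  Pi.single_eq_of_ne h _

theorem holRe_of_ne (Ω : E [⋀^Fin 3]→L[ℂ] ℂ) {k : ℕ} (h : k ≠ 3) : holRe Ω k = 0 := by
  rw [holRe, holSpinor_of_ne Ω h]
  rfl

theorem holIm_of_ne (Ω : E [⋀^Fin 3]→L[ℂ] ℂ) {k : ℕ} (h : k ≠ 3) : holIm Ω k = 0 := by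
  rw [holIm, holSpinor_of_ne Ω h]
  rfl

theorem holRe_three_apply (Ω : E [⋀^Fin 3]→L[ℂ] ℂ) (v : Fin 3 → E) :
    holRe Ω 3 v = (Ω v).re := by
  rw [holRe, holSpinor_three]
  rfl

theorem holIm_three_apply (Ω : E [⋀^Fin 3]→L[ℂ] ℂ) (v : Fin 3 → E) :
    holIm Ω 3 v = (Ω v).im := by
  rw [holIm, holSpinor_three]
  rfl

theorem map_vecCons_smul (Ω : E [⋀^Fin 3]→L[ℂ] ℂ) (c : ℂ) (v : E) (u : Fin 2 → E) :
    Ω (Matrix.vecCons (c • v) u) = c * Ω (Matrix.vecCons v u) := by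
  have h := congrArg (fun α => α u) (Ω.curryLeft.map_smul c v)
  exact h

theorem holRe_curryLeft_I (Ω : E [⋀^Fin 3]→L[ℂ] ℂ) (k : ℕ) (v : E) :
    (holRe Ω (k + 1)).curryLeft (Complex.I • v) = -(holIm Ω (k + 1)).curryLeft v := by
  by_cases hk : k = 2
  · subst hk
    ext u
    rw [ContinuousAlternatingMap.neg_apply, ContinuousAlternatingMap.curryLeft_apply_apply,
      ContinuousAlternatingMap.curryLeft_apply_apply, holRe_three_apply, holIm_three_apply,
      map_vecCons_smul]
    simp
  · rw [holRe_of_ne Ω (by omega), holIm_of_ne Ω (by omega), form_zero_apply, form_zero_apply,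
      neg_zero]

theorem holIm_curryLeft_I (Ω : E [⋀^Fin 3]→L[ℂ] ℂ) (k : ℕ) (v : E) :
    (holIm Ω (k + 1)).curryLeft (Complex.I • v) = (holRe Ω (k + 1)).curryLeft v := by
  by_cases hk : k = 2
  · subst hk
    ext u
    rw [ContinuousAlternatingMap.curryLeft_apply_apply,
      ContinuousAlternatingMap.curryLeft_apply_apply, holRe_three_apply, holIm_three_apply,
      map_vecCons_smul]
    simp
  · rw [holRe_of_ne Ω (by omega), holIm_of_ne Ω (by omega), form_zero_apply, form_zero_apply]

/-- `ρ'` is obtained from `ρ` by multiplying the arguments by `i`. -/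
theorem rot_holRe (Ω : E [⋀^Fin 3]→L[ℂ] ℂ) (k : ℕ) : rot (holRe Ω k) = holIm Ω k := by
  by_cases hk : k = 3
  · subst hk
    ext v
    have h := Ω.toMultilinearMap.map_smul_univ (fun _ => Complex.I) v
    rw [Finset.prod_const, Finset.card_univ, Fintype.card_fin] at h
    have h2 : Ω (fun i => Complex.I • v i) = Complex.I ^ 3 • Ω v := h
    rw [rot_apply, holRe_three_apply, holIm_three_apply, h2, Complex.I_pow_three]
    simp
  · rw [holRe_of_ne Ω hk, holIm_of_ne Ω hk]
    rfl

/-- An i in any of the three slots comes out of Ω as a factor, and Re(iΩ) = -Im Ω. -/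
theorem rotDeriv_holRe (Ω : E [⋀^Fin 3]→L[ℂ] ℂ) :
    (fun k => rotDeriv (holRe Ω k)) = -(3 : ℝ) • holIm Ω := by
  funext k
  by_cases hk : k = 3
  · subst hk
    have h : (holRe Ω 3).curryLeft ∘L mulI E = -(holIm Ω 3).curryLeft :=
      ContinuousLinearMap.ext fun v => holRe_curryLeft_I Ω 2 v
    have h2 := ContinuousAlternatingMap.alternatizeUncurryFin_curryLeft (holIm Ω 3)
    have h3 : rotDeriv (holRe Ω 3) = -ContinuousAlternatingMap.alternatizeUncurryFin
        (holIm Ω 3).curryLeft := by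
      rw [rotDeriv, h]
      ext v
      rw [ContinuousAlternatingMap.neg_apply, ContinuousAlternatingMap.alternatizeUncurryFin_apply,
        ContinuousAlternatingMap.alternatizeUncurryFin_apply, ← Finset.sum_neg_distrib]
      refine Finset.sum_congr rfl fun p _ => ?_
      rw [← smul_neg]
      rfl
    rw [h3, h2, Pi.smul_apply]
    module
  · have h0 : rotDeriv (0 : E [⋀^Fin k]→L[ℝ] ℝ) = 0 := by
      have := rotDeriv_smul 0 (0 : E [⋀^Fin k]→L[ℝ] ℝ)
      rwa [form_smul_zero, zero_smul] at this
    rw [holRe_of_ne Ω hk, Pi.smul_apply, holIm_of_ne Ω hk, h0, form_smul_zero]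

variable [FiniteDimensional ℂ E] [hE : Fact (Module.finrank ℂ E = 3)]

theorem holForm_four_eq_zero (α : E [⋀^Fin 4]→L[ℂ] ℂ) : α = 0 := by
  ext v
  exact α.toAlternatingMap.map_linearDependent v fun hv => by
    have h := hv.fintype_card_le_finrank
    rw [hE.out, Fintype.card_fin] at h
    omega

/-- The bracket is the value of the ℂ-linear covector ζ with real part ξ, and ζ ∧ Ω is a
ℂ-multilinear 4-form on a complex 3-space, hence zero. -/
theorem sum_extend_smul_eq_zero (Ω : E [⋀^Fin 3]→L[ℂ] ℂ) (ξ : E →L[ℝ] ℝ) (v : Fin 4 → E) :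
    ∑ p : Fin 4, (-1 : ℤ) ^ (p : ℕ) • (((ξ (v p) : ℂ) - Complex.I * ξ (Complex.I • v p)) *
      Ω (p.removeNth v)) = 0 := by
  let ζ : E →L[ℂ] ℂ := StrongDual.extendRCLike ξ
  have h := congrArg (fun α => α v)
    (holForm_four_eq_zero (ContinuousAlternatingMap.alternatizeUncurryFin (ζ.smulRight Ω)))
  simp only [ContinuousAlternatingMap.alternatizeUncurryFin_apply] at h
  have hζ : ∀ x, ζ x = (ξ x : ℂ) - Complex.I * ξ (Complex.I • x) := fun _ => rfl
  simp only [← hζ]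
  exact h

/-- This is the imaginary part of ζ ∧ Ω = 0 for ζ = ξ - i(ξ ∘ i). -/
theorem cwedge_holRe (Ω : E [⋀^Fin 3]→L[ℂ] ℂ) (k : ℕ) (ξ : E →L[ℝ] ℝ) :
    cwedge (ξ ∘L mulI E) (holRe Ω k) = cwedge ξ (holIm Ω k) := by
  by_cases hk : k = 3
  · subst hk
    ext v
    have h := congrArg Complex.im (sum_extend_smul_eq_zero Ω ξ v)
    rw [Complex.im_sum] at h
    rw [cwedge_apply, cwedge_apply, ← sub_eq_zero, ← Finset.sum_sub_distrib, ← neg_eq_zero,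
      ← Finset.sum_neg_distrib]
    refine Eq.trans (Finset.sum_congr rfl fun p _ => ?_) h
    rw [holRe_three_apply, holIm_three_apply]
    rcases neg_one_pow_eq_or ℤ (p : ℕ) with hp | hp <;>
    · rw [hp]
      simp [Complex.mul_im]
      try ring
  · rw [holRe_of_ne Ω hk, holIm_of_ne Ω hk, cwedge_zero, cwedge_zero]

theorem cwedge_holIm (Ω : E [⋀^Fin 3]→L[ℂ] ℂ) (k : ℕ) (ξ : E →L[ℝ] ℝ) :
    cwedge (ξ ∘L mulI E) (holIm Ω k) = -cwedge ξ (holRe Ω k) := by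
  have h := cwedge_holRe Ω k (ξ ∘L mulI E)
  rw [← h]
  have h2 : (ξ ∘L mulI E) ∘L mulI E = -ξ := by
    ext v
    simp [smul_smul]
  rw [h2]
  exact neg_cwedge _ _

theorem isPurePair_hol (Ω : E [⋀^Fin 3]→L[ℂ] ℂ) :
    IsPurePair (holRe Ω) (holIm Ω) (rotWitt E) where
  skew w w' := by
    simp [rotWitt, wittForm_apply, add_comm]
  sq w := by
    refine Prod.ext ?_ ?_
    · simp [rotWitt, smul_smul]
    · ext v
      simp [rotWitt, smul_smul]
  left w := by
    funext k
    rw [Pi.neg_apply]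
    cases k with
    | zero => exact holRe_curryLeft_I Ω 0 w.1
    | succ k =>
      rw [clifford_succ, clifford_succ, neg_add, ← holRe_curryLeft_I, ← cwedge_holRe, ← neg_cwedge]
      rfl
  right w := by
    funext k
    cases k with
    | zero => exact holIm_curryLeft_I Ω 0 w.1
    | succ k =>
      rw [clifford_succ, clifford_succ, ← holIm_curryLeft_I, ← neg_neg (cwedge w.2 (holRe Ω k)),
        ← cwedge_holIm, ← neg_cwedge]
      rfl

end HolomorphicSpinor

end GenCY

end

/-! ### Nonvanishing of Ω ∧ Ω̄. -/

noncomputable section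

namespace GenCY

attribute [local irreducible] pairing clifford

section NonVanishing

theorem reForm_wedge_conjForm {V : Type*} [NormedAddCommGroup V] [NormedSpace ℝ V] {k l : ℕ}
    (α : V [⋀^Fin k]→L[ℝ] ℂ) (β : V [⋀^Fin l]→L[ℝ] ℂ) :
    reForm (wedge α (conjForm β)) =
      wedge (reForm α) (reForm β) + wedge (imForm α) (imForm β) := by
  ext v
  have h : reForm (wedge α (conjForm β)) v = (wedge α (conjForm β) v).re := rfl
  rw [h, ContinuousAlternatingMap.add_apply, wedge_apply_eq_sum, wedge_apply_eq_sum,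
    wedge_apply_eq_sum, Complex.smul_re, ← smul_add, ← Finset.sum_add_distrib, Complex.re_sum]
  congr 1
  refine Finset.sum_congr rfl fun σ _ => ?_
  rw [← smul_add]
  rcases Int.units_eq_one_or (Equiv.Perm.sign σ) with hs | hs <;>
    · simp [hs, imForm, reForm, conjForm, Complex.mul_re]
      try ring

variable {E : Type*} [NormedAddCommGroup E] [NormedSpace ℂ E]

theorem holSpinor_curryLeft_I (Ω : E [⋀^Fin 3]→L[ℂ] ℂ) (v : E) :
    (holSpinor Ω 3).curryLeft (Complex.I • v) = Complex.I • (holSpinor Ω 3).curryLeft v := by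
  rw [holSpinor_three]
  ext u
  exact map_vecCons_smul Ω Complex.I v u

variable [FiniteDimensional ℝ E]

/-- Contraction with vectors of type `(0, 1)`. -/
theorem wedge_curryLeft_eq_zero {Ω : E [⋀^Fin 3]→L[ℂ] ℂ} {l : ℕ} {β : E [⋀^Fin (l + 1)]→L[ℝ] ℂ}
    (hβ : ∀ v, β.curryLeft (Complex.I • v) = -(Complex.I • β.curryLeft v))
    (h : wedge (holSpinor Ω 3) β = 0) (v : E) : wedge (holSpinor Ω 3) (β.curryLeft v) = 0 := by
  have h1 := curryLeft_wedge (k := 2) (holSpinor Ω 3) β v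
  have h2 := curryLeft_wedge (k := 2) (holSpinor Ω 3) β (Complex.I • v)
  have h0 : wedge (k := 2 + 1) (holSpinor Ω 3) β = 0 := h
  rw [h0, castDeg_zero, form_zero_apply] at h1 h2
  rw [hβ, holSpinor_curryLeft_I, wedge_smul_left, wedge_neg_right, wedge_smul_right] at h2
  have h3 : wedge (k := 2 + 1) (holSpinor Ω 3) (β.curryLeft v) = 0 := by
    have hz : ∀ {k l : ℕ} (e : k = l) (α : E [⋀^Fin k]→L[ℝ] ℂ), castDeg e α = 0 → α = 0 := by
      intro k l e α hα
      subst e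
      exact hα
    refine hz (Nat.succ_add 2 l) _ ?_
    ext u
    have e1 := congrArg (fun α => α u) h1
    have e2 := congrArg (fun α => α u) h2
    simp only [ContinuousAlternatingMap.add_apply, ContinuousAlternatingMap.smul_apply,
      castDeg_apply, ContinuousAlternatingMap.neg_apply,
      Complex.real_smul, smul_eq_mul] at e1 e2 ⊢
    have z : ∀ {n : ℕ} (x : Fin n → E), (0 : E [⋀^Fin n]→L[ℝ] ℂ) x = 0 := fun _ => rfl
    rw [z] at e1 e2 ⊢
    push_cast at e1 e2
    -- The combination of the contractions with v and iv eliminates the term in which Ω is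
    -- contracted.
    refine mul_left_cancel₀ Complex.I_ne_zero ?_
    linear_combination (Complex.I * e1 - e2) / 2
  exact h3

/-- Contractions with vectors of type (0,1) hit only Ω̄. After three of them Ω ∧ Ω̄ = 0 becomes
Ω̄(v₀, v₁, v₂) Ω = 0, and evaluation at the same vectors gives |Ω(v)|² = 0. -/
theorem wedge_conj_ne_zero {Ω : E [⋀^Fin 3]→L[ℂ] ℂ} (hΩ : Ω ≠ 0) :
    wedge (holSpinor Ω 3) (conjForm (holSpinor Ω 3)) ≠ 0 := by
  intro h
  have hc : ∀ v, (conjForm (holSpinor Ω 3)).curryLeft (Complex.I • v) =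
      -(Complex.I • (conjForm (holSpinor Ω 3)).curryLeft v) := by
    intro v
    have h1 := congrArg conjForm (holSpinor_curryLeft_I Ω v)
    refine Eq.trans h1 ?_
    ext u
    simp [conjForm]
  have hi : ∀ {l : ℕ} (γ : E [⋀^Fin (l + 2)]→L[ℝ] ℂ), (∀ v, γ.curryLeft (Complex.I • v) =
      -(Complex.I • γ.curryLeft v)) → ∀ u v, (γ.curryLeft u).curryLeft (Complex.I • v) =
      -(Complex.I • (γ.curryLeft u).curryLeft v) := by
    intro l γ hγ u v
    rw [curryLeft_curryLeft_anticomm, hγ, curryLeft_curryLeft_anticomm γ u v]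
    ext w
    simp
  apply hΩ
  ext v
  have h1 := wedge_curryLeft_eq_zero hc h (v 0)
  have h2 := wedge_curryLeft_eq_zero (hi _ hc (v 0)) h1 (v 1)
  have h3 := wedge_curryLeft_eq_zero (hi _ (hi _ hc (v 0)) (v 1)) h2 (v 2)
  rw [wedge_comm_of_degree_zero] at h3
  have h4 := congrArg (fun α => α v) h3
  have h5 : holSpinor Ω 3 v = Ω v := by rw [holSpinor_three]; rfl
  have h6 : (((conjForm (holSpinor Ω 3)).curryLeft (v 0)).curryLeft (v 1)).curryLeft (v 2) 0 =
      (starRingEnd ℂ) (Ω v) := by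
    rw [← h5]
    simp only [ContinuousAlternatingMap.curryLeft_apply_apply]
    change (starRingEnd ℂ) (holSpinor Ω 3 _) = _
    congr 2
    funext i
    fin_cases i <;> rfl
  rw [h6] at h4
  change (starRingEnd ℂ) (Ω v) • holSpinor Ω 3 v = 0 at h4
  rw [h5] at h4
  rcases smul_eq_zero.mp h4 with h7 | h7
  · exact (map_eq_zero _).mp h7
  · exact h7

/-- Squares of 3-forms vanish, so the real part of Ω ∧ Ω̄ is zero and its imaginary part is 2ρ' ∧ ρ.
-/
theorem wedge_holIm_holRe_ne_zero {Ω : E [⋀^Fin 3]→L[ℂ] ℂ} (hΩ : Ω ≠ 0) :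
    castDeg (l := 6) (by norm_num) (wedge (holIm Ω 3) (holRe Ω 3)) ≠ 0 := by
  intro h2
  rw [castDeg_rfl] at h2
  have hc : ∀ α β : E [⋀^Fin 3]→L[ℝ] ℝ, wedge α β = -wedge β α := by
    intro α β
    have h4 : wedge α β = (-1 : ℝ) ^ (3 * 3) • wedge β α := wedge_comm α β
    rw [h4]
    norm_num
  have hs : ∀ α : E [⋀^Fin 3]→L[ℝ] ℝ, wedge α α = 0 := by
    intro α
    ext v
    have h5 := congrArg (fun γ : E [⋀^Fin (3 + 3)]→L[ℝ] ℝ => γ v) (hc α α)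
    exact self_eq_neg.mp h5
  have h3 : wedge (holRe Ω 3) (holIm Ω 3) = 0 := by rw [hc, h2, neg_zero]
  apply wedge_conj_ne_zero hΩ
  have him : imForm (wedge (holSpinor Ω 3) (conjForm (holSpinor Ω 3))) = 0 :=
    (imForm_wedge_conjForm _ _).trans (sub_eq_zero.mpr (h2.trans h3.symm))
  have hre : reForm (wedge (holSpinor Ω 3) (conjForm (holSpinor Ω 3))) = 0 := by
    rw [reForm_wedge_conjForm, hs, hs, add_zero]
  generalize wedge (holSpinor Ω 3) (conjForm (holSpinor Ω 3)) = W at hre him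
  ext v
  exact Complex.ext (congrArg (fun γ => γ v) hre) (congrArg (fun γ => γ v) him)

theorem mukai_hol_ne_zero {Ω : E [⋀^Fin 3]→L[ℂ] ℂ} (hΩ : Ω ≠ 0) :
    mukai (holIm Ω) (holRe Ω) ≠ 0 := by
  have h1 : mukai (holIm Ω) (holRe Ω) =
      -castDeg (by norm_num) (wedge (holIm Ω 3) (holRe Ω 3)) := by
    rw [mukai_eq, holIm_of_ne Ω (k := 0) (by norm_num), holIm_of_ne Ω (k := 1) (by norm_num),
      holIm_of_ne Ω (k := 2) (by norm_num), holIm_of_ne Ω (k := 4) (by norm_num),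
      holIm_of_ne Ω (k := 5) (by norm_num), holIm_of_ne Ω (k := 6) (by norm_num)]
    simp only [zero_wedge, castDeg_rfl]
    abel
  rw [h1]
  exact neg_ne_zero.mpr (wedge_holIm_holRe_ne_zero hΩ)

end NonVanishing
end GenCY
end

/-! ### The holomorphic case: the spinors w₁w₂ρ span the odd forms. -/

noncomputable section

namespace GenCY

attribute [local irreducible] pairing clifford

theorem curryLeft_castDeg_wedge {V : Type*} [NormedAddCommGroup V] [NormedSpace ℝ V]
    [FiniteDimensional ℝ V] {k l n : ℕ} (h : k + 1 + (l + 1) = n + 1) (α : V [⋀^Fin (k + 1)]→L[ℝ] ℝ)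
    (β : V [⋀^Fin (l + 1)]→L[ℝ] ℝ) (v : V) :
    (castDeg h (wedge α β)).curryLeft v =
      castDeg (by omega) (wedge (α.curryLeft v) β) +
        (-1 : ℝ) ^ (k + 1) • castDeg (by omega) (wedge α (β.curryLeft v)) := by
  obtain rfl : n = k + (l + 1) := by omega
  exact curryLeft_wedge α β v

section Single

variable {V : Type*} [NormedAddCommGroup V] [NormedSpace ℝ V]

theorem clifford_vector_single {k : ℕ} (v : V) (α : V [⋀^Fin (k + 1)]→L[ℝ] ℝ) :
    clifford (v, 0) (Pi.single (k + 1) α) = Pi.single k (α.curryLeft v) := by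
  have h0 : ∀ {n : ℕ} (γ : V [⋀^Fin n]→L[ℝ] ℝ), cwedge (0 : V →L[ℝ] ℝ) γ = 0 := fun γ =>
    LinearMap.map_zero₂ (cwedgeₗ _) γ
  funext n
  have h1 : ∀ m, (Pi.single (M := fun j => V [⋀^Fin j]→L[ℝ] ℝ) (k + 1) α (m + 1)).curryLeft v =
      Pi.single (M := fun j => V [⋀^Fin j]→L[ℝ] ℝ) k (α.curryLeft v) m := by
    intro m
    by_cases hm : m = k
    · subst hm
      rw [Pi.single_eq_same, Pi.single_eq_same]
    · rw [Pi.single_eq_of_ne hm, Pi.single_eq_of_ne (by omega), form_zero_apply]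
  cases n with
  | zero => rw [clifford_zero, h1]
  | succ n => rw [clifford_succ, h0, add_zero, h1]

theorem clifford_covector_single {k : ℕ} (ξ : V →L[ℝ] ℝ) (α : V [⋀^Fin k]→L[ℝ] ℝ) :
    clifford (0, ξ) (Pi.single k α) = Pi.single (k + 1) (cwedge ξ α) := by
  have h0 : ∀ {n : ℕ} (γ : V [⋀^Fin (n + 1)]→L[ℝ] ℝ), γ.curryLeft 0 = 0 := fun γ =>
    γ.curryLeft.map_zero
  funext n
  cases n with
  | zero => rw [clifford_zero, h0, Pi.single_eq_of_ne (by omega)]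
  | succ n =>
    rw [clifford_succ, h0, zero_add]
    by_cases hn : n = k
    · subst hn
      rw [Pi.single_eq_same, Pi.single_eq_same]
    · rw [Pi.single_eq_of_ne hn, Pi.single_eq_of_ne (by omega), cwedge_zero]

variable [FiniteDimensional ℝ V] [hV : Fact (Module.finrank ℝ V = 6)]

theorem exists_smul_eq_of_ne_zero {ν : V [⋀^Fin 6]→L[ℝ] ℝ} (hν : ν ≠ 0)
    (μ : V [⋀^Fin 6]→L[ℝ] ℝ) : ∃ t : ℝ, μ = t • ν := by
  have h0 : ν (sixBasis V) ≠ 0 := fun h => hν (form_six_eq_zero h)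
  refine ⟨μ (sixBasis V) / ν (sixBasis V), ?_⟩
  rw [← sub_eq_zero]
  refine form_six_eq_zero ?_
  rw [ContinuousAlternatingMap.sub_apply, ContinuousAlternatingMap.smul_apply, smul_eq_mul,
    div_mul_cancel₀ _ h0, sub_self]

theorem sum_curryLeft_cwedge_five (X : V [⋀^Fin 5]→L[ℝ] ℝ) :
    ∑ a, (cwedge (LinearMap.toContinuousLinearMap ((sixBasis V).coord a)) X).curryLeft
      (sixBasis V a) = X := by
  have h1 := sum_cwedge_curryLeft (sixBasis V) (k := 4) X
  simp only [curryLeft_cwedge, Finset.sum_sub_distrib, h1]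
  simp only [LinearMap.coe_toContinuousLinearMap', Module.Basis.coord_apply,
    Module.Basis.repr_self, Finsupp.single_eq_same, one_smul]
  rw [Finset.sum_const, Finset.card_univ, Fintype.card_fin]
  module

end Single

section Holomorphic

variable {E : Type*} [NormedAddCommGroup E] [NormedSpace ℂ E]

theorem holRe_eq_single (Ω : E [⋀^Fin 3]→L[ℂ] ℂ) : holRe Ω = Pi.single 3 (holRe Ω 3) := by
  funext k
  by_cases hk : k = 3
  · subst hk
    rw [Pi.single_eq_same]
  · rw [Pi.single_eq_of_ne hk, holRe_of_ne Ω hk]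

theorem holIm_eq_single (Ω : E [⋀^Fin 3]→L[ℂ] ℂ) : holIm Ω = Pi.single 3 (holIm Ω 3) := by
  funext k
  by_cases hk : k = 3
  · subst hk
    rw [Pi.single_eq_same]
  · rw [Pi.single_eq_of_ne hk, holIm_of_ne Ω hk]

theorem rot_of_degree_zero (α : E [⋀^Fin 0]→L[ℝ] ℝ) : rot α = α := by
  ext v
  rw [rot_apply]
  congr 1
  exact Subsingleton.elim _ _

/-- The difference is y ∧ γ minus its own rotation, and the hypothesis makes rotation an involution
on y ∧ γ. For 1-forms γ this produces forms of type (2,0) + (0,2). -/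
theorem rot_cwedge_sub {k : ℕ} (y : E →L[ℝ] ℝ) (γ : E [⋀^Fin k]→L[ℝ] ℝ)
    (hγ : rot (rot γ) = -γ) :
    rot (cwedge y γ - cwedge (y ∘L mulI E) (rot γ)) =
      -(cwedge y γ - cwedge (y ∘L mulI E) (rot γ)) := by
  have h2 : (y ∘L mulI E) ∘L mulI E = -y := by
    ext v
    simp [smul_smul]
  rw [rot_sub, rot_cwedge, rot_cwedge, h2, hγ, neg_cwedge, cwedge_neg]
  abel

variable {Ω : E [⋀^Fin 3]→L[ℂ] ℂ}

variable (Ω) in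
/-- The span of the spinors `w₁ w₂ ρ`. -/
def holSpan : Submodule ℝ (Spinor E ℝ) :=
  Submodule.span ℝ (Set.range fun w : (E × (E →L[ℝ] ℝ)) × (E × (E →L[ℝ] ℝ)) =>
    clifford w.1 (clifford w.2 (holRe Ω)))

theorem clifford_mem_holSpan (w₁ w₂ : E × (E →L[ℝ] ℝ)) :
    clifford w₁ (clifford w₂ (holRe Ω)) ∈ holSpan Ω :=
  Submodule.subset_span ⟨(w₁, w₂), rfl⟩

variable [FiniteDimensional ℂ E] [hE : Fact (Module.finrank ℂ E = 3)]

/-- The form η is the real part of the ℂ-bilinear form H(x, y) = η(x, y) - iη(ix, y), and in complex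
dimension 3 every alternating ℂ-bilinear form is a contraction of Ω. In a basis b with c = Ω(b₀, b₁,
b₂) the vector has coordinates H₁₂/c, H₂₀/c, H₀₁/c. -/
theorem exists_curryLeft_eq_of_rot_eq_neg (hΩ : Ω ≠ 0) {η : E [⋀^Fin 2]→L[ℝ] ℝ}
    (hη : rot η = -η) : ∃ v, η = (holRe Ω 3).curryLeft v := by
  let b : Module.Basis (Fin 3) ℂ E := Module.finBasisOfFinrankEq ℂ E hE.out
  let H : Fin 3 → Fin 3 → ℂ := fun i j => (η ![b i, b j] : ℂ) - Complex.I * η ![Complex.I • b i, b j]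
  have hrot : ∀ γ : E [⋀^Fin 2]→L[ℝ] ℝ, rot γ = -γ → ∀ u v,
      γ ![Complex.I • u, Complex.I • v] = -γ ![u, v] := by
    intro γ hγ u v
    have h := congrArg (fun δ => δ ![u, v]) hγ
    rw [← ContinuousAlternatingMap.neg_apply, ← hγ, rot_apply]
    congr 1
    funext i
    fin_cases i <;> rfl
  have hswap : ∀ (γ : E [⋀^Fin 2]→L[ℝ] ℝ) u v, γ ![v, u] = -γ ![u, v] := by
    intro γ u v
    have h := γ.map_swap ![u, v] (show (0 : Fin 2) ≠ 1 by decide)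
    refine Eq.trans ?_ h
    rw [ContinuousAlternatingMap.coe_toAlternatingMap]
    congr 1
    funext i
    fin_cases i <;> rfl
  have hmix : ∀ γ : E [⋀^Fin 2]→L[ℝ] ℝ, rot γ = -γ → ∀ u v,
      γ ![u, Complex.I • v] = γ ![Complex.I • u, v] := by
    intro γ hγ u v
    have h := hrot γ hγ (Complex.I • u) v
    rw [smul_smul, Complex.I_mul_I] at h
    have h2 : γ ![(-1 : ℂ) • u, Complex.I • v] = -γ ![u, Complex.I • v] := by
      rw [neg_one_smul]
      have := congrArg (fun δ => δ ![Complex.I • v]) (γ.curryLeft.map_neg u)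
      exact this
    rw [h2] at h
    linarith
  have hH : ∀ i j, H j i = -H i j := by
    intro i j
    simp only [H]
    rw [hswap η (b i) (b j), hswap η (b i) (Complex.I • b j), hmix η hη]
    push_cast
    ring
  have hΩb : Ω ![b 0, b 1, b 2] ≠ 0 := by
    intro h
    apply hΩ
    have h2 : Ω.toAlternatingMap = 0 := by
      refine b.ext_alternating fun v hv => ?_
      obtain ⟨σ, hσ⟩ : ∃ σ : Equiv.Perm (Fin 3), ⇑σ = v :=
        ⟨Equiv.ofBijective v (Finite.injective_iff_bijective.mp hv), rfl⟩
      have h3 : (fun i => b (v i)) = (![b 0, b 1, b 2]) ∘ σ := by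
        funext i
        rw [Function.comp_apply, ← hσ]
        generalize σ i = m
        fin_cases m <;> rfl
      rw [h3]
      change Ω.toAlternatingMap _ = 0
      rw [AlternatingMap.map_perm]
      change _ • Ω ![b 0, b 1, b 2] = 0
      rw [h, smul_zero]
    ext v
    exact congrArg (fun α => α v) h2
  set c := Ω ![b 0, b 1, b 2] with hc
  have s1 : ∀ x y z : E, Ω ![y, x, z] = -Ω ![x, y, z] := by
    intro x y z
    have h := Ω.map_swap ![x, y, z] (show (0 : Fin 3) ≠ 1 by decide)
    refine Eq.trans ?_ h
    rw [ContinuousAlternatingMap.coe_toAlternatingMap]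
    congr 1
    funext i
    fin_cases i <;> rfl
  have s2 : ∀ x y z : E, Ω ![x, z, y] = -Ω ![x, y, z] := by
    intro x y z
    have h := Ω.map_swap ![x, y, z] (show (1 : Fin 3) ≠ 2 by decide)
    refine Eq.trans ?_ h
    rw [ContinuousAlternatingMap.coe_toAlternatingMap]
    congr 1
    funext i
    fin_cases i <;> rfl
  have s3 : ∀ x z : E, Ω ![x, z, z] = 0 := fun x z => self_eq_neg.mp (s2 x z z)
  have s4 : ∀ x z : E, Ω ![x, x, z] = 0 := fun x z => self_eq_neg.mp (s1 x x z)
  have s5 : ∀ x z : E, Ω ![x, z, x] = 0 := fun x z => by rw [s2, s4, neg_zero]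
  let v : E := (H 1 2 / c) • b 0 + (H 2 0 / c) • b 1 + (H 0 1 / c) • b 2
  have hv : ∀ x y, Ω ![v, x, y] = H 1 2 / c * Ω ![b 0, x, y] + H 2 0 / c * Ω ![b 1, x, y] +
      H 0 1 / c * Ω ![b 2, x, y] := by
    intro x y
    have ladd : ∀ p q : E, Ω ![p + q, x, y] = Ω ![p, x, y] + Ω ![q, x, y] := fun p q =>
      congrArg (fun α => α ![x, y]) (Ω.curryLeft.map_add p q)
    rw [ladd, ladd, map_vecCons_smul, map_vecCons_smul, map_vecCons_smul]
  have T1 : Ω ![v, b 0, b 1] = H 0 1 := by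
    rw [hv, s4, s5, s1 (b 0) (b 2), s2 (b 0) (b 1), ← hc]
    field_simp
    ring
  have T2 : Ω ![v, b 1, b 2] = H 1 2 := by
    rw [hv, s4, s5, ← hc]
    field_simp
    ring
  have T3 : Ω ![v, b 2, b 0] = H 2 0 := by
    rw [hv, s4, s5, s2 (b 1) (b 0), s1 (b 0) (b 1), ← hc]
    field_simp
    ring
  have hself : ∀ i, H i i = 0 := fun i => self_eq_neg.mp (hH i i)
  have hT : ∀ i j, Ω ![v, b i, b j] = H i j := by
    intro i j
    fin_cases i <;> fin_cases j
    · exact (s3 _ _).trans (hself 0).symm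
    · exact T1
    · exact (s2 _ _ _).trans ((congrArg Neg.neg T3).trans (hH 2 0).symm)
    · exact (s2 _ _ _).trans ((congrArg Neg.neg T1).trans (hH 0 1).symm)
    · exact (s3 _ _).trans (hself 1).symm
    · exact T2
    · exact T3
    · exact (s2 _ _ _).trans ((congrArg Neg.neg T2).trans (hH 1 2).symm)
    · exact (s3 _ _).trans (hself 2).symm
  refine ⟨v, ?_⟩
  rw [← sub_eq_zero]
  -- Like η, the difference β is anti-invariant, so i can be moved between its arguments. It
  -- therefore suffices that β vanish on the complex basis, with or without i in the first slot.
  set β := η - (holRe Ω 3).curryLeft v with hβ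
  have hrv : rot ((holRe Ω 3).curryLeft v) = -(holRe Ω 3).curryLeft v := by
    have h1 := curryLeft_rot (holRe Ω 3) (Complex.I • v)
    rw [rot_holRe, holIm_curryLeft_I, smul_smul, Complex.I_mul_I, neg_one_smul, map_neg,
      rot_neg] at h1
    exact neg_eq_iff_eq_neg.mp h1.symm
  have hβr : rot β = -β := by
    rw [hβ, rot_sub, hη, hrv]
    abel
  have happ : ∀ x y, β ![x, y] = η ![x, y] - (Ω ![v, x, y]).re := by
    intro x y
    rw [hβ, ContinuousAlternatingMap.sub_apply, ContinuousAlternatingMap.curryLeft_apply_apply,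
      holRe_three_apply]
  have b1 : ∀ i j, β ![b i, b j] = 0 := by
    intro i j
    rw [happ, hT]
    simp [H]
  have hΩI : ∀ x y, Ω ![v, Complex.I • x, y] = Complex.I * Ω ![v, x, y] := by
    intro x y
    rw [s1, map_vecCons_smul, s1 x v y]
    ring
  have b2 : ∀ i j, β ![Complex.I • b i, b j] = 0 := by
    intro i j
    rw [happ, hΩI, hT]
    simp [H]
  have hadd : ∀ x x' y, β ![x + x', y] = β ![x, y] + β ![x', y] := fun x x' y =>
    congrArg (fun δ => δ ![y]) (β.curryLeft.map_add x x')
  have hsm : ∀ (r : ℝ) x y, β ![r • x, y] = r * β ![x, y] := fun r x y =>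
    congrArg (fun δ => δ ![y]) (β.curryLeft.map_smul r x)
  have hcs : ∀ (z : ℂ) (x y : E), β ![z • x, y] = z.re * β ![x, y] +
      z.im * β ![Complex.I • x, y] := by
    intro z x y
    have e : z • x = z.re • x + z.im • Complex.I • x := by
      conv_lhs => rw [← Complex.re_add_im z]
      rw [add_smul, mul_smul]
      rfl
    rw [e, hadd, hsm, hsm]
  have hIcs : ∀ x y, β ![Complex.I • Complex.I • x, y] = -β ![x, y] := by
    intro x y
    have e : Complex.I • Complex.I • x = (-1 : ℝ) • x := by
      rw [smul_smul, Complex.I_mul_I, neg_one_smul, neg_one_smul]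
    rw [e, hsm]
    ring
  have c1 : ∀ x j, β ![x, b j] = 0 ∧ β ![Complex.I • x, b j] = 0 := by
    intro x j
    induction (b.mem_span x) using Submodule.span_induction with
    | mem x hx =>
      obtain ⟨i, rfl⟩ := hx
      exact ⟨b1 i j, b2 i j⟩
    | zero =>
      have := hsm 0 0 (b j)
      rw [zero_smul, zero_mul] at this
      rw [smul_zero]
      exact ⟨this, this⟩
    | add x y _ _ hx hy =>
      rw [smul_add, hadd, hadd, hx.1, hx.2, hy.1, hy.2]
      simp
    | smul z x _ hx =>
      rw [smul_comm, hcs z x, hcs z (Complex.I • x), hIcs, hx.1, hx.2]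
      simp
  have c2 : ∀ y x, β ![x, y] = 0 := by
    have c3 : ∀ y x, β ![y, x] = 0 ∧ β ![Complex.I • y, x] = 0 := by
      intro y x
      induction (b.mem_span y) using Submodule.span_induction with
      | mem y hy =>
        obtain ⟨j, rfl⟩ := hy
        rw [← hmix β hβr, hswap β x, hswap β (Complex.I • x), (c1 x j).1, (c1 x j).2, neg_zero]
        exact ⟨rfl, rfl⟩
      | zero =>
        have := hsm 0 0 x
        rw [zero_smul, zero_mul] at this
        rw [smul_zero]
        exact ⟨this, this⟩
      | add y y' _ _ hx hy =>
        rw [smul_add, hadd, hadd, hx.1, hx.2, hy.1, hy.2]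
        simp
      | smul z y _ hx =>
        rw [smul_comm, hcs z y, hcs z (Complex.I • y), hIcs, hx.1, hx.2]
        simp
    exact fun y x => (c3 x y).1
  ext u
  have hu : u = ![u 0, u 1] := by
    funext i
    fin_cases i <;> rfl
  rw [hu]
  exact c2 _ _

theorem clifford_holIm_mem_holSpan (w₁ w₂ : E × (E →L[ℝ] ℝ)) :
    clifford w₁ (clifford w₂ (holIm Ω)) ∈ holSpan Ω := by
  rw [← neg_neg (clifford w₂ (holIm Ω)), ← (isPurePair_hol Ω).left, clifford_neg]
  exact neg_mem (clifford_mem_holSpan _ _)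

/-- Two real conditions in dimension 6 leave a vector u ≠ 0 with γ(u) = γ(iu) = 0. If y(u) = 1 and
y(iu) = 0, then γ is the contraction with u of y ∧ γ - (y ∘ i) ∧ rot γ. That 2-form is
anti-invariant, hence some ι(v)ρ, and so γ = ι(u)ι(v)ρ. -/
theorem single_one_mem_holSpan (hΩ : Ω ≠ 0) (γ : E [⋀^Fin 1]→L[ℝ] ℝ) :
    Pi.single 1 γ ∈ holSpan Ω := by
  obtain ⟨u, hu0, hu1, hu2⟩ : ∃ u : E, u ≠ 0 ∧ γ.curryLeft u = 0 ∧
      γ.curryLeft (Complex.I • u) = 0 := by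
    let L : E →ₗ[ℝ] ℝ × ℝ :=
      { toFun := fun u => (γ ![u], γ ![Complex.I • u])
        map_add' := fun u v => by
          rw [smul_add]
          exact Prod.ext (congrArg (fun δ => δ ![]) (γ.curryLeft.map_add u v))
            (congrArg (fun δ => δ ![]) (γ.curryLeft.map_add (Complex.I • u) (Complex.I • v)))
        map_smul' := fun c u => by
          rw [smul_comm]
          exact Prod.ext (congrArg (fun δ => δ ![]) (γ.curryLeft.map_smul c u))
            (congrArg (fun δ => δ ![]) (γ.curryLeft.map_smul c (Complex.I • u))) }
    have hL : LinearMap.ker L ≠ ⊥ := LinearMap.ker_ne_bot_of_finrank_lt (by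
      rw [(fact_finrank_real (E := E)).out]
      simp)
    obtain ⟨u, hu, hu0⟩ := Submodule.exists_mem_ne_zero_of_ne_bot hL
    have h1 := congrArg Prod.fst (LinearMap.mem_ker.mp hu)
    have h2 := congrArg Prod.snd (LinearMap.mem_ker.mp hu)
    have hz : ∀ v, γ ![v] = 0 → γ.curryLeft v = 0 := by
      intro v hv
      ext w
      rw [Subsingleton.elim w ![]]
      exact hv
    exact ⟨u, hu0, hz u h1, hz _ h2⟩
  obtain ⟨f, hf⟩ := SeparatingDual.exists_eq_one (R := ℂ) hu0
  let y : E →L[ℝ] ℝ := Complex.reCLM ∘L f.restrictScalars ℝ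
  have hy : y u = 1 := by
    change (f u).re = 1
    rw [hf, Complex.one_re]
  have hy' : (y ∘L mulI E) u = 0 := by
    change (f (Complex.I • u)).re = 0
    rw [map_smul, hf]
    simp
  have hrr : rot (rot γ) = -γ := by
    rw [rot_rot, pow_one]
    module
  obtain ⟨v, hv⟩ := exists_curryLeft_eq_of_rot_eq_neg hΩ (rot_cwedge_sub y γ hrr)
  have h1 : ((cwedge y γ - cwedge (y ∘L mulI E) (rot γ)).curryLeft u) = γ := by
    have h2 : (rot γ).curryLeft u = 0 := by
      rw [curryLeft_rot, hu2]
      rfl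
    have h3 : (cwedge y γ - cwedge (y ∘L mulI E) (rot γ)).curryLeft u =
      (cwedge y γ).curryLeft u - (cwedge (y ∘L mulI E) (rot γ)).curryLeft u := rfl
    rw [h3, curryLeft_cwedge, curryLeft_cwedge, hy, hy', hu1, h2, cwedge_zero, cwedge_zero]
    module
  rw [← h1, hv, ← clifford_vector_single, ← clifford_vector_single, ← holRe_eq_single]
  exact clifford_mem_holSpan _ _

/-- Products of a covector with an anti-invariant 2-form lie in the span. Hence, modulo the span, x
∧ y ∧ z does not change when two of its factors are composed with i (`R1`). Doing this once for each
of the three pairs composes every factor with i twice, so the product is congruent to its negative.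
-/
theorem single_three_mem_holSpan (hΩ : Ω ≠ 0) (γ : E [⋀^Fin 3]→L[ℝ] ℝ) :
    Pi.single 3 γ ∈ holSpan Ω := by
  let S : Submodule ℝ (E [⋀^Fin 3]→L[ℝ] ℝ) := (holSpan Ω).comap
    (LinearMap.single ℝ (fun k => E [⋀^Fin k]→L[ℝ] ℝ) 3)
  change γ ∈ S
  have hneg : ∀ (x : E →L[ℝ] ℝ) (η : E [⋀^Fin 2]→L[ℝ] ℝ), rot η = -η → cwedge x η ∈ S := by
    intro x η hη
    obtain ⟨v, rfl⟩ := exists_curryLeft_eq_of_rot_eq_neg hΩ hη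
    change Pi.single 3 _ ∈ holSpan Ω
    rw [← clifford_covector_single, ← clifford_vector_single, ← holRe_eq_single]
    exact clifford_mem_holSpan _ _
  have R1 : ∀ (x y : E →L[ℝ] ℝ) (δ : E [⋀^Fin 1]→L[ℝ] ℝ),
      cwedge x (cwedge y δ) - cwedge x (cwedge (y ∘L mulI E) (rot δ)) ∈ S := by
    intro x y δ
    have hrr : rot (rot δ) = -δ := by
      rw [rot_rot, pow_one]
      module
    have h := hneg x _ (rot_cwedge_sub y δ hrr)
    rwa [cwedge_sub] at h
  have hI : ∀ x : E →L[ℝ] ℝ, (x ∘L mulI E) ∘L mulI E = -x := by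
    intro x
    ext v
    simp [smul_smul]
  have key : ∀ (x y z : E →L[ℝ] ℝ) (c : E [⋀^Fin 0]→L[ℝ] ℝ),
      cwedge x (cwedge y (cwedge z c)) ∈ S := by
    intro x y z c
    have hr : ∀ z : E →L[ℝ] ℝ, rot (cwedge z c) = cwedge (z ∘L mulI E) c := fun z => by
      rw [rot_cwedge, rot_of_degree_zero]
    have a1 := R1 x y (cwedge z c)
    have a2 := R1 (y ∘L mulI E) x (rot (cwedge z c))
    have a3 := R1 z (x ∘L mulI E) (cwedge (y ∘L mulI E) c)
    rw [hr] at a1 a2 a3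
    rw [hr, hI, neg_cwedge, cwedge_neg, cwedge_neg] at a2
    rw [hI, hI, neg_cwedge, neg_cwedge, cwedge_neg, cwedge_neg, cwedge_neg] at a3
    have p1 : ∀ p q r : E →L[ℝ] ℝ, cwedge p (cwedge q (cwedge r c)) =
        -cwedge q (cwedge p (cwedge r c)) := fun p q r => cwedge_anticomm p q _
    have p2 : ∀ p q r : E →L[ℝ] ℝ, cwedge p (cwedge q (cwedge r c)) =
        -cwedge p (cwedge r (cwedge q c)) := fun p q r => by
      rw [cwedge_anticomm q r, cwedge_neg]
    rw [p1 (y ∘L mulI E) x (z ∘L mulI E), p1 (y ∘L mulI E) (x ∘L mulI E) z] at a2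
    rw [p1 z (x ∘L mulI E), p2 (x ∘L mulI E) z, p1 z x y, p2 x z y] at a3
    have a4 := S.smul_mem (1 / 2 : ℝ) (S.sub_mem (S.sub_mem a1 a2) a3)
    convert a4 using 1
    module
  induction γ using form_induction with
  | h0 => exact S.zero_mem
  | hadd α β hα hβ => exact S.add_mem hα hβ
  | hw x α =>
    induction α using form_induction with
    | h0 =>
      rw [cwedge_zero]
      exact S.zero_mem
    | hadd α β hα hβ =>
      rw [cwedge_add]
      exact S.add_mem hα hβ
    | hw y δ =>
      induction δ using form_induction with
      | h0 =>
        rw [cwedge_zero, cwedge_zero]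
        exact S.zero_mem
      | hadd α β hα hβ =>
        rw [cwedge_add, cwedge_add]
        exact S.add_mem hα hβ
      | hw z c => exact key x y z c

/-- The span contains β ∧ ρ and β ∧ ρ' for all 2-forms β, hence by the Leibniz rule every
contraction of the volume form ρ' ∧ ρ. A 5-form X equals ∑ ι(e_a)(eᵃ ∧ X), a sum of contractions of
multiples of that volume form. -/
theorem single_five_mem_holSpan (hΩ : Ω ≠ 0) (X : E [⋀^Fin 5]→L[ℝ] ℝ) :
    Pi.single 5 X ∈ holSpan Ω := by
  let S : Submodule ℝ (E [⋀^Fin 5]→L[ℝ] ℝ) := (holSpan Ω).comap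
    (LinearMap.single ℝ (fun k => E [⋀^Fin k]→L[ℝ] ℝ) 5)
  change X ∈ S
  have hw : ∀ α : E [⋀^Fin 3]→L[ℝ] ℝ, (∀ ξ η, cwedge ξ (cwedge η α) ∈ S) →
      ∀ β : E [⋀^Fin 2]→L[ℝ] ℝ, wedge β α ∈ S := by
    intro α hα β
    induction β using form_induction with
    | h0 =>
      rw [zero_wedge]
      exact S.zero_mem
    | hadd β β' h h' =>
      rw [wedge_add_left]
      exact S.add_mem h h'
    | hw ξ γ =>
      have h1 : wedge (cwedge ξ γ) α = cwedge ξ (wedge γ α) := cwedge_wedge ξ γ α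
      rw [h1]
      induction γ using form_induction with
      | h0 =>
        rw [zero_wedge, cwedge_zero]
        exact S.zero_mem
      | hadd β β' h h' =>
        rw [wedge_add_left, cwedge_add]
        exact S.add_mem (h (cwedge_wedge ξ β α)) (h' (cwedge_wedge ξ β' α))
      | hw η c =>
        have h2 : wedge (cwedge η c) α = cwedge η (wedge c α) := cwedge_wedge η c α
        have h3 : wedge c α = c 0 • α := wedge_of_degree_zero c α
        rw [h2, h3, cwedge_smul, cwedge_smul]
        exact S.smul_mem _ (hα ξ η)
  have ha : ∀ β : E [⋀^Fin 2]→L[ℝ] ℝ, wedge β (holRe Ω 3) ∈ S := hw _ fun ξ η => by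
    change Pi.single 5 _ ∈ holSpan Ω
    rw [← clifford_covector_single, ← clifford_covector_single, ← holRe_eq_single]
    exact clifford_mem_holSpan _ _
  have hb : ∀ β : E [⋀^Fin 2]→L[ℝ] ℝ, wedge β (holIm Ω 3) ∈ S := hw _ fun ξ η => by
    change Pi.single 5 _ ∈ holSpan Ω
    rw [← clifford_covector_single, ← clifford_covector_single, ← holIm_eq_single]
    exact clifford_holIm_mem_holSpan _ _
  obtain ⟨ν, hνdef⟩ : ∃ ν : E [⋀^Fin 6]→L[ℝ] ℝ, ν =
      castDeg (by norm_num) (wedge (holIm Ω 3) (holRe Ω 3)) := ⟨_, rfl⟩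
  have hν : ν ≠ 0 := by
    rw [hνdef]
    exact wedge_holIm_holRe_ne_zero hΩ
  have hνy : ∀ y, ν.curryLeft y ∈ S := by
    intro y
    have h1 := curryLeft_castDeg_wedge (n := 5) (by norm_num) (holIm Ω 3) (holRe Ω 3) y
    have h2 := wedge_comm (holIm Ω 3) ((holRe Ω 3).curryLeft y)
    rw [castDeg_rfl] at h2
    rw [hνdef, h1, h2, castDeg_rfl, castDeg_smul, castDeg_rfl]
    exact S.add_mem (ha _) (S.smul_mem _ (S.smul_mem _ (hb _)))
  rw [← sum_curryLeft_cwedge_five X]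
  refine S.sum_mem fun a _ => ?_
  obtain ⟨t, ht⟩ := exists_smul_eq_of_ne_zero hν
    (cwedge (LinearMap.toContinuousLinearMap ((sixBasis E).coord a)) X)
  rw [ht]
  exact S.smul_mem t (hνy _)

end Holomorphic
end GenCY
end

/-! ### `J` on odd forms of a complex 3-space; 4-forms of the shape ξ ∧ ρ. -/

noncomputable section

namespace GenCY

attribute [local irreducible] pairing clifford

/-- By `pairing_clifford_clifford` the numbers ⟨wρ, w'ρ⟩ determine `wittForm` on w, which is
nondegenerate. This uniqueness is what later makes pointwise choices smooth. -/
theorem IsPurePair.eq_zero_of_clifford_eq_zero {V : Type*} [NormedAddCommGroup V] [NormedSpace ℝ V]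
    [FiniteDimensional ℝ V] [Fact (Module.finrank ℝ V = 6)] {ε : V [⋀^Fin 6]→L[ℝ] ℝ}
    {ρ ρ' : Spinor V ℝ} {j : (V × (V →L[ℝ] ℝ)) →ₗ[ℝ] (V × (V →L[ℝ] ℝ))}
    (hj : IsPurePair ρ ρ' j) (hρ : pairing ε ρ' ρ = 1 / 2) {w : V × (V →L[ℝ] ℝ)}
    (h : clifford w ρ = 0) : w = 0 := by
  have h1 : ∀ w', wittForm w w' = 0 := by
    intro w'
    have h2 := hj.pairing_clifford_clifford (ε := ε) w (-j w')
    rw [h, map_neg, hj.sq, neg_neg, pairing_skew ε ρ ρ', hρ, ← pairingₗ_apply, map_zero,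
      LinearMap.zero_apply] at h2
    linarith
  rw [← sum_wittForm_swap_basis w]
  exact Finset.sum_eq_zero fun i _ => by rw [wittForm_comm, h1, zero_smul]

section HolomorphicStructure

variable {E : Type*} [NormedAddCommGroup E] [NormedSpace ℂ E]
variable [FiniteDimensional ℂ E] [hE : Fact (Module.finrank ℂ E = 3)]
variable {Ω : E [⋀^Fin 3]→L[ℂ] ℂ}

theorem mem_holSpan (hΩ : Ω ≠ 0) {σ : Spinor E ℝ} (hσ : ∀ k, k % 2 = 0 → σ k = 0) :
    σ ∈ holSpan Ω := by
  have h : σ = Pi.single 1 (σ 1) + Pi.single 3 (σ 3) + Pi.single 5 (σ 5) := by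
    funext k
    rw [Pi.add_apply, Pi.add_apply]
    have hz : ∀ m, k ≠ m → (Pi.single (M := fun j => E [⋀^Fin j]→L[ℝ] ℝ) m (σ m)) k = 0 :=
      fun m hm => Pi.single_eq_of_ne hm _
    by_cases h1 : k = 1
    · subst h1
      rw [hz 3 (by norm_num), hz 5 (by norm_num), Pi.single_eq_same, add_zero, add_zero]
    by_cases h3 : k = 3
    · subst h3
      rw [hz 1 (by norm_num), hz 5 (by norm_num), Pi.single_eq_same, zero_add, add_zero]
    by_cases h5 : k = 5
    · subst h5
      rw [hz 1 (by norm_num), hz 3 (by norm_num), Pi.single_eq_same, zero_add, zero_add]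
    rw [hz 1 h1, hz 3 h3, hz 5 h5, add_zero, add_zero]
    by_cases h2 : k % 2 = 0
    · exact hσ k h2
    · exact form_eq_zero (by omega) _
  rw [h]
  exact add_mem (add_mem (single_one_mem_holSpan hΩ _) (single_three_mem_holSpan hΩ _))
    (single_five_mem_holSpan hΩ _)

theorem volOf_holSpinor_ne_zero (hΩ : Ω ≠ 0) : volOf (holSpinor Ω) (sixBasis E) ≠ 0 :=
  volOf_basis_ne_zero (mukai_hol_ne_zero hΩ)

theorem pairing_holSpinor (hΩ : Ω ≠ 0) :
    pairing (volOf (holSpinor Ω)) (holIm Ω) (holRe Ω) = 1 / 2 :=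
  pairing_volOf (mukai_hol_ne_zero hΩ)

/-- The complex structure on odd forms defined by a holomorphic volume form. -/
theorem cplxStr_holSpinor (hΩ : Ω ≠ 0) {σ : Spinor E ℝ} (hσ : ∀ k, k % 2 = 0 → σ k = 0) (k : ℕ) :
    cplxStr (volOf (holSpinor Ω)) (holRe Ω) σ k =
      (-(1 / 2) : ℝ) • (rotDeriv (σ k) + rot (σ k)) := by
  have hj := isPurePair_hol Ω
  have hρ := pairing_holSpinor hΩ
  have hε := volOf_holSpinor_ne_zero hΩ
  suffices h : cplxStr (volOf (holSpinor Ω)) (holRe Ω) σ =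
      (-(1 / 2) : ℝ) • ((fun k => rotDeriv (σ k)) + fun k => rot (σ k)) from congrFun h k
  have hmem := mem_holSpan hΩ hσ
  clear hσ
  rw [holSpan] at hmem
  induction hmem using Submodule.span_induction with
  | mem x hx =>
    obtain ⟨⟨w₁, w₂⟩, rfl⟩ := hx
    beta_reduce
    -- The derivation produces the extra term -(jw₁)w₂ρ, which the rotation (jw₁)(jw₂)ρ' = (jw₁)w₂ρ
    -- cancels; -2w₁w₂ρ' remains.
    rw [hj.cplxStr_clifford_clifford hρ hε, clifford_rotDeriv, clifford_rot]
    have h1 := clifford_rotDeriv w₂ (holRe Ω)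
    have h2 := clifford_rot w₂ (holRe Ω)
    have h3 : (fun k => rot (holRe Ω k)) = holIm Ω := funext fun k => rot_holRe Ω k
    rw [h1, h2, rotDeriv_holRe, h3, hj.right, hj.left, clifford_sub, clifford_smul, clifford_smul,
      clifford_neg, clifford_neg]
    module
  | zero =>
    have h := hj.cplxStr_smul hρ hε 0 0
    rw [zero_smul, zero_smul] at h
    rw [h]
    funext k
    have h0 : rotDeriv (0 : E [⋀^Fin k]→L[ℝ] ℝ) = 0 := by
      have := rotDeriv_smul 0 (0 : E [⋀^Fin k]→L[ℝ] ℝ)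
      rwa [form_smul_zero, zero_smul] at this
    have h1 : rot (0 : E [⋀^Fin k]→L[ℝ] ℝ) = 0 := rfl
    simp [h0, h1]
  | add x y _ _ hx hy =>
    rw [hj.cplxStr_add hρ hε, hx, hy]
    funext k
    simp only [Pi.add_apply, Pi.smul_apply, rotDeriv_add, rot_add]
    module
  | smul c x _ hx =>
    rw [hj.cplxStr_smul hρ hε, hx]
    funext k
    simp only [Pi.add_apply, Pi.smul_apply, rotDeriv_smul, rot_smul]
    module

/-- Rotation sends the volume form ρ' ∧ ρ to -ρ ∧ ρ', which is ρ' ∧ ρ again. -/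
theorem rot_six (hΩ : Ω ≠ 0) (μ : E [⋀^Fin 6]→L[ℝ] ℝ) : rot μ = μ := by
  obtain ⟨t, rfl⟩ := exists_smul_eq_of_ne_zero (wedge_holIm_holRe_ne_zero hΩ) μ
  have h1 : rot (holIm Ω 3) = -holRe Ω 3 := by
    rw [← rot_holRe, rot_rot]
    norm_num
  have h2 : rot (wedge (holIm Ω 3) (holRe Ω 3)) = wedge (holIm Ω 3) (holRe Ω 3) := by
    have h3 : rot (wedge (holIm Ω 3) (holRe Ω 3)) =
        wedge (rot (holIm Ω 3)) (rot (holRe Ω 3)) := wedge_compContinuousLinearMap _ _ _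
    have h4 := wedge_comm (holRe Ω 3) (holIm Ω 3)
    rw [castDeg_rfl] at h4
    rw [h3, h1, rot_holRe, wedge_neg_left, h4]
    norm_num
  rw [castDeg_rfl, rot_smul, h2]

theorem pairing_single_four (ε : E [⋀^Fin 6]→L[ℝ] ℝ) (ζ : E [⋀^Fin 4]→L[ℝ] ℝ) (χ : Spinor E ℝ) :
    pairing ε (Pi.single 4 ζ) χ =
      castDeg (l := 6) (by norm_num) (wedge ζ (χ 2)) (sixBasis E) / ε (sixBasis E) := by
  have hz : ∀ m, m ≠ 4 → (Pi.single (M := fun j => E [⋀^Fin j]→L[ℝ] ℝ) 4 ζ) m = 0 :=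
    fun m hm => Pi.single_eq_of_ne hm _
  have h : mukai (Pi.single 4 ζ) χ = castDeg (l := 6) (by norm_num) (wedge ζ (χ 2)) := by
    rw [mukai_eq, hz 0 (by norm_num), hz 1 (by norm_num), hz 2 (by norm_num),
      hz 3 (by norm_num), hz 5 (by norm_num), hz 6 (by norm_num), Pi.single_eq_same]
    simp only [zero_wedge, castDeg_rfl]
    abel
  rw [pairing, h]

/-- By duality. An anti-invariant 4-form has product zero with every invariant 2-form, since 6-forms
are invariant. The anti-invariant 2-forms are the ι(v)ρ, and ξ is fitted so that η - ξ ∧ ρ has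
product zero with these too. -/
theorem exists_cwedge_eq_of_rot_eq_neg (hΩ : Ω ≠ 0) {η : E [⋀^Fin 4]→L[ℝ] ℝ}
    (hη : rot η = -η) : ∃ ξ, η = cwedge ξ (holRe Ω 3) := by
  have hε := volOf_holSpinor_ne_zero hΩ
  set ε := volOf (holSpinor Ω) with hεdef
  have hρ : pairing ε (holIm Ω) (holRe Ω) = 1 / 2 := pairing_holSpinor hΩ
  let g : E →ₗ[ℝ] ℝ :=
    { toFun := fun v => pairing ε (clifford (v, 0) (holRe Ω)) (Pi.single 4 η)
      map_add' := fun u v => by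
        rw [← pairing_add_left, ← clifford_add_left, Prod.mk_add_mk, add_zero]
      map_smul' := fun c v => by
        rw [RingHom.id_apply, smul_eq_mul, ← pairing_smul_left, ← clifford_smul_left, Prod.smul_mk,
          smul_zero] }
  -- The constant inverts ⟨ξρ, vρ⟩ = ½ ξ(iv)⟨ρ, ρ'⟩ = -¼ ξ(iv).
  let ξ : E →L[ℝ] ℝ := (-4 : ℝ) • (LinearMap.toContinuousLinearMap g ∘L mulI E)
  have hξ : ∀ v, ξ (Complex.I • v) = 4 * g v := by
    intro v
    have h : ξ (Complex.I • v) = -4 * g (Complex.I • Complex.I • v) := rfl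
    rw [h, smul_smul, Complex.I_mul_I, neg_one_smul, map_neg]
    ring
  refine ⟨ξ, ?_⟩
  rw [← sub_eq_zero]
  set ζ := η - cwedge ξ (holRe Ω 3) with hζ
  have hrζ : rot ζ = -ζ := by
    rw [hζ, rot_sub, hη, rot_cwedge, rot_holRe, cwedge_holIm]
    abel
  have hv : ∀ v, castDeg (l := 6) (by norm_num) (wedge ζ ((holRe Ω 3).curryLeft v)) = 0 := by
    intro v
    refine form_six_eq_zero ?_
    have h1 := pairing_single_four ε ζ (Pi.single 2 ((holRe Ω 3).curryLeft v))
    rw [Pi.single_eq_same] at h1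
    have h2 : pairing ε (Pi.single 4 ζ) (Pi.single 2 ((holRe Ω 3).curryLeft v)) = 0 := by
      have h3 : (Pi.single 4 ζ : Spinor E ℝ) = Pi.single 4 η - clifford (0, ξ) (holRe Ω) := by
        rw [hζ, Pi.single_sub, holRe_eq_single, clifford_covector_single, Pi.single_eq_same]
      rw [← clifford_vector_single, ← holRe_eq_single, h3, pairing_sub_left,
        (isPurePair_hol Ω).pairing_clifford_clifford, pairing_skew,
        pairing_skew ε (holRe Ω) (holIm Ω), hρ]
      have h4 : pairing ε (clifford (v, 0) (holRe Ω)) (Pi.single 4 η) = g v := rfl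
      have h5 : wittForm (0, ξ) (rotWitt E (v, 0)) = 4 * g v := by
        rw [← hξ]
        simp [wittForm_apply, rotWitt]
      rw [h4, h5]
      ring
    rw [h2] at h1
    have h6 := (div_eq_zero_iff.mp h1.symm).resolve_right hε
    exact h6
  have hall : ∀ χ : E [⋀^Fin 2]→L[ℝ] ℝ, castDeg (l := 6) (by norm_num) (wedge ζ χ) = 0 := by
    intro χ
    have hm : rot ((1 / 2 : ℝ) • (χ - rot χ)) = -((1 / 2 : ℝ) • (χ - rot χ)) := by
      rw [rot_smul, rot_sub, rot_rot]
      module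
    have hp : rot ((1 / 2 : ℝ) • (χ + rot χ)) = (1 / 2 : ℝ) • (χ + rot χ) := by
      rw [rot_smul, rot_add, rot_rot]
      module
    obtain ⟨v, hv'⟩ := exists_curryLeft_eq_of_rot_eq_neg hΩ hm
    have hsum : χ = (1 / 2 : ℝ) • (χ - rot χ) + (1 / 2 : ℝ) • (χ + rot χ) := by module
    have hp' : castDeg (l := 6) (by norm_num) (wedge ζ ((1 / 2 : ℝ) • (χ + rot χ))) = 0 := by
      generalize (1 / 2 : ℝ) • (χ + rot χ) = κ at hp
      have h3 : rot (wedge ζ κ) = wedge (rot ζ) (rot κ) := wedge_compContinuousLinearMap _ _ _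
      have h4 := rot_six hΩ (castDeg (l := 6) (by norm_num) (wedge ζ κ))
      rw [castDeg_rfl] at h4 ⊢
      rw [h3, hrζ, hp, wedge_neg_left] at h4
      generalize wedge ζ κ = W at h4
      ext u
      have h5 := congrArg (fun γ => γ u) h4
      exact self_eq_neg.mp h5.symm
    rw [hsum, wedge_add_right, castDeg_add, hp', hv', hv, add_zero]
  have h := eq_zero_of_pairing_eq_zero hε (X := Pi.single 4 ζ) fun χ => by
    rw [pairing_single_four, hall]
    exact zero_div _
  have h2 := congrFun h 4
  rwa [Pi.single_eq_same] at h2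

theorem eq_zero_of_curryLeft_holRe_eq_zero (hΩ : Ω ≠ 0) {v : E}
    (h : (holRe Ω 3).curryLeft v = 0) : v = 0 := by
  have h1 : clifford (v, 0) (holRe Ω) = 0 := by
    rw [holRe_eq_single, clifford_vector_single, h, Pi.single_zero]
  exact congrArg Prod.fst ((isPurePair_hol Ω).eq_zero_of_clifford_eq_zero (pairing_holSpinor hΩ) h1)

theorem eq_zero_of_cwedge_holRe_eq_zero (hΩ : Ω ≠ 0) {ξ : E →L[ℝ] ℝ}
    (h : cwedge ξ (holRe Ω 3) = 0) : ξ = 0 := by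
  have h1 : clifford (0, ξ) (holRe Ω) = 0 := by
    rw [holRe_eq_single, clifford_covector_single, h, Pi.single_zero]
  exact congrArg Prod.snd ((isPurePair_hol Ω).eq_zero_of_clifford_eq_zero (pairing_holSpinor hΩ) h1)

end HolomorphicStructure

end GenCY

end

/-! ### Components of the spinor exp(iω). -/

noncomputable section

namespace GenCY

attribute [local irreducible] pairing clifford

section ExpForm

variable {V : Type*} [NormedAddCommGroup V] [NormedSpace ℝ V]
variable {F : Type*} [NormedField F] [NormedAlgebra ℝ F]

variable (V F) in
/-- The form `1` of degree `0`. -/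
def oneForm : V [⋀^Fin 0]→L[ℝ] F := ContinuousAlternatingMap.constOfIsEmpty ℝ V (Fin 0) 1

theorem oneForm_apply (v : Fin 0 → V) : oneForm V F v = 1 := rfl

theorem oneForm_wedge {k : ℕ} (α : V [⋀^Fin k]→L[ℝ] F) :
    castDeg (Nat.zero_add k) (wedge (oneForm V F) α) = α := by
  rw [wedge_of_degree_zero, oneForm_apply, one_smul]

theorem expForm_even (B : V [⋀^Fin 2]→L[ℝ] F) (m : ℕ) :
    expForm B (2 * m) = ((Nat.factorial m : ℝ)⁻¹) • wedgePow B m := by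
  have h : ∀ n (hn : 2 * n = 2 * m), castDeg hn (((Nat.factorial n : ℝ)⁻¹) • wedgePow B n) =
      ((Nat.factorial m : ℝ)⁻¹) • wedgePow B m := by
    intro n hn
    obtain rfl : n = m := by omega
    rfl
  rw [expForm, dif_pos (by omega)]
  exact h _ _

theorem expForm_zero (B : V [⋀^Fin 2]→L[ℝ] F) : expForm B 0 = oneForm V F := by
  have h : expForm B 0 = ((Nat.factorial 0 : ℝ)⁻¹) • oneForm V F := rfl
  rw [h]
  norm_num

theorem expForm_two (B : V [⋀^Fin 2]→L[ℝ] F) : expForm B 2 = B := by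
  have h : expForm B 2 = ((Nat.factorial 1 : ℝ)⁻¹) •
    castDeg (Nat.zero_add 2) (wedge (oneForm V F) B) := rfl
  rw [h, oneForm_wedge]
  norm_num

theorem wedgePow_two (B : V [⋀^Fin 2]→L[ℝ] F) :
    wedgePow B 2 = castDeg (by norm_num) (wedge B B) := by
  have h : wedgePow B 2 = wedge (castDeg (Nat.zero_add 2) (wedge (oneForm V F) B)) B := rfl
  rw [h, oneForm_wedge]
  rfl

theorem expForm_four (B : V [⋀^Fin 2]→L[ℝ] F) :
    expForm B 4 = (1 / 2 : ℝ) • castDeg (by norm_num) (wedge B B) := by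
  have h : expForm B 4 = ((Nat.factorial 2 : ℝ)⁻¹) • castDeg (by norm_num) (wedgePow B 2) := rfl
  rw [h, wedgePow_two, castDeg_castDeg]
  norm_num

theorem expForm_six (B : V [⋀^Fin 2]→L[ℝ] F) : expForm B 6 =
    (1 / 6 : ℝ) • castDeg (by norm_num) (wedge (wedge B B) B) := by
  have h : expForm B 6 = castDeg (by norm_num) (expForm B (2 * 3)) := rfl
  have h2 : wedgePow B 3 = castDeg (by norm_num) (wedge (wedgePow B 2) B) := rfl
  rw [h, expForm_even, h2, wedgePow_two, wedge_castDeg_left, castDeg_castDeg, castDeg_smul,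
    castDeg_castDeg]
  norm_num [Nat.factorial]

theorem expForm_odd (B : V [⋀^Fin 2]→L[ℝ] F) {k : ℕ} (h : k % 2 = 1) : expForm B k = 0 := by
  rw [expForm, dif_neg (by omega)]

end ExpForm

section SymplecticSpinor

variable {V : Type*} [NormedAddCommGroup V] [NormedSpace ℝ V]

/-- The square of a `2`-form. -/
def formSq (w : V [⋀^Fin 2]→L[ℝ] ℝ) : V [⋀^Fin 4]→L[ℝ] ℝ := wedge w w

/-- The cube of a `2`-form. -/
def formCube (w : V [⋀^Fin 2]→L[ℝ] ℝ) : V [⋀^Fin 6]→L[ℝ] ℝ := wedge (formSq w) w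

/-- The real part of `exp (i w)`. -/
def symRe (w : V [⋀^Fin 2]→L[ℝ] ℝ) : Spinor V ℝ :=
  Pi.single 0 (oneForm V ℝ) + Pi.single 4 (-(1 / 2 : ℝ) • formSq w)

/-- The imaginary part of `exp (i w)`. -/
def symIm (w : V [⋀^Fin 2]→L[ℝ] ℝ) : Spinor V ℝ :=
  Pi.single 2 w + Pi.single 6 (-(1 / 6 : ℝ) • formCube w)

theorem wedge_I_smul {k l : ℕ} (a b : ℂ) (α : V [⋀^Fin k]→L[ℝ] ℝ) (β : V [⋀^Fin l]→L[ℝ] ℝ) :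
    wedge (a • ofRealForm α) (b • ofRealForm β) = (a * b) • ofRealForm (wedge α β) := by
  have h : ofRealForm (wedge α β) = wedge (ofRealForm α) (ofRealForm β) :=
    comp_wedge Complex.ofRealCLM (fun x y => Complex.ofReal_mul x y) α β
  rw [wedge_smul_left, wedge_smul_right, h, smul_smul]

theorem expForm_I_four (w : V [⋀^Fin 2]→L[ℝ] ℝ) :
    expForm (Complex.I • ofRealForm w) 4 = ofRealForm (-(1 / 2 : ℝ) • formSq w) := by
  rw [expForm_four, castDeg_rfl, wedge_I_smul, Complex.I_mul_I]
  ext v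
  simp [ofRealForm, formSq]

theorem expForm_I_six (w : V [⋀^Fin 2]→L[ℝ] ℝ) :
    expForm (Complex.I • ofRealForm w) 6 =
      Complex.I • ofRealForm (-(1 / 6 : ℝ) • formCube w) := by
  rw [expForm_six, castDeg_rfl, wedge_I_smul, wedge_I_smul, Complex.I_mul_I]
  ext v
  simp [ofRealForm, formSq, formCube]
  ring

theorem reForm_ofRealForm {k : ℕ} (α : V [⋀^Fin k]→L[ℝ] ℝ) : reForm (ofRealForm α) = α := rfl

theorem symRe_zero (w : V [⋀^Fin 2]→L[ℝ] ℝ) : symRe w 0 = oneForm V ℝ := by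
  simp [symRe]

theorem symRe_four (w : V [⋀^Fin 2]→L[ℝ] ℝ) : symRe w 4 = -(1 / 2 : ℝ) • formSq w := by
  simp [symRe]

theorem symRe_of_ne (w : V [⋀^Fin 2]→L[ℝ] ℝ) {k : ℕ} (h : k ≠ 0) (h' : k ≠ 4) : symRe w k = 0 := by
  simp [symRe, h, h']

theorem symIm_two (w : V [⋀^Fin 2]→L[ℝ] ℝ) : symIm w 2 = w := by
  simp [symIm]

theorem symIm_six (w : V [⋀^Fin 2]→L[ℝ] ℝ) : symIm w 6 = -(1 / 6 : ℝ) • formCube w := by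
  simp [symIm]

theorem symIm_of_ne (w : V [⋀^Fin 2]→L[ℝ] ℝ) {k : ℕ} (h : k ≠ 2) (h' : k ≠ 6) : symIm w k = 0 := by
  simp [symIm, h, h']

end SymplecticSpinor

end GenCY

end

/-! ### Linear algebra of a symplectic form in dimension 6. -/

noncomputable section

namespace GenCY

attribute [local irreducible] pairing clifford

section CovectorOfForm

variable {V : Type*} [NormedAddCommGroup V] [NormedSpace ℝ V]

/-- The covector underlying a `1`-form. -/
def toCovector (α : V [⋀^Fin 1]→L[ℝ] ℝ) : V →L[ℝ] ℝ :=
  (ContinuousAlternatingMap.ofSubsingleton ℝ V ℝ (0 : Fin 1)).symm α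

theorem toCovector_apply (α : V [⋀^Fin 1]→L[ℝ] ℝ) (v : V) : toCovector α v = α ![v] := by
  have h : toCovector α v = α (fun _ => v) := rfl
  rw [h]
  congr 1
  funext i
  rw [Subsingleton.elim i 0]
  rfl

theorem cwedge_toCovector (α : V [⋀^Fin 1]→L[ℝ] ℝ) : cwedge (toCovector α) (oneForm V ℝ) = α := by
  ext v
  rw [cwedge_apply, Fin.sum_univ_one, toCovector_apply, oneForm_apply]
  simp only [Fin.val_zero, pow_zero, one_smul, smul_eq_mul, mul_one]
  congr 1
  funext i
  rw [Subsingleton.elim i 0]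
  rfl

theorem toCovector_cwedge (ξ : V →L[ℝ] ℝ) : toCovector (cwedge ξ (oneForm V ℝ)) = ξ := by
  ext v
  rw [toCovector_apply, cwedge_apply, Fin.sum_univ_one, oneForm_apply]
  simp

theorem wedge_one_form {k : ℕ} (α : V [⋀^Fin 1]→L[ℝ] ℝ) (β : V [⋀^Fin k]→L[ℝ] ℝ) :
    castDeg (Nat.add_comm 1 k) (wedge α β) = cwedge (toCovector α) β := by
  conv_lhs => rw [← cwedge_toCovector α]
  have h := cwedge_wedge (toCovector α) (oneForm V ℝ) β
  have h2 := congrArg (cwedge (toCovector α)) (oneForm_wedge β)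
  rw [cwedge_castDeg, ← h, castDeg_castDeg] at h2
  exact h2

variable [FiniteDimensional ℝ V]

theorem wedge_one_form_right {k : ℕ} (α : V [⋀^Fin 1]→L[ℝ] ℝ) (β : V [⋀^Fin k]→L[ℝ] ℝ) :
    wedge β α = (-1 : ℝ) ^ k • cwedge (toCovector α) β := by
  conv_lhs => rw [← cwedge_toCovector α]
  rw [wedge_cwedge, wedge_comm_of_degree_zero, oneForm_apply, one_smul]

variable [hV : Fact (Module.finrank ℝ V = 6)]

/-- The complement of Euler's identity: ∑ ι(e_a)(eᵃ ∧ ·) counts 6 minus the degree. -/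
theorem sum_curryLeft_cwedge {k : ℕ} (X : V [⋀^Fin k]→L[ℝ] ℝ) :
    ∑ a, (cwedge (LinearMap.toContinuousLinearMap ((sixBasis V).coord a)) X).curryLeft
      (sixBasis V a) = (6 - k : ℝ) • X := by
  cases k with
  | zero =>
    simp only [curryLeft_cwedge_zero]
    simp only [LinearMap.coe_toContinuousLinearMap', Module.Basis.coord_apply,
      Module.Basis.repr_self, Finsupp.single_eq_same, one_smul]
    rw [Finset.sum_const, Finset.card_univ, Fintype.card_fin]
    module
  | succ k =>
    have h1 := sum_cwedge_curryLeft (sixBasis V) X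
    simp only [curryLeft_cwedge, Finset.sum_sub_distrib, h1]
    simp only [LinearMap.coe_toContinuousLinearMap', Module.Basis.coord_apply,
      Module.Basis.repr_self, Finsupp.single_eq_same, one_smul]
    rw [Finset.sum_const, Finset.card_univ, Fintype.card_fin]
    push_cast
    module

theorem eq_zero_of_cwedge_eq_zero {k : ℕ} (hk : k < 6) {X : V [⋀^Fin k]→L[ℝ] ℝ}
    (h : ∀ ξ, cwedge ξ X = 0) : X = 0 := by
  have h1 := sum_curryLeft_cwedge X
  simp only [h, form_zero_apply, Finset.sum_const_zero] at h1
  have hk' : (k : ℝ) < 6 := by exact_mod_cast hk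
  exact (smul_eq_zero.mp h1.symm).resolve_left (by linarith)

end CovectorOfForm

section SymplecticAlgebra

variable {V : Type*} [NormedAddCommGroup V] [NormedSpace ℝ V]
variable (w : V [⋀^Fin 2]→L[ℝ] ℝ)

/-- The map `v ↦ ι(v) w` from vectors to covectors. -/
def symFlat : V →ₗ[ℝ] (V →L[ℝ] ℝ) where
  toFun v := toCovector (w.curryLeft v)
  map_add' u v := by
    ext x
    simp [toCovector_apply]
  map_smul' c v := by
    ext x
    simp [toCovector_apply]

theorem symFlat_apply (v u : V) : symFlat w v u = w ![v, u] := by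
  have h : symFlat w v = toCovector (w.curryLeft v) := rfl
  rw [h, toCovector_apply]
  rfl

theorem cwedge_symFlat (v : V) : cwedge (symFlat w v) (oneForm V ℝ) = w.curryLeft v :=
  cwedge_toCovector _

theorem symFlat_skew (u v : V) : symFlat w u v = -symFlat w v u := by
  rw [symFlat_apply, symFlat_apply]
  have h := w.map_swap ![v, u] (show (0 : Fin 2) ≠ 1 by decide)
  refine Eq.trans ?_ h
  rw [ContinuousAlternatingMap.coe_toAlternatingMap]
  congr 1
  funext i
  fin_cases i <;> rfl

variable [FiniteDimensional ℝ V]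

theorem curryLeft_formSq (v : V) : (formSq w).curryLeft v = (2 : ℝ) • cwedge (symFlat w v) w := by
  have h1 : (formSq w).curryLeft v = castDeg (Nat.add_comm 1 2) (wedge (w.curryLeft v) w) +
      (-1 : ℝ) ^ (1 + 1) • wedge w (w.curryLeft v) := curryLeft_wedge w w v
  rw [h1, wedge_one_form, wedge_one_form_right]
  have h2 : toCovector (w.curryLeft v) = symFlat w v := rfl
  rw [h2]
  module

theorem curryLeft_formCube (v : V) :
    (formCube w).curryLeft v = (3 : ℝ) • cwedge (symFlat w v) (formSq w) := by
  have h0 : formCube w = castDeg (by norm_num) (wedge (k := 3 + 1) (l := 1 + 1) (formSq w) w) := rfl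
  have h1 := curryLeft_castDeg_wedge (k := 3) (l := 1) (n := 5) (by norm_num) (formSq w) w v
  have h3 : castDeg (by norm_num) (wedge (cwedge (symFlat w v) w) w) =
      cwedge (symFlat w v) (formSq w) := cwedge_wedge (symFlat w v) w w
  have h2 : toCovector (w.curryLeft v) = symFlat w v := rfl
  rw [h0, h1, wedge_one_form_right, curryLeft_formSq, wedge_smul_left, castDeg_smul, castDeg_smul,
    h2, h3, castDeg_rfl]
  module

theorem clifford_symRe (v : V) (ξ : V →L[ℝ] ℝ) : clifford (v, ξ) (symRe w) =
    Pi.single 1 (cwedge ξ (oneForm V ℝ)) + Pi.single 3 (-cwedge (symFlat w v) w) +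
      Pi.single 5 (-(1 / 2 : ℝ) • cwedge ξ (formSq w)) := by
  have h1 : ((v, ξ) : V × (V →L[ℝ] ℝ)) = (v, 0) + (0, ξ) := by simp
  have h2 : clifford (v, 0) (Pi.single 0 (oneForm V ℝ)) = 0 := by
    have h0 : ∀ {n : ℕ} (γ : V [⋀^Fin n]→L[ℝ] ℝ), cwedge (0 : V →L[ℝ] ℝ) γ = 0 := fun γ =>
      LinearMap.map_zero₂ (cwedgeₗ _) γ
    funext n
    cases n with
    | zero => rw [clifford_zero, Pi.single_eq_of_ne (by norm_num), form_zero_apply, Pi.zero_apply]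
    | succ n =>
      rw [clifford_succ, h0, add_zero, Pi.single_eq_of_ne (by omega), form_zero_apply,
        Pi.zero_apply]
  rw [h1, clifford_add_left, symRe, clifford_add, clifford_add, h2, clifford_covector_single,
    clifford_covector_single, clifford_vector_single, curryLeft_smul_apply, curryLeft_formSq,
    cwedge_smul]
  have h3 : (-(1 / 2 : ℝ)) • (2 : ℝ) • cwedge (symFlat w v) w = -cwedge (symFlat w v) w := by
    module
  rw [h3]
  abel

theorem clifford_symIm [hV : Fact (Module.finrank ℝ V = 6)] (v : V) (ξ : V →L[ℝ] ℝ) : clifford (v, ξ) (symIm w) =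
    Pi.single 1 (cwedge (symFlat w v) (oneForm V ℝ)) + Pi.single 3 (cwedge ξ w) +
      Pi.single 5 (-(1 / 2 : ℝ) • cwedge (symFlat w v) (formSq w)) := by
  have h1 : ((v, ξ) : V × (V →L[ℝ] ℝ)) = (v, 0) + (0, ξ) := by simp
  rw [h1, clifford_add_left, symIm, clifford_add, clifford_add, clifford_covector_single,
    clifford_covector_single, clifford_vector_single, clifford_vector_single, curryLeft_smul_apply,
    curryLeft_formCube, cwedge_smul, form_eq_zero (k := 6 + 1) (by norm_num) (cwedge ξ _),
    form_smul_zero, Pi.single_zero, cwedge_symFlat]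
  have h3 : (-(1 / 6 : ℝ)) • (3 : ℝ) • cwedge (symFlat w v) (formSq w) =
      -(1 / 2 : ℝ) • cwedge (symFlat w v) (formSq w) := by
    module
  rw [h3]
  abel

variable {w} (hw : ∀ u : V, (∀ v : V, w ![u, v] = 0) → u = 0)
include hw

theorem symFlat_bijective : Function.Bijective (symFlat w) := by
  have hinj : Function.Injective (symFlat w) := by
    rw [← LinearMap.ker_eq_bot, LinearMap.ker_eq_bot']
    intro u hu
    refine hw u fun v => ?_
    rw [← symFlat_apply, hu]
    rfl
  refine ⟨hinj, (LinearMap.injective_iff_surjective_of_finrank_eq_finrank ?_).mp hinj⟩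
  rw [← LinearEquiv.finrank_eq (LinearMap.toContinuousLinearMap (𝕜 := ℝ) (E := V) (F' := ℝ)),
    Subspace.dual_finrank_eq]

/-- The inverse of `symFlat`. -/
def symSharp : (V →L[ℝ] ℝ) →ₗ[ℝ] V :=
  (LinearEquiv.ofBijective (symFlat w) (symFlat_bijective hw)).symm

theorem symFlat_symSharp (ξ : V →L[ℝ] ℝ) : symFlat w (symSharp hw ξ) = ξ :=
  (LinearEquiv.ofBijective (symFlat w) (symFlat_bijective hw)).apply_symm_apply ξ

theorem symSharp_symFlat (v : V) : symSharp hw (symFlat w v) = v :=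
  (LinearEquiv.ofBijective (symFlat w) (symFlat_bijective hw)).symm_apply_apply v

/-- The complex structure on `V ⊕ V*` defined by a symplectic form. -/
def symWitt : (V × (V →L[ℝ] ℝ)) →ₗ[ℝ] (V × (V →L[ℝ] ℝ)) :=
  ((symSharp hw).comp (LinearMap.snd ℝ _ _)).prod (-(symFlat w).comp (LinearMap.fst ℝ _ _))

theorem symWitt_apply (x : V × (V →L[ℝ] ℝ)) :
    symWitt hw x = (symSharp hw x.2, -symFlat w x.1) := rfl

variable [hV : Fact (Module.finrank ℝ V = 6)]

/-- In (v + ξ)ρ and (v + ξ)ρ' the covectors ξ and ι(v)ω play the same parts with exchanged roles, up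
to the sign built into `symWitt`. -/
theorem isPurePair_sym : IsPurePair (symRe w) (symIm w) (symWitt hw) where
  skew x y := by
    rw [symWitt_apply, symWitt_apply, wittForm_apply, wittForm_apply]
    have h1 := symFlat_skew w (symSharp hw x.2) (symSharp hw y.2)
    rw [symFlat_symSharp, symFlat_symSharp] at h1
    have h2 := symFlat_skew w x.1 y.1
    simp only [neg_apply]
    linarith
  sq x := by
    rw [symWitt_apply, symWitt_apply, map_neg, symSharp_symFlat, symFlat_symSharp]
    rfl
  left x := by
    rw [symWitt_apply, clifford_symRe, symFlat_symSharp]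
    conv_rhs => rw [show x = (x.1, x.2) from rfl, clifford_symIm]
    rw [neg_cwedge, neg_cwedge, smul_neg]
    simp only [Pi.single_neg]
    abel
  right x := by
    rw [symWitt_apply, clifford_symIm, symFlat_symSharp]
    conv_rhs => rw [show x = (x.1, x.2) from rfl, clifford_symRe]
    rw [neg_cwedge]

/-- Every covector ξ is some ι(v)ω, so ω² = 0 would give ξ ∧ ω = 0 for all ξ, hence ω = 0. -/
theorem formSq_ne_zero : formSq w ≠ 0 := by
  intro h
  have h1 : w = 0 := by
    refine eq_zero_of_cwedge_eq_zero (by norm_num) fun ξ => ?_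
    have h2 := curryLeft_formSq w (symSharp hw ξ)
    rw [h, form_zero_apply, symFlat_symSharp] at h2
    exact (smul_eq_zero.mp h2.symm).resolve_left two_ne_zero
  have h3 : ∀ u : V, u = 0 := fun u => hw u fun v => by rw [h1]; rfl
  have := hV.out
  have hs : Subsingleton V := ⟨fun u v => (h3 u).trans (h3 v).symm⟩
  rw [Module.finrank_zero_of_subsingleton] at this
  norm_num at this

theorem formCube_ne_zero : formCube w ≠ 0 := by
  intro h
  refine formSq_ne_zero hw (eq_zero_of_cwedge_eq_zero (by norm_num) fun ξ => ?_)
  have h2 := curryLeft_formCube w (symSharp hw ξ)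
  rw [h, form_zero_apply, symFlat_symSharp] at h2
  exact (smul_eq_zero.mp h2.symm).resolve_left three_ne_zero

/-- Skewness of ω makes ∑ (ι(e_a)ω)(v) ω⁻¹(eᵃ) equal to -v, so this is Euler's identity in degree 2
with a minus sign. -/
theorem sum_cwedge_curryLeft_symSharp (β : V [⋀^Fin 2]→L[ℝ] ℝ) :
    ∑ a, cwedge (symFlat w (sixBasis V a)) (β.curryLeft
      (symSharp hw (LinearMap.toContinuousLinearMap ((sixBasis V).coord a)))) = -(2 : ℝ) • β := by
  have h1 : ∀ v, ∑ a, (symFlat w (sixBasis V a) v) •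
      symSharp hw (LinearMap.toContinuousLinearMap ((sixBasis V).coord a)) = -v := by
    intro v
    have h2 := congrArg (symSharp hw) (sum_apply_smul_coord (sixBasis V) (symFlat w v))
    rw [symSharp_symFlat, map_sum] at h2
    conv_rhs => rw [← h2]
    rw [← Finset.sum_neg_distrib]
    exact Finset.sum_congr rfl fun a _ => by rw [symFlat_skew, map_smul, neg_smul]
  have h3 := congrArg (fun L : V [⋀^Fin 2]→L[ℝ] ℝ => L)
    (ContinuousAlternatingMap.alternatizeUncurryFin_curryLeft β)
  ext u
  have h4 := congrArg (fun γ => γ u) h3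
  rw [ContinuousAlternatingMap.alternatizeUncurryFin_apply] at h4
  simp only [ContinuousAlternatingMap.sum_apply, cwedge_apply]
  rw [Finset.sum_comm]
  have h5 : ∀ p : Fin 2, ∑ a, (-1 : ℤ) ^ (p : ℕ) • symFlat w (sixBasis V a) (u p) • β.curryLeft
      (symSharp hw (LinearMap.toContinuousLinearMap ((sixBasis V).coord a))) (p.removeNth u) =
      -((-1 : ℤ) ^ (p : ℕ) • β.curryLeft (u p) (p.removeNth u)) := by
    intro p
    rw [← Finset.smul_sum, ← smul_neg]
    congr 1
    have h6 := congrArg (fun x => β.curryLeft x (p.removeNth u)) (h1 (u p))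
    simp only [map_sum, map_neg, map_smul, ContinuousAlternatingMap.sum_apply,
      ContinuousAlternatingMap.smul_apply, ContinuousAlternatingMap.neg_apply] at h6
    exact h6
  rw [Finset.sum_congr rfl fun p _ => h5 p, Finset.sum_neg_distrib]
  rw [ContinuousAlternatingMap.smul_apply, neg_smul]
  refine congrArg Neg.neg (h4.trans ?_)
  rw [ContinuousAlternatingMap.smul_apply]
  norm_num

/-- Contracting ω ∧ β = 0 with a basis and its ω-dual and summing gives 6β - 2β - 2β + tω = 0. So β
is a multiple of ω, and ω² ≠ 0 makes the multiple zero. -/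
theorem eq_zero_of_wedge_eq_zero {β : V [⋀^Fin 2]→L[ℝ] ℝ} (h : wedge w β = 0) : β = 0 := by
  have h1 : ∀ a b, (symFlat w a b) • β - cwedge (symFlat w a) (β.curryLeft b) +
      cwedge (symFlat w b) (β.curryLeft a) + (β ![a, b]) • w = 0 := by
    intro a b
    have h2 : (wedge w β).curryLeft a = castDeg (Nat.add_comm 1 2) (wedge (w.curryLeft a) β) +
        (-1 : ℝ) ^ (1 + 1) • wedge w (β.curryLeft a) := curryLeft_wedge w β a
    rw [h, form_zero_apply, wedge_one_form, wedge_one_form_right] at h2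
    have h3 := congrArg (fun γ => γ.curryLeft b) h2
    beta_reduce at h3
    rw [form_zero_apply, curryLeft_add_apply, curryLeft_cwedge, curryLeft_smul_apply,
      curryLeft_smul_apply, curryLeft_cwedge] at h3
    have h4 : toCovector (w.curryLeft a) = symFlat w a := rfl
    have h5 : cwedge (toCovector (β.curryLeft a)) (w.curryLeft b) =
        -cwedge (symFlat w b) (β.curryLeft a) := by
      conv_lhs => rw [← cwedge_symFlat w b, cwedge_anticomm, cwedge_toCovector]
    rw [h4, h5] at h3
    have h6 : toCovector (β.curryLeft a) b = β ![a, b] := toCovector_apply _ _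
    rw [h6] at h3
    rw [h3]
    module
  have h7 : ∑ i, ((symFlat w (symSharp hw (LinearMap.toContinuousLinearMap ((sixBasis V).coord i)))
      (sixBasis V i)) • β - cwedge (symFlat w (symSharp hw
        (LinearMap.toContinuousLinearMap ((sixBasis V).coord i)))) (β.curryLeft (sixBasis V i)) +
      cwedge (symFlat w (sixBasis V i)) (β.curryLeft (symSharp hw
        (LinearMap.toContinuousLinearMap ((sixBasis V).coord i)))) +
      (β ![symSharp hw (LinearMap.toContinuousLinearMap ((sixBasis V).coord i)),
        sixBasis V i]) • w) = 0 := Finset.sum_eq_zero fun i _ => h1 _ _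
  rw [Finset.sum_add_distrib, Finset.sum_add_distrib, Finset.sum_sub_distrib,
    sum_cwedge_curryLeft_symSharp hw β] at h7
  simp only [symFlat_symSharp] at h7
  rw [sum_cwedge_curryLeft (sixBasis V) β, ← Finset.sum_smul, ← Finset.sum_smul] at h7
  simp only [LinearMap.coe_toContinuousLinearMap', Module.Basis.coord_apply,
    Module.Basis.repr_self, Finsupp.single_eq_same] at h7
  rw [Finset.sum_const, Finset.card_univ, Fintype.card_fin, nsmul_eq_mul, mul_one] at h7
  generalize (∑ i, β ![symSharp hw (LinearMap.toContinuousLinearMap ((sixBasis V).coord i)),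
        sixBasis V i]) = t at h7
  have h8 : β = (-(t / 2)) • w := by
    have h9 : β = (1 / 2 : ℝ) • (((6 : ℕ) : ℝ) • β - ((1 : ℕ) + 1 : ℝ) • β + -(2 : ℝ) • β + t • w) +
        (-(t / 2)) • w := by
      push_cast
      module
    rw [h9, h7, smul_zero, zero_add]
  have h10 : (-(t / 2)) • formSq w = 0 := by
    rw [formSq, ← wedge_smul_right, ← h8, h]
  rw [h8, (smul_eq_zero.mp h10).resolve_right (formSq_ne_zero hw)]
  module

end SymplecticAlgebra

end GenCY

end

/-! ### `J` on even forms of a symplectic 6-space. -/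

noncomputable section

namespace GenCY

attribute [local irreducible] pairing clifford

section WedgeFormSq

variable {V : Type*} [NormedAddCommGroup V] [NormedSpace ℝ V]

theorem wedge_cwedge_cwedge_one {m : ℕ} (ξ η : V →L[ℝ] ℝ) (X : V [⋀^Fin m]→L[ℝ] ℝ) :
    castDeg (Nat.add_comm 2 m) (wedge (cwedge ξ (cwedge η (oneForm V ℝ))) X) =
      cwedge ξ (cwedge η X) := by
  have h1 := cwedge_wedge ξ (cwedge η (oneForm V ℝ)) X
  have h2 := cwedge_wedge η (oneForm V ℝ) X
  have h3 := oneForm_wedge X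
  conv_rhs => rw [← h3, cwedge_castDeg, cwedge_castDeg, ← h2, cwedge_castDeg, ← h1]
  simp only [castDeg_castDeg]

variable [FiniteDimensional ℝ V]

theorem wedge_formSq (w : V [⋀^Fin 2]→L[ℝ] ℝ) :
    (wedge w (formSq w) : V [⋀^Fin (2 + 4)]→L[ℝ] ℝ) = formCube w := by
  have h := wedge_comm w (formSq w)
  rw [castDeg_rfl] at h
  rw [h]
  norm_num
  rfl

theorem mukai_symIm_symRe (w : V [⋀^Fin 2]→L[ℝ] ℝ) :
    mukai (symIm w) (symRe w) = (2 / 3 : ℝ) • formCube w := by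
  rw [mukai_eq, symRe_zero, symRe_four, symIm_two, symIm_six]
  rw [symIm_of_ne w (k := 0) (by norm_num) (by norm_num),
    symIm_of_ne w (k := 1) (by norm_num) (by norm_num),
    symIm_of_ne w (k := 3) (by norm_num) (by norm_num),
    symIm_of_ne w (k := 4) (by norm_num) (by norm_num),
    symIm_of_ne w (k := 5) (by norm_num) (by norm_num), wedge_comm_of_degree_zero, oneForm_apply,
    wedge_smul_right, wedge_formSq]
  simp only [zero_wedge, one_smul]
  module

theorem two_form_induction {P : (V [⋀^Fin 2]→L[ℝ] ℝ) → Prop} (h0 : P 0)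
    (hadd : ∀ α β, P α → P β → P (α + β)) (hsmul : ∀ (c : ℝ) α, P α → P (c • α))
    (hw : ∀ ξ η, P (cwedge ξ (cwedge η (oneForm V ℝ)))) (α : V [⋀^Fin 2]→L[ℝ] ℝ) : P α := by
  refine form_induction (k := 1) h0 hadd (fun ξ γ => ?_) α
  refine form_induction (k := 0) (P := fun γ => P (cwedge ξ γ)) ?_ ?_ (fun η c => ?_) γ
  · rwa [cwedge_zero]
  · intro a b ha hb
    rw [cwedge_add]
    exact hadd _ _ ha hb
  · have h : c = c 0 • oneForm V ℝ := by
      ext v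
      rw [Subsingleton.elim v 0, ContinuousAlternatingMap.smul_apply, oneForm_apply]
      simp
    rw [h, cwedge_smul, cwedge_smul]
    exact hsmul _ _ (hw ξ η)

end WedgeFormSq

section SymplecticStructure

variable {V : Type*} [NormedAddCommGroup V] [NormedSpace ℝ V] [FiniteDimensional ℝ V]
variable [hV : Fact (Module.finrank ℝ V = 6)] (w : V [⋀^Fin 2]→L[ℝ] ℝ)

theorem expForm_I_eq (k : ℕ) : expForm (Complex.I • ofRealForm w) k =
    ofRealForm (symRe w k) + Complex.I • ofRealForm (symIm w k) := by
  have h0 : ∀ j, ofRealForm (0 : V [⋀^Fin j]→L[ℝ] ℝ) = 0 := fun j => by ext v; simp [ofRealForm]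
  have hI : ∀ j, Complex.I • (0 : V [⋀^Fin j]→L[ℝ] ℂ) = 0 := fun j => by ext v; simp
  rcases Nat.lt_or_ge 6 k with h | h
  · rw [form_eq_zero h (symRe w k), form_eq_zero h (symIm w k), form_eq_zero h (expForm _ k), h0,
      hI, add_zero]
  by_cases hk : k % 2 = 1
  · rw [expForm_odd _ hk, symRe_of_ne w (by omega) (by omega),
      symIm_of_ne w (by omega) (by omega), h0, hI, add_zero]
  interval_cases k
  · rw [expForm_zero, symRe_zero, symIm_of_ne w (by norm_num) (by norm_num), h0, hI, add_zero]
    ext v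
    simp [oneForm_apply, ofRealForm]
  · norm_num at hk
  · rw [expForm_two, symIm_two, symRe_of_ne w (by norm_num) (by norm_num), h0, zero_add]
  · norm_num at hk
  · rw [expForm_I_four, symRe_four, symIm_of_ne w (by norm_num) (by norm_num), h0, hI, add_zero]
  · norm_num at hk
  · rw [expForm_I_six, symIm_six, symRe_of_ne w (by norm_num) (by norm_num), h0, zero_add]

theorem reForm_expForm_I : (fun k => reForm (expForm (Complex.I • ofRealForm w) k)) = symRe w := by
  funext k
  rw [expForm_I_eq]
  ext v
  simp [reForm, ofRealForm]

theorem imForm_expForm_I : (fun k => imForm (expForm (Complex.I • ofRealForm w) k)) = symIm w := by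
  funext k
  rw [expForm_I_eq]
  ext v
  simp [imForm, ofRealForm]

variable {w} (hw : ∀ u : V, (∀ v : V, w ![u, v] = 0) → u = 0)
include hw

theorem mukai_expForm_I_ne_zero : mukai (fun k => imForm (expForm (Complex.I • ofRealForm w) k))
    (fun k => reForm (expForm (Complex.I • ofRealForm w) k)) ≠ 0 := by
  rw [reForm_expForm_I, imForm_expForm_I, mukai_symIm_symRe]
  intro h
  exact formCube_ne_zero hw ((smul_eq_zero.mp h).resolve_left (by norm_num))

theorem volOf_expForm_I_ne_zero :
    volOf (expForm (Complex.I • ofRealForm w)) (sixBasis V) ≠ 0 :=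
  volOf_basis_ne_zero (mukai_expForm_I_ne_zero hw)

theorem pairing_expForm_I :
    pairing (volOf (expForm (Complex.I • ofRealForm w))) (symIm w) (symRe w) = 1 / 2 := by
  have h := pairing_volOf (mukai_expForm_I_ne_zero hw)
  rwa [reForm_expForm_I, imForm_expForm_I] at h

/-- The pairing embeds Λ⁴ in the dual of Λ². Composed with it, the injective map β ↦ ω ∧ β goes from
Λ² to a space of the same dimension and is bijective; injectivity of the embedding brings the
solution back to Λ⁴. -/
theorem wedge_surjective (χ : V [⋀^Fin 4]→L[ℝ] ℝ) :
    ∃ β : V [⋀^Fin 2]→L[ℝ] ℝ, wedge w β = χ := by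
  obtain ⟨ε, hε⟩ : ∃ ε : V [⋀^Fin 6]→L[ℝ] ℝ, ε (sixBasis V) ≠ 0 := ⟨_, volOf_expForm_I_ne_zero hw⟩
  have hfin : FiniteDimensional ℝ (V [⋀^Fin 2]→L[ℝ] ℝ) := finiteDimensional_form 2
  have key : ∀ (α : V [⋀^Fin 4]→L[ℝ] ℝ) (ψ : Spinor V ℝ),
      pairing ε (Pi.single 4 α) ψ = pairing ε (Pi.single 4 α) (Pi.single 2 (ψ 2)) := by
    intro α ψ
    rw [pairing, pairing, mukai_eq, mukai_eq]
    simp [zero_wedge]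
  let Q : (V [⋀^Fin 4]→L[ℝ] ℝ) →ₗ[ℝ] Module.Dual ℝ (V [⋀^Fin 2]→L[ℝ] ℝ) :=
    LinearMap.mk₂ ℝ (fun χ β => pairing ε (Pi.single 4 χ) (Pi.single 2 β))
      (fun a b c => by rw [Pi.single_add, pairing_add_left])
      (fun r a b => by rw [Pi.single_smul, pairing_smul_left]; rfl)
      (fun a b c => by rw [Pi.single_add, pairing_add_right])
      (fun r a b => by rw [Pi.single_smul, pairing_smul_right]; rfl)
  have hQ : ∀ α, Q α = 0 → α = 0 := by
    intro α hα
    have h1 : (Pi.single 4 α : Spinor V ℝ) = 0 := by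
      refine eq_zero_of_pairing_eq_zero hε fun ψ => ?_
      rw [key]
      exact congrArg (fun l => l (ψ 2)) hα
    have h2 := congrFun h1 4
    rwa [Pi.single_eq_same] at h2
  let L : (V [⋀^Fin 2]→L[ℝ] ℝ) →ₗ[ℝ] (V [⋀^Fin 4]→L[ℝ] ℝ) :=
    { toFun := fun β => wedge w β
      map_add' := fun a b => wedge_add_right _ _ _
      map_smul' := fun c a => wedge_smul_right _ _ _ }
  have hinj : Function.Injective (Q.comp L) := by
    rw [← LinearMap.ker_eq_bot, LinearMap.ker_eq_bot']
    intro β hβ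
    exact eq_zero_of_wedge_eq_zero hw (hQ _ hβ)
  obtain ⟨β, hβ⟩ := (LinearMap.injective_iff_surjective_of_finrank_eq_finrank
    Subspace.dual_finrank_eq.symm).mp hinj (Q χ)
  refine ⟨β, ?_⟩
  have h3 : Q (L β - χ) = 0 := by rw [map_sub, sub_eq_zero]; exact hβ
  exact sub_eq_zero.mp (hQ _ h3)

theorem cplxStr_clifford_clifford_symIm (w₁ w₂ : V × (V →L[ℝ] ℝ)) :
    cplxStr (volOf (expForm (Complex.I • ofRealForm w))) (symRe w)
      (clifford w₁ (clifford w₂ (symIm w))) = -clifford w₁ (clifford w₂ (symRe w)) := by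
  have hj := isPurePair_sym hw
  have hρ := pairing_expForm_I hw
  have hε := volOf_expForm_I_ne_zero hw
  have h1 : clifford w₂ (symIm w) = (-1 : ℝ) • clifford (symWitt hw w₂) (symRe w) := by
    rw [hj.left]
    module
  rw [h1, clifford_smul, hj.cplxStr_smul hρ hε, hj.cplxStr_clifford_clifford hρ hε, hj.right]
  module

/-- A vector u with `wittForm u u` = 2 has Clifford square 1, so ρ' = uuρ' and the rule for two
factors applies. -/
theorem cplxStr_symIm :
    cplxStr (volOf (expForm (Complex.I • ofRealForm w))) (symRe w) (symIm w) = -symRe w := by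
  have hj := isPurePair_sym hw
  have hρ := pairing_expForm_I hw
  have hε := volOf_expForm_I_ne_zero hw
  let u : V × (V →L[ℝ] ℝ) :=
    (sixBasis V 0, LinearMap.toContinuousLinearMap ((sixBasis V).coord 0))
  have hu : wittForm u u = 2 := by
    rw [wittForm_apply]
    simp [u]
    norm_num
  have h2 : ∀ x : Spinor V ℝ, clifford u (clifford u x) = x := by
    intro x
    have h3 := clifford_clifford_add u u x
    rw [hu, ← two_smul ℝ] at h3
    exact (smul_right_injective _ (two_ne_zero' ℝ)) h3
  have h4 := cplxStr_clifford_clifford_symIm hw u u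
  rwa [h2, h2] at h4

/-- For β = ξ ∧ η the argument is the spinor ξηρ, and ξηρ' = ξ ∧ η ∧ ω because 8-forms vanish. -/
theorem cplxStr_two_six (β : V [⋀^Fin 2]→L[ℝ] ℝ) :
    cplxStr (volOf (expForm (Complex.I • ofRealForm w))) (symRe w)
      (Pi.single 2 β + Pi.single 6 (-(1 / 2 : ℝ) • wedge β (formSq w))) =
      Pi.single 4 (wedge β w) := by
  have hj := isPurePair_sym hw
  have hρ := pairing_expForm_I hw
  have hε := volOf_expForm_I_ne_zero hw
  induction β using two_form_induction with
  | h0 =>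
    have h := hj.cplxStr_smul hρ hε 0 0
    rw [zero_smul, zero_smul] at h
    rw [zero_wedge, zero_wedge, form_smul_zero, Pi.single_zero, Pi.single_zero, Pi.single_zero,
      add_zero, h]
  | hadd a b ha hb =>
    have e : (Pi.single 2 (a + b) + Pi.single 6 (-(1 / 2 : ℝ) • wedge (a + b) (formSq w)) :
        Spinor V ℝ) = (Pi.single 2 a + Pi.single 6 (-(1 / 2 : ℝ) • wedge a (formSq w))) +
        (Pi.single 2 b + Pi.single 6 (-(1 / 2 : ℝ) • wedge b (formSq w))) := by
      rw [wedge_add_left, smul_add, Pi.single_add, Pi.single_add]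
      abel
    rw [e, hj.cplxStr_add hρ hε, ha, hb, wedge_add_left, Pi.single_add]
  | hsmul c a ha =>
    have e : (Pi.single 2 (c • a) + Pi.single 6 (-(1 / 2 : ℝ) • wedge (c • a) (formSq w)) :
        Spinor V ℝ) = c • (Pi.single 2 a + Pi.single 6 (-(1 / 2 : ℝ) • wedge a (formSq w))) := by
      rw [wedge_smul_left, smul_comm, Pi.single_smul, Pi.single_smul, smul_add]
    rw [e, hj.cplxStr_smul hρ hε, ha, wedge_smul_left, Pi.single_smul]
  | hw ξ η =>
    have h := hj.cplxStr_clifford_clifford hρ hε (0, ξ) (0, η)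
    rw [symRe, symIm, clifford_add, clifford_add, clifford_add, clifford_add] at h
    simp only [clifford_covector_single] at h
    rw [form_eq_zero (k := 6 + 1 + 1) (by norm_num) (cwedge ξ _), Pi.single_zero, add_zero,
      cwedge_smul, cwedge_smul, ← wedge_cwedge_cwedge_one ξ η (formSq w),
      ← wedge_cwedge_cwedge_one ξ η w] at h
    exact h

theorem cplxStr_four (β : V [⋀^Fin 2]→L[ℝ] ℝ) :
    cplxStr (volOf (expForm (Complex.I • ofRealForm w))) (symRe w) (Pi.single 4 (wedge β w)) =
      -(Pi.single 2 β + Pi.single 6 (-(1 / 2 : ℝ) • wedge β (formSq w))) := by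
  have hj := isPurePair_sym hw
  have hρ := pairing_expForm_I hw
  have hε := volOf_expForm_I_ne_zero hw
  induction β using two_form_induction with
  | h0 =>
    have h := hj.cplxStr_smul hρ hε 0 0
    rw [zero_smul, zero_smul] at h
    rw [zero_wedge, zero_wedge, form_smul_zero, Pi.single_zero, Pi.single_zero, Pi.single_zero,
      add_zero, h, neg_zero]
  | hadd a b ha hb =>
    rw [wedge_add_left, wedge_add_left, Pi.single_add, hj.cplxStr_add hρ hε, ha, hb, smul_add,
      Pi.single_add, Pi.single_add]
    abel
  | hsmul c a ha =>
    rw [wedge_smul_left, wedge_smul_left, Pi.single_smul, hj.cplxStr_smul hρ hε, ha,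
      smul_comm (-(1 / 2 : ℝ)) c (wedge a _), Pi.single_smul (i := 2), Pi.single_smul (i := 6) c,
      smul_neg, smul_add]
  | hw ξ η =>
    have h := cplxStr_clifford_clifford_symIm hw (0, ξ) (0, η)
    rw [symRe, symIm, clifford_add, clifford_add, clifford_add, clifford_add] at h
    simp only [clifford_covector_single] at h
    rw [form_eq_zero (k := 6 + 1 + 1) (by norm_num) (cwedge ξ _), Pi.single_zero, add_zero,
      cwedge_smul, cwedge_smul, ← wedge_cwedge_cwedge_one ξ η (formSq w),
      ← wedge_cwedge_cwedge_one ξ η w] at h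
    exact h

/-- ω³ = 3(ρ' - (ω - ½ω³)), a combination of spinors on which `J` is known. -/
theorem cplxStr_formCube :
    cplxStr (volOf (expForm (Complex.I • ofRealForm w))) (symRe w) (Pi.single 6 (formCube w)) =
      (-(3 : ℝ)) • (Pi.single 0 (oneForm V ℝ) + Pi.single 4 ((1 / 2 : ℝ) • formSq w)) := by
  have hj := isPurePair_sym hw
  have hρ := pairing_expForm_I hw
  have hε := volOf_expForm_I_ne_zero hw
  have e : (Pi.single 6 (formCube w) : Spinor V ℝ) = (3 : ℝ) • (symIm w + (-1 : ℝ) •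
      (Pi.single 2 w + Pi.single 6 (-(1 / 2 : ℝ) • wedge w (formSq w)))) := by
    rw [wedge_formSq, symIm, Pi.single_smul, Pi.single_smul]
    module
  rw [e, hj.cplxStr_smul hρ hε, hj.cplxStr_add hρ hε, hj.cplxStr_smul hρ hε, cplxStr_two_six hw,
    cplxStr_symIm hw, symRe, Pi.single_smul, Pi.single_smul]
  have h : (wedge w w : V [⋀^Fin (2 + 2)]→L[ℝ] ℝ) = formSq w := rfl
  rw [h]
  module

/-- The complex structure on even forms without component of degree `0` defined by the exponential
of a symplectic form. -/
theorem cplxStr_expForm_I {σ : Spinor V ℝ} (hσ : ∀ k, k % 2 = 1 → σ k = 0) (hσ0 : σ 0 = 0)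
    {γ : V [⋀^Fin 2]→L[ℝ] ℝ} {s : ℝ} (h4 : σ 4 = wedge γ w)
    (h6 : σ 6 + (1 / 2 : ℝ) • wedge (σ 2) (formSq w) = s • formCube w) :
    cplxStr (volOf (expForm (Complex.I • ofRealForm w))) (symRe w) σ 0 =
      (-(3 * s)) • oneForm V ℝ ∧
    cplxStr (volOf (expForm (Complex.I • ofRealForm w))) (symRe w) σ 2 = -γ := by
  have hj := isPurePair_sym hw
  have hρ := pairing_expForm_I hw
  have hε := volOf_expForm_I_ne_zero hw
  -- Decomposition into the three kinds treated above: the 2-form completed in degree 6, the 4-form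
  -- γ ∧ ω, and the remaining multiple of ω³.
  have e : σ = (Pi.single 2 (σ 2) + Pi.single 6 (-(1 / 2 : ℝ) • wedge (σ 2) (formSq w))) +
      Pi.single 4 (wedge γ w) + s • (Pi.single 6 (formCube w) : Spinor V ℝ) := by
    have e6 : (Pi.single 6 (-(1 / 2 : ℝ) • wedge (σ 2) (formSq w)) : Spinor V ℝ) =
        Pi.single 6 (σ 6) - s • (Pi.single 6 (formCube w) : Spinor V ℝ) := by
      rw [← Pi.single_smul, ← h6, ← Pi.single_sub]
      congr 1
      module
    rw [e6, ← h4]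
    have e7 : σ = Pi.single 2 (σ 2) + Pi.single 4 (σ 4) + Pi.single 6 (σ 6) := by
      funext k
      rcases Nat.lt_or_ge 6 k with h | h
      · exact (form_eq_zero h _).trans (form_eq_zero h _).symm
      by_cases hk : k % 2 = 1
      · have h1 : k ≠ 2 := by omega
        have h2 : k ≠ 4 := by omega
        have h3 : k ≠ 6 := by omega
        simp [hσ k hk, h1, h2, h3]
      interval_cases k <;> simp_all
    conv_lhs => rw [e7]
    abel
  rw [e, hj.cplxStr_add hρ hε, hj.cplxStr_add hρ hε, hj.cplxStr_smul hρ hε, cplxStr_two_six hw,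
    cplxStr_four hw, cplxStr_formCube hw]
  constructor
  · simp [smul_smul, mul_comm]
  · simp

end SymplecticStructure

end GenCY

end

/-! ### Forms in charts and the exterior derivative on a manifold. -/

noncomputable section

namespace GenCY

open Filter Topology

section Charts

variable {𝕜 E M F : Type*} [NontriviallyNormedField 𝕜] [NormedAddCommGroup E] [NormedSpace 𝕜 E]
  [TopologicalSpace M] [ChartedSpace E M] [NormedAddCommGroup F] [NormedSpace 𝕜 F]

/-- The change of coordinates between two preferred charts. -/
def chartTrans (x x' : M) : E → E := chartAt E x' ∘ (chartAt E x).symm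

theorem eventually_chartAt_symm_mem {x x' : M} {y : E} (hy : y ∈ (chartAt E x).target)
    (hy' : (chartAt E x).symm y ∈ (chartAt E x').source) :
    ∀ᶠ z in 𝓝 y, z ∈ (chartAt E x).target ∧ (chartAt E x).symm z ∈ (chartAt E x').source :=
  Filter.Eventually.and ((chartAt E x).open_target.mem_nhds hy)
    (((chartAt E x).continuousAt_symm hy).eventually ((chartAt E x').open_source.mem_nhds hy'))

theorem chartTrans_mem {x x' : M} {y : E}
    (hy' : (chartAt E x).symm y ∈ (chartAt E x').source) :
    chartTrans x x' y ∈ (chartAt E x').target := (chartAt E x').map_source hy'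

theorem symm_chartTrans {x x' : M} {y : E}
    (hy' : (chartAt E x).symm y ∈ (chartAt E x').source) :
    (chartAt E x').symm (chartTrans x x' y) = (chartAt E x).symm y := (chartAt E x').left_inv hy'

theorem chartTrans_chartTrans {x x' p : M} {y : E}
    (hy' : (chartAt E x).symm y ∈ (chartAt E x').source) :
    chartTrans x' p (chartTrans x x' y) = chartTrans x p y :=
  congrArg (chartAt E p) (symm_chartTrans hy')

theorem contDiffAt_chartTrans (𝕜 : Type*) [NontriviallyNormedField 𝕜] [NormedSpace 𝕜 E] (n : ℕ∞ω)
    [IsManifold 𝓘(𝕜, E) n M] {x x' : M} {y : E}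
    (hy : y ∈ (chartAt E x).target) (hy' : (chartAt E x).symm y ∈ (chartAt E x').source) :
    ContDiffAt 𝕜 n (chartTrans x x') y := by
  have h := contDiffWithinAt_ext_coord_change (I := 𝓘(𝕜, E)) (n := n) x' x (y := y)
    (by simp only [mfld_simps]; exact ⟨hy, hy'⟩)
  simp only [mfld_simps] at h
  exact contDiffWithinAt_univ.mp h

/-- Each tangent space is identified with `E` by the preferred chart at its own point, so the
derivative of an inverse chart is that of a transition map into the preferred chart of the image
point. -/
theorem mfderiv_chartAt_symm [IsManifold 𝓘(𝕜, E) 1 M] {x : M} {y : E}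
    (hy : y ∈ (chartAt E x).target) :
    (mfderiv 𝓘(𝕜, E) 𝓘(𝕜, E) (chartAt E x).symm y : E →L[𝕜] E) =
      fderiv 𝕜 (chartTrans x ((chartAt E x).symm y)) y := by
  have h : MDifferentiableAt 𝓘(𝕜, E) 𝓘(𝕜, E) (chartAt E x).symm y :=
    mdifferentiableAt_atlas_symm (chart_mem_atlas E x) hy
  refine h.mfderiv.trans ?_
  simp only [writtenInExtChartAt, mfld_simps]
  rw [fderivWithin_univ]
  rfl

theorem mfderiv_chartAt_self [IsManifold 𝓘(𝕜, E) 1 M] (x : M) :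
    (mfderiv 𝓘(𝕜, E) 𝓘(𝕜, E) (chartAt E x) x : E →L[𝕜] E) = ContinuousLinearMap.id 𝕜 E := by
  have h : MDifferentiableAt 𝓘(𝕜, E) 𝓘(𝕜, E) (chartAt E x) x :=
    mdifferentiableAt_atlas (chart_mem_atlas E x) (mem_chart_source E x)
  refine h.mfderiv.trans ?_
  simp only [writtenInExtChartAt, mfld_simps]
  rw [fderivWithin_univ]
  have h2 : (chartAt E x : M → E) ∘ (chartAt E x).symm =ᶠ[𝓝 (chartAt E x x)] id := by
    filter_upwards [(chartAt E x).open_target.mem_nhds (mem_chart_target E x)] with z hz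
    exact (chartAt E x).right_inv hz
  exact h2.fderiv_eq.trans fderiv_id

variable {k : ℕ}

theorem chartRep_eq [IsManifold 𝓘(𝕜, E) 1 M] (α : Form 𝕜 E M F k) {x : M} {y : E}
    (hy : y ∈ (chartAt E x).target) :
    chartRep x α y = (α ((chartAt E x).symm y)).compContinuousLinearMap
      (fderiv 𝕜 (chartTrans x ((chartAt E x).symm y)) y) := by
  rw [chartRep, mfderiv_chartAt_symm hy]

theorem chartRep_self [IsManifold 𝓘(𝕜, E) 1 M] (α : Form 𝕜 E M F k) (x : M) :
    chartRep x α (chartAt E x x) = α x := by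
  have hx : (chartAt E x).symm (chartAt E x x) = x := (chartAt E x).left_inv (mem_chart_source E x)
  have h2 : chartTrans x x =ᶠ[𝓝 (chartAt E x x)] (id : E → E) := by
    filter_upwards [(chartAt E x).open_target.mem_nhds (mem_chart_target E x)] with z hz
    exact (chartAt E x).right_inv hz
  rw [chartRep_eq α (mem_chart_target E x), hx, h2.fderiv_eq, fderiv_id]
  rfl

/-- The derivative of the change of coordinates is invertible. -/
theorem fderiv_chartTrans_comp [IsManifold 𝓘(𝕜, E) 1 M] {x x' p : M} {y : E}
    (hy : y ∈ (chartAt E x).target) (hy' : (chartAt E x).symm y ∈ (chartAt E x').source)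
    (hp : (chartAt E x).symm y ∈ (chartAt E p).source) :
    (fderiv 𝕜 (chartTrans x' p) (chartTrans x x' y)).comp (fderiv 𝕜 (chartTrans x x') y) =
      fderiv 𝕜 (chartTrans x p) y := by
  have h1 := (contDiffAt_chartTrans 𝕜 1 hy hy').differentiableAt one_ne_zero
  have h2 := (contDiffAt_chartTrans 𝕜 1 (x' := p) (chartTrans_mem hy')
    ((symm_chartTrans hy').symm ▸ hp)).differentiableAt one_ne_zero
  rw [← fderiv_comp y h2 h1]
  refine Filter.EventuallyEq.fderiv_eq ?_
  filter_upwards [eventually_chartAt_symm_mem hy hy'] with z hz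
  exact chartTrans_chartTrans hz.2

theorem chartRep_chartTrans [IsManifold 𝓘(𝕜, E) 1 M] (α : Form 𝕜 E M F k) {x x' : M} {y : E}
    (hy : y ∈ (chartAt E x).target) (hy' : (chartAt E x).symm y ∈ (chartAt E x').source) :
    chartRep x α y = (chartRep x' α (chartTrans x x' y)).compContinuousLinearMap
      (fderiv 𝕜 (chartTrans x x') y) := by
  rw [chartRep_eq α hy, chartRep_eq α (chartTrans_mem hy'), symm_chartTrans hy',
    ← fderiv_chartTrans_comp hy hy' (mem_chart_source E _)]
  rfl

theorem extD_apply [IsManifold 𝓘(𝕜, E) 1 M] (α : Form 𝕜 E M F k) (x : M) :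
    extD α x = extDeriv (chartRep x α) (chartAt E x x) := by
  rw [extD, mfderiv_chartAt_self]
  rfl

end Charts

section RealForms

variable {E M F : Type*} [NormedAddCommGroup E] [NormedSpace ℝ E]
  [TopologicalSpace M] [ChartedSpace E M]
  [NormedAddCommGroup F] [NormedSpace ℝ F] {k : ℕ}

theorem IsCn.contDiffAt {α : Form ℝ E M F k} (hα : IsCn ∞ α) {x : M} {y : E}
    (hy : y ∈ (chartAt E x).target) : ContDiffAt ℝ ∞ (chartRep x α) y :=
  (hα x).contDiffAt ((chartAt E x).open_target.mem_nhds hy)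

theorem IsCn.differentiableAt {α : Form ℝ E M F k} (hα : IsCn ∞ α) {x : M} {y : E}
    (hy : y ∈ (chartAt E x).target) : DifferentiableAt ℝ (chartRep x α) y :=
  (hα.contDiffAt hy).differentiableAt (by simp)

theorem isCn_of_contDiffAt {α : Form ℝ E M F k}
    (h : ∀ x, ∀ y ∈ (chartAt E x).target, ContDiffAt ℝ ∞ (chartRep x α) y) : IsCn ∞ α :=
  fun x y hy => (h x y hy).contDiffWithinAt

theorem chartRep_add (α β : Form ℝ E M F k) (x : M) :
    chartRep x (α + β) = chartRep x α + chartRep x β := rfl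

theorem chartRep_smul (c : ℝ) (α : Form ℝ E M F k) (x : M) :
    chartRep x (c • α) = c • chartRep x α := rfl

theorem IsCn.add {α β : Form ℝ E M F k} (hα : IsCn ∞ α) (hβ : IsCn ∞ β) : IsCn ∞ (α + β) :=
  isCn_of_contDiffAt fun _ _ hy => (hα.contDiffAt hy).add (hβ.contDiffAt hy)

theorem IsCn.smul {α : Form ℝ E M F k} (c : ℝ) (hα : IsCn ∞ α) : IsCn ∞ (c • α) :=
  isCn_of_contDiffAt fun _ _ hy => (hα.contDiffAt hy).const_smul c

theorem IsCn.neg {α : Form ℝ E M F k} (hα : IsCn ∞ α) : IsCn ∞ (-α) :=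
  isCn_of_contDiffAt fun _ _ hy => (hα.contDiffAt hy).neg

theorem IsCn.sub {α β : Form ℝ E M F k} (hα : IsCn ∞ α) (hβ : IsCn ∞ β) : IsCn ∞ (α - β) :=
  isCn_of_contDiffAt fun _ _ hy => (hα.contDiffAt hy).sub (hβ.contDiffAt hy)

theorem isCn_zero : IsCn ∞ (0 : Form ℝ E M F k) :=
  isCn_of_contDiffAt fun _ _ _ => (contDiffAt_const (c := 0)).congr_of_eventuallyEq
    (Eventually.of_forall fun _ => by ext; rfl)

variable [IsManifold 𝓘(ℝ, E) ∞ M]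

instance isManifold_one : IsManifold 𝓘(ℝ, E) 1 M := IsManifold.of_le (n := ∞) (by simp)

theorem minSmoothness_two_le : minSmoothness ℝ 2 ≤ ∞ := by
  rw [minSmoothness_of_isRCLikeNormedField]
  exact WithTop.coe_le_coe.mpr le_top

/-- At each point `extD` is computed in that point's own chart; naturality of d under transition
maps shows that any other chart gives the same result. -/
theorem chartRep_extD {α : Form ℝ E M F k} (hα : IsCn ∞ α) {x : M} {y : E}
    (hy : y ∈ (chartAt E x).target) : chartRep x (extD α) y = extDeriv (chartRep x α) y := by
  set p := (chartAt E x).symm y with hp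
  have hy' : (chartAt E x).symm y ∈ (chartAt E p).source := mem_chart_source E _
  have h1 : chartRep x α =ᶠ[𝓝 y] fun z => (chartRep p α (chartTrans x p z)).compContinuousLinearMap
      (fderiv ℝ (chartTrans x p) z) := by
    filter_upwards [eventually_chartAt_symm_mem hy hy'] with z hz
    exact chartRep_chartTrans α hz.1 hz.2
  rw [h1.extDeriv_eq, extDeriv_pullback (hα.differentiableAt (chartTrans_mem hy'))
    (contDiffAt_chartTrans ℝ ∞ hy hy') minSmoothness_two_le, chartRep_eq _ hy, ← hp, extD_apply]
  rfl

theorem contDiffAt_extDeriv {η : E → E [⋀^Fin k]→L[ℝ] F} {y : E} (h : ContDiffAt ℝ ∞ η y) :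
    ContDiffAt ℝ ∞ (extDeriv η) y := by
  have e : extDeriv η =
      ContinuousAlternatingMap.alternatizeUncurryFinCLM ℝ E F ∘ fderiv ℝ η := rfl
  rw [e]
  exact (ContinuousAlternatingMap.alternatizeUncurryFinCLM ℝ E F).contDiff.contDiffAt.comp y
    (h.fderiv_right (m := ∞) (by simp))

theorem chartRep_extD_eventuallyEq {α : Form ℝ E M F k} (hα : IsCn ∞ α) {x : M} {y : E}
    (hy : y ∈ (chartAt E x).target) : chartRep x (extD α) =ᶠ[𝓝 y] extDeriv (chartRep x α) := by
  filter_upwards [(chartAt E x).open_target.mem_nhds hy] with z hz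
  exact chartRep_extD hα hz

theorem IsCn.extD {α : Form ℝ E M F k} (hα : IsCn ∞ α) : IsCn ∞ (extD α) :=
  isCn_of_contDiffAt fun _ _ hy =>
    (contDiffAt_extDeriv (hα.contDiffAt hy)).congr_of_eventuallyEq
      (chartRep_extD_eventuallyEq hα hy)

theorem extD_extD {α : Form ℝ E M F k} (hα : IsCn ∞ α) : extD (extD α) = 0 := by
  funext x
  have hx := mem_chart_target E x
  rw [extD_apply, (chartRep_extD_eventuallyEq hα hx).extDeriv_eq,
    extDeriv_extDeriv_apply (hα.contDiffAt hx) minSmoothness_two_le]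
  rfl

theorem extD_add {α β : Form ℝ E M F k} (hα : IsCn ∞ α) (hβ : IsCn ∞ β) :
    extD (α + β) = extD α + extD β := by
  funext x
  have hx := mem_chart_target E x
  rw [Pi.add_apply, extD_apply, extD_apply, extD_apply, chartRep_add,
    extDeriv_add (hα.differentiableAt hx) (hβ.differentiableAt hx)]

theorem extD_smul (c : ℝ) (α : Form ℝ E M F k) : extD (c • α) = c • extD α := by
  funext x
  rw [Pi.smul_apply, extD_apply, extD_apply, chartRep_smul, extDeriv_smul]

theorem extD_neg (α : Form ℝ E M F k) : extD (-α) = -extD α := by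
  have h := extD_smul (-1) α
  rwa [neg_one_smul, neg_one_smul] at h

theorem extD_zero : extD (0 : Form ℝ E M F k) = 0 := by
  have h := extD_smul 0 (0 : Form ℝ E M F k)
  rwa [zero_smul, zero_smul] at h

theorem extD_sub {α β : Form ℝ E M F k} (hα : IsCn ∞ α) (hβ : IsCn ∞ β) :
    extD (α - β) = extD α - extD β := by
  rw [sub_eq_add_neg, extD_add hα hβ.neg, extD_neg, sub_eq_add_neg]

end RealForms

end GenCY

end

/-! ### Leibniz rule; d and composition with linear maps of the values. -/

noncomputable section

namespace GenCY

open Filter Topology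

section FlatLeibniz

variable {V : Type*} [NormedAddCommGroup V] [NormedSpace ℝ V]
variable {F : Type*} [NormedField F] [NormedAlgebra ℝ F] {k l : ℕ}

theorem castDeg_sum {ι : Type*} (s : Finset ι) (h : k = l) (f : ι → V [⋀^Fin k]→L[ℝ] F) :
    castDeg h (∑ i ∈ s, f i) = ∑ i ∈ s, castDeg h (f i) := by
  subst h
  rfl

variable [FiniteDimensional ℝ V]

theorem alternatizeUncurryFin_eq_sum {ι : Type*} [Fintype ι] (b : Module.Basis ι ℝ V)
    (A : V →L[ℝ] V [⋀^Fin k]→L[ℝ] F) : ContinuousAlternatingMap.alternatizeUncurryFin A =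
      ∑ a, cwedge (LinearMap.toContinuousLinearMap (b.coord a)) (A (b a)) := by
  ext v
  rw [ContinuousAlternatingMap.sum_apply, ContinuousAlternatingMap.alternatizeUncurryFin_apply]
  simp only [cwedge_apply]
  rw [Finset.sum_comm]
  refine Finset.sum_congr rfl fun i _ => ?_
  rw [← Finset.smul_sum]
  congr 1
  have h : v i = ∑ a, (b.repr (v i)) a • b a := (b.sum_repr _).symm
  conv_lhs => rw [h, map_sum, ContinuousAlternatingMap.sum_apply]
  refine Finset.sum_congr rfl fun a _ => ?_
  rw [map_smul]
  rfl

/-- With d = ∑ eᵃ ∧ ∂_a, identities for d reduce to the algebra of `cwedge`. -/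
theorem extDeriv_eq_sum {ι : Type*} [Fintype ι] (b : Module.Basis ι ℝ V)
    (α : V → V [⋀^Fin k]→L[ℝ] F) (y : V) : extDeriv α y =
      ∑ a, cwedge (LinearMap.toContinuousLinearMap (b.coord a)) (fderiv ℝ α y (b a)) :=
  alternatizeUncurryFin_eq_sum b _

variable [FiniteDimensional ℝ F]

variable (V F k l) in
/-- The exterior product as a continuous bilinear map. -/
def wedgeL : (V [⋀^Fin k]→L[ℝ] F) →L[ℝ] (V [⋀^Fin l]→L[ℝ] F) →L[ℝ] V [⋀^Fin (k + l)]→L[ℝ] F :=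
  haveI := finiteDimensional_form (V := V) (F := F)
  (wedgeₗ k l).toContinuousBilinearMap

theorem contDiffAt_wedge {n : ℕ∞ω} {α : V → V [⋀^Fin k]→L[ℝ] F} {β : V → V [⋀^Fin l]→L[ℝ] F} {y : V}
    (hα : ContDiffAt ℝ n α y) (hβ : ContDiffAt ℝ n β y) :
    ContDiffAt ℝ n (fun z => wedge (α z) (β z)) y := by
  have h := (wedgeL V F k l).isBoundedBilinearMap.contDiff (n := n)
  exact (h.contDiffAt (x := (α y, β y))).comp y (hα.prodMk hβ)

theorem fderiv_wedge {α : V → V [⋀^Fin k]→L[ℝ] F} {β : V → V [⋀^Fin l]→L[ℝ] F} {y : V}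
    (hα : DifferentiableAt ℝ α y) (hβ : DifferentiableAt ℝ β y) (v : V) :
    fderiv ℝ (fun z => wedge (α z) (β z)) y v =
      wedge (α y) (fderiv ℝ β y v) + wedge (fderiv ℝ α y v) (β y) := by
  have h := ((wedgeL V F k l).hasFDerivAt_of_bilinear hα.hasFDerivAt hβ.hasFDerivAt).fderiv
  exact congrArg (fun L => L v) h

theorem extDeriv_wedge {α : V → V [⋀^Fin k]→L[ℝ] F} {β : V → V [⋀^Fin l]→L[ℝ] F} {y : V}
    (hα : DifferentiableAt ℝ α y) (hβ : DifferentiableAt ℝ β y) :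
    extDeriv (fun z => wedge (α z) (β z)) y =
      castDeg (Nat.succ_add k l) (wedge (extDeriv α y) (β y)) +
        (-1 : ℝ) ^ k • wedge (α y) (extDeriv β y) := by
  have b := Module.finBasis ℝ V
  rw [extDeriv_eq_sum b, extDeriv_eq_sum b, extDeriv_eq_sum b, ← wedgeₗ_apply, ← wedgeₗ_apply,
    map_sum, map_sum, LinearMap.sum_apply, castDeg_sum, Finset.smul_sum, ← Finset.sum_add_distrib]
  refine Finset.sum_congr rfl fun a _ => ?_
  rw [fderiv_wedge hα hβ, cwedge_add, wedgeₗ_apply, wedgeₗ_apply, cwedge_wedge, wedge_cwedge,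
    smul_smul, ← mul_pow]
  simp [add_comm]

end FlatLeibniz

section FlatComp

variable {V : Type*} [NormedAddCommGroup V] [NormedSpace ℝ V]
variable {F F' : Type*} [NormedAddCommGroup F] [NormedSpace ℝ F] [NormedAddCommGroup F']
  [NormedSpace ℝ F'] {k : ℕ}

theorem contDiffAt_compContinuousAlternatingMap (L : F →L[ℝ] F') {n : ℕ∞ω}
    {α : V → V [⋀^Fin k]→L[ℝ] F} {y : V} (hα : ContDiffAt ℝ n α y) :
    ContDiffAt ℝ n (fun z => L.compContinuousAlternatingMap (α z)) y :=
  ((ContinuousLinearMap.compContinuousAlternatingMapCLM ℝ V F F' (Fin k) L).contDiff.contDiffAt (x := α y)).comp y hα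

theorem extDeriv_compContinuousAlternatingMap (L : F →L[ℝ] F') {α : V → V [⋀^Fin k]→L[ℝ] F} {y : V}
    (hα : DifferentiableAt ℝ α y) : extDeriv (fun z => L.compContinuousAlternatingMap (α z)) y =
      L.compContinuousAlternatingMap (extDeriv α y) := by
  have h2 : ∀ v, fderiv ℝ (fun z => L.compContinuousAlternatingMap (α z)) y v =
      L.compContinuousAlternatingMap (fderiv ℝ α y v) := fun v =>
    congrArg (fun D => D v) ((ContinuousLinearMap.compContinuousAlternatingMapCLM ℝ V F F' (Fin k)
      L).hasFDerivAt.comp y hα.hasFDerivAt).fderiv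
  ext v
  rw [ContinuousLinearMap.compContinuousAlternatingMap_coe, Function.comp_apply, extDeriv, extDeriv,
    ContinuousAlternatingMap.alternatizeUncurryFin_apply,
    ContinuousAlternatingMap.alternatizeUncurryFin_apply, map_sum]
  refine Finset.sum_congr rfl fun i _ => ?_
  rw [h2, map_zsmul]
  rfl

end FlatComp

section Global

variable {E M : Type*} [NormedAddCommGroup E] [NormedSpace ℝ E]
  [TopologicalSpace M] [ChartedSpace E M]

theorem IsCn.castDeg {F : Type*} [NormedField F] [NormedAlgebra ℝ F] {k l : ℕ} (h : k = l)
    {α : Form ℝ E M F k} (hα : IsCn ∞ α) : IsCn ∞ (fun p => castDeg h (α p)) := by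
  subst h
  exact hα

theorem chartRep_wedge {F : Type*} [NormedField F] [NormedAlgebra ℝ F] {k l : ℕ}
    (α : Form ℝ E M F k) (β : Form ℝ E M F l) (x : M) :
    chartRep x (fun p => wedge (α p) (β p)) =
      fun y => wedge (chartRep x α y) (chartRep x β y) :=
  funext fun _ => wedge_compContinuousLinearMap _ _ _

variable [FiniteDimensional ℝ E]

theorem IsCn.wedge {F : Type*} [NormedField F] [NormedAlgebra ℝ F] [FiniteDimensional ℝ F] {k l : ℕ}
    {α : Form ℝ E M F k} {β : Form ℝ E M F l} (hα : IsCn ∞ α) (hβ : IsCn ∞ β) :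
    IsCn ∞ (fun p => wedge (α p) (β p) : Form ℝ E M F (k + l)) :=
  isCn_of_contDiffAt fun x y hy => by
    rw [chartRep_wedge]
    exact contDiffAt_wedge (hα.contDiffAt hy) (hβ.contDiffAt hy)

variable [IsManifold 𝓘(ℝ, E) ∞ M]

theorem extD_wedge {F : Type*} [NormedField F] [NormedAlgebra ℝ F] [FiniteDimensional ℝ F] {k l : ℕ}
    {α : Form ℝ E M F k} {β : Form ℝ E M F l} (hα : IsCn ∞ α) (hβ : IsCn ∞ β) :
    extD (fun p => wedge (α p) (β p) : Form ℝ E M F (k + l)) =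
      fun p => castDeg (Nat.succ_add k l) (wedge (extD α p) (β p)) +
        (-1 : ℝ) ^ k • wedge (α p) (extD β p) := by
  funext p
  have hx := mem_chart_target E p
  rw [extD_apply, chartRep_wedge, extDeriv_wedge (hα.differentiableAt hx) (hβ.differentiableAt hx),
    extD_apply, extD_apply, chartRep_self, chartRep_self]

end Global

section GlobalComp

variable {E M : Type*} [NormedAddCommGroup E] [NormedSpace ℝ E]
  [TopologicalSpace M] [ChartedSpace E M]
variable {F F' : Type*} [NormedAddCommGroup F] [NormedSpace ℝ F] [NormedAddCommGroup F']
  [NormedSpace ℝ F'] {k : ℕ}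

theorem IsCn.comp (L : F →L[ℝ] F') {α : Form ℝ E M F k} (hα : IsCn ∞ α) :
    IsCn ∞ (fun p => L.compContinuousAlternatingMap (α p)) :=
  isCn_of_contDiffAt fun _ _ hy => contDiffAt_compContinuousAlternatingMap L (hα.contDiffAt hy)

theorem extD_comp [IsManifold 𝓘(ℝ, E) ∞ M] (L : F →L[ℝ] F') {α : Form ℝ E M F k} (hα : IsCn ∞ α) :
    extD (fun p => L.compContinuousAlternatingMap (α p)) =
      fun p => L.compContinuousAlternatingMap (extD α p) := by
  funext p
  have hx := mem_chart_target E p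
  rw [extD_apply, extD_apply]
  exact extDeriv_compContinuousAlternatingMap L (hα.differentiableAt hx)

end GlobalComp

end GenCY

end

/-! ### Smoothness of pointwise solutions of linear equations. -/

noncomputable section

namespace GenCY

open Filter Topology

section SmoothSolution

/-- If B is a left inverse of A(y), then B A(z) is invertible for z near y, where X(z) = (B A(z))⁻¹
B (A(z) X(z)); inversion of operators is smooth. -/
theorem contDiffAt_of_clm_apply {E V W : Type*} [NormedAddCommGroup E] [NormedSpace ℝ E]
    [NormedAddCommGroup V] [NormedSpace ℝ V] [FiniteDimensional ℝ V]
    [NormedAddCommGroup W] [NormedSpace ℝ W] [FiniteDimensional ℝ W] {n : ℕ∞ω}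
    {A : E → V →L[ℝ] W} {X : E → V} {y : E} (hA : ContDiffAt ℝ n A y)
    (hinj : ∀ v, A y v = 0 → v = 0) (h : ContDiffAt ℝ n (fun z => A z (X z)) y) :
    ContDiffAt ℝ n X y := by
  have : CompleteSpace V := FiniteDimensional.complete ℝ V
  obtain ⟨B', hB'⟩ := (A y).toLinearMap.exists_leftInverse_of_injective
    (LinearMap.ker_eq_bot'.mpr hinj)
  let B : W →L[ℝ] V := LinearMap.toContinuousLinearMap B'
  have hB : B.comp (A y) = ((ContinuousLinearEquiv.refl ℝ V : V ≃L[ℝ] V) : V →L[ℝ] V) := by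
    ext v
    exact congrArg (fun L : V →ₗ[ℝ] V => L v) hB'
  have hBA : ContDiffAt ℝ n (fun z => B.comp (A z)) y := contDiffAt_const.clm_comp hA
  have hBA' : ContDiffAt ℝ n (fun z => (B.comp (A z)).inverse) y := by
    have h1 := contDiffAt_map_inverse (n := n) (ContinuousLinearEquiv.refl ℝ V)
    rw [← hB] at h1
    exact h1.comp y hBA
  have hX : ContDiffAt ℝ n (fun z => (B.comp (A z)).inverse (B (A z (X z)))) y :=
    hBA'.clm_apply (contDiffAt_const.clm_apply h)
  refine hX.congr_of_eventuallyEq ?_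
  have hev : ∀ᶠ z in 𝓝 y, B.comp (A z) ∈ Set.range ((↑) : (V ≃L[ℝ] V) → (V →L[ℝ] V)) :=
    hBA.continuousAt.eventually (ContinuousLinearEquiv.isOpen.mem_nhds ⟨_, hB.symm⟩)
  filter_upwards [hev] with z ⟨e, he⟩
  rw [show B (A z (X z)) = (B.comp (A z)) (X z) from rfl, ← he,
    ContinuousLinearMap.inverse_equiv]
  simp

end SmoothSolution

section VectorFields

variable {E M : Type*} [NormedAddCommGroup E] [NormedSpace ℝ E]
  [TopologicalSpace M] [ChartedSpace E M]

theorem fderiv_chartTrans_self {x : M} {y : E} (hy : y ∈ (chartAt E x).target) :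
    fderiv ℝ (chartTrans x x) y = ContinuousLinearMap.id ℝ E := by
  have h2 : chartTrans x x =ᶠ[𝓝 y] (id : E → E) := by
    filter_upwards [(chartAt E x).open_target.mem_nhds hy] with z hz
    exact (chartAt E x).right_inv hz
  rw [h2.fderiv_eq, fderiv_id]

variable [IsManifold 𝓘(ℝ, E) ∞ M]

theorem fderiv_chartTrans_inv {x x' : M} {y : E} (hy : y ∈ (chartAt E x).target)
    (hy' : (chartAt E x).symm y ∈ (chartAt E x').source) :
    (fderiv ℝ (chartTrans x' x) (chartTrans x x' y)).comp (fderiv ℝ (chartTrans x x') y) =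
      ContinuousLinearMap.id ℝ E := by
  rw [fderiv_chartTrans_comp hy hy' ((chartAt E x).map_target hy), fderiv_chartTrans_self hy]

theorem fderiv_chartTrans_inv' {x x' : M} {y : E} (hy : y ∈ (chartAt E x).target)
    (hy' : (chartAt E x).symm y ∈ (chartAt E x').source) :
    (fderiv ℝ (chartTrans x x') y).comp (fderiv ℝ (chartTrans x' x) (chartTrans x x' y)) =
      ContinuousLinearMap.id ℝ E := by
  have h := fderiv_chartTrans_inv (x := x') (x' := x) (chartTrans_mem hy')
    (by rw [symm_chartTrans hy']; exact (chartAt E x).map_target hy)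
  rwa [chartTrans_chartTrans hy', show chartTrans x x y = y from (chartAt E x).right_inv hy] at h

/-- The expression of a vector field in the preferred chart at `x`. -/
def vecRep (x : M) (X : M → E) (y : E) : E :=
  fderiv ℝ (chartTrans ((chartAt E x).symm y) x) (chartTrans x ((chartAt E x).symm y) y)
    (X ((chartAt E x).symm y))

theorem fderiv_vecRep (X : M → E) {x : M} {y : E} (hy : y ∈ (chartAt E x).target) :
    fderiv ℝ (chartTrans x ((chartAt E x).symm y)) y (vecRep x X y) = X ((chartAt E x).symm y) := by
  have h := fderiv_chartTrans_inv' (x' := (chartAt E x).symm y) hy (mem_chart_source E _)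
  exact congrArg (fun L => L (X ((chartAt E x).symm y))) h

/-- The trivialization of the tangent bundle at x is the derivative of a transition map, so near x
the section in this trivialization is `vecRep` read in the chart. -/
theorem contMDiff_section {X : ∀ x : M, TangentSpace 𝓘(ℝ, E) x}
    (h : ∀ x, ContDiffAt ℝ ∞ (vecRep x (fun p => (X p : E))) (chartAt E x x)) :
    ContMDiff 𝓘(ℝ, E) 𝓘(ℝ, E).tangent ∞ (fun x => (⟨x, X x⟩ : TangentBundle 𝓘(ℝ, E) M)) := by
  intro x
  refine (Bundle.contMDiffAt_section (IB := 𝓘(ℝ, E)) (F := E) (E := TangentSpace 𝓘(ℝ, E))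
    (s := X) x).mpr ?_
  have h1 : ContMDiffAt 𝓘(ℝ, E) 𝓘(ℝ, E) ∞
      (fun p => vecRep x (fun p => (X p : E)) (chartAt E x p)) x :=
    (h x).contMDiffAt.comp x (contMDiffAt_of_mem_maximalAtlas
      (IsManifold.chart_mem_maximalAtlas x) (mem_chart_source E x))
  refine h1.congr_of_eventuallyEq ?_
  filter_upwards [(chartAt E x).open_source.mem_nhds (mem_chart_source E x)] with p hp
  have h3 : vecRep x (fun p => (X p : E)) (chartAt E x p) =
      fderiv ℝ (chartTrans p x) (chartTrans x p (chartAt E x p)) (X p) := by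
    simp only [vecRep]
    rw [(chartAt E x).left_inv hp]
  rw [TangentBundle.trivializationAt_apply, h3]
  simp only [mfld_simps]
  rw [fderivWithin_univ]
  have h2 : chartTrans x p (chartAt E x p) = chartAt E p p :=
    congrArg (chartAt E p) ((chartAt E x).left_inv hp)
  rw [h2]
  rfl

variable {k l : ℕ}

theorem compContinuousLinearMap_curryLeft (α : E [⋀^Fin (k + 1)]→L[ℝ] ℝ) (A : E →L[ℝ] E) (v : E) :
    (α.compContinuousLinearMap A).curryLeft v = (α.curryLeft (A v)).compContinuousLinearMap A := by
  ext u
  simp only [ContinuousAlternatingMap.curryLeft_apply_apply,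
    ContinuousAlternatingMap.compContinuousLinearMap_apply]
  congr 1
  funext i
  refine Fin.cases ?_ (fun i => ?_) i <;> rfl

theorem compContinuousLinearMap_injective {A B : E →L[ℝ] E}
    (h : A.comp B = ContinuousLinearMap.id ℝ E) {α : E [⋀^Fin k]→L[ℝ] ℝ}
    (hα : α.compContinuousLinearMap A = 0) : α = 0 := by
  have h1 : (α.compContinuousLinearMap A).compContinuousLinearMap B = 0 := by rw [hα]; rfl
  have h2 : (α.compContinuousLinearMap A).compContinuousLinearMap B =
    α.compContinuousLinearMap (A.comp B) := rfl
  rw [h2, h] at h1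
  exact h1

theorem chartRep_curryLeft (X : M → E) (α : Form ℝ E M ℝ (k + 1)) {x : M} {y : E}
    (hy : y ∈ (chartAt E x).target) : chartRep x (fun p => (α p).curryLeft (X p)) y =
      (chartRep x α y).curryLeft (vecRep x X y) := by
  rw [chartRep_eq _ hy, chartRep_eq _ hy, compContinuousLinearMap_curryLeft, fderiv_vecRep X hy]

variable [FiniteDimensional ℝ E]

/-- A vector field `X` is smooth if `ι(X) α` is, for a smooth form `α` with `ι(v) α ≠ 0` for all
`v ≠ 0`. -/
theorem contMDiff_of_curryLeft {X : ∀ x : M, TangentSpace 𝓘(ℝ, E) x} {α : Form ℝ E M ℝ (k + 1)}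
    (hα : IsCn ∞ α) (hinj : ∀ x v, (α x).curryLeft v = 0 → v = 0)
    (h : IsCn ∞ (fun p => (α p).curryLeft (X p : E))) :
    ContMDiff 𝓘(ℝ, E) 𝓘(ℝ, E).tangent ∞ (fun x => (⟨x, X x⟩ : TangentBundle 𝓘(ℝ, E) M)) := by
  refine contMDiff_section fun x => ?_
  have hx := mem_chart_target E x
  have hfin : FiniteDimensional ℝ (E [⋀^Fin k]→L[ℝ] ℝ) := finiteDimensional_form k
  refine contDiffAt_of_clm_apply (A := fun z => (chartRep x α z).curryLeft) ?_ ?_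
    ((h.contDiffAt hx).congr_of_eventuallyEq ?_)
  · have hL : ContDiff ℝ ∞ (fun a : E [⋀^Fin (k + 1)]→L[ℝ] ℝ => a.curryLeft) :=
      LinearIsometry.contDiff (𝕜 := ℝ) (E := E [⋀^Fin (k + 1)]→L[ℝ] ℝ)
        (F := E →L[ℝ] E [⋀^Fin k]→L[ℝ] ℝ) ContinuousAlternatingMap.curryLeftLI
    exact (hL.contDiffAt (x := chartRep x α (chartAt E x x))).comp _ (hα.contDiffAt hx)
  · intro v hv
    rw [chartRep_self] at hv
    exact hinj x v hv
  · filter_upwards [(chartAt E x).open_target.mem_nhds hx] with z hz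
    exact (chartRep_curryLeft _ α hz).symm

/-- Division by a smooth form is smooth when it is unique. Injectivity is assumed on the fibres and
is carried to the chart expressions by the inverse of the transition map. -/
theorem isCn_of_wedge {α : Form ℝ E M ℝ k} {β : Form ℝ E M ℝ l} (hβ : IsCn ∞ β)
    (hinj : ∀ x α', wedge (k := k) α' (β x) = 0 → α' = 0)
    (h : IsCn ∞ (fun p => wedge (α p) (β p) : Form ℝ E M ℝ (k + l))) : IsCn ∞ α := by
  refine isCn_of_contDiffAt fun x y hy => ?_
  have hfin : FiniteDimensional ℝ (E [⋀^Fin k]→L[ℝ] ℝ) := finiteDimensional_form k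
  have hfin' : FiniteDimensional ℝ (E [⋀^Fin (k + l)]→L[ℝ] ℝ) := finiteDimensional_form _
  have h1 := h.contDiffAt hy
  rw [chartRep_wedge] at h1
  refine contDiffAt_of_clm_apply (A := fun z => (wedgeL E ℝ k l).flip (chartRep x β z)) ?_ ?_ h1
  · have hL : ContDiff ℝ ∞ (fun b => (wedgeL E ℝ k l).flip b) :=
      ContinuousLinearMap.contDiff (𝕜 := ℝ) (E := E [⋀^Fin l]→L[ℝ] ℝ)
        (F := (E [⋀^Fin k]→L[ℝ] ℝ) →L[ℝ] E [⋀^Fin (k + l)]→L[ℝ] ℝ) _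
    exact (hL.contDiffAt (x := chartRep x β y)).comp y (hβ.contDiffAt hy)
  · intro α' hα'
    have hα'' : wedge α' (chartRep x β y) = 0 := hα'
    have hinv := fderiv_chartTrans_inv (x' := (chartAt E x).symm y) hy (mem_chart_source E _)
    have hinv' := fderiv_chartTrans_inv' (x' := (chartAt E x).symm y) hy (mem_chart_source E _)
    set A := fderiv ℝ (chartTrans x ((chartAt E x).symm y)) y
    set B := fderiv ℝ (chartTrans ((chartAt E x).symm y) x) (chartTrans x ((chartAt E x).symm y) y)
    refine compContinuousLinearMap_injective (A := B) (B := A) hinv 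
      (hinj ((chartAt E x).symm y) _ ?_)
    have h2 : (chartRep x β y).compContinuousLinearMap B = β ((chartAt E x).symm y) := by
      rw [chartRep_eq β hy]
      change (β ((chartAt E x).symm y)).compContinuousLinearMap (A.comp B) = _
      rw [hinv']
      rfl
    rw [← h2, ← wedge_compContinuousLinearMap, hα'']
    rfl

end VectorFields

end GenCY

end

/-! ### `rot`, `rotDeriv` and d^c on a complex manifold. -/

noncomputable section

namespace GenCY

open Filter Topology

section LinearComp

variable {E : Type*} [NormedAddCommGroup E] [NormedSpace ℝ E]

theorem contDiffAt_linearMap_comp {V W : Type*} [NormedAddCommGroup V] [NormedSpace ℝ V]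
    [FiniteDimensional ℝ V] [NormedAddCommGroup W] [NormedSpace ℝ W] (L : V →ₗ[ℝ] W) {n : ℕ∞ω}
    {f : E → V} {y : E} (hf : ContDiffAt ℝ n f y) : ContDiffAt ℝ n (fun z => L (f z)) y :=
  ((LinearMap.toContinuousLinearMap L).contDiff.contDiffAt (x := f y)).comp y hf

theorem fderiv_linearMap_comp {V W : Type*} [NormedAddCommGroup V] [NormedSpace ℝ V]
    [FiniteDimensional ℝ V] [NormedAddCommGroup W] [NormedSpace ℝ W] (L : V →ₗ[ℝ] W)
    {f : E → V} {y : E} (hf : DifferentiableAt ℝ f y) (v : E) :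
    fderiv ℝ (fun z => L (f z)) y v = L (fderiv ℝ f y v) :=
  congrArg (fun D => D v)
    ((LinearMap.toContinuousLinearMap L).hasFDerivAt.comp y hf.hasFDerivAt).fderiv

end LinearComp

section RotNatural

variable {E : Type*} [NormedAddCommGroup E] [NormedSpace ℂ E]
variable {F : Type*} [NormedField F] [NormedAlgebra ℝ F] {k : ℕ}

theorem rot_compContinuousLinearMap (α : E [⋀^Fin k]→L[ℝ] F) (A : E →L[ℂ] E) :
    (rot α).compContinuousLinearMap (A.restrictScalars ℝ) =
      rot (α.compContinuousLinearMap (A.restrictScalars ℝ)) := by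
  ext v
  rw [rot_apply, ContinuousAlternatingMap.compContinuousLinearMap_apply, rot_apply,
    ContinuousAlternatingMap.compContinuousLinearMap_apply]
  congr 1
  funext i
  exact (A.map_smul Complex.I (v i)).symm

theorem rotDeriv_compContinuousLinearMap (α : E [⋀^Fin k]→L[ℝ] F) (A : E →L[ℂ] E) :
    (rotDeriv α).compContinuousLinearMap (A.restrictScalars ℝ) =
      rotDeriv (α.compContinuousLinearMap (A.restrictScalars ℝ)) := by
  cases k with
  | zero => rfl
  | succ k =>
    ext v
    simp only [rotDeriv, ContinuousAlternatingMap.compContinuousLinearMap_apply,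
      ContinuousAlternatingMap.alternatizeUncurryFin_apply]
    refine Finset.sum_congr rfl fun i _ => ?_
    congr 1
    simp only [ContinuousLinearMap.comp_apply, ContinuousAlternatingMap.curryLeft_apply_apply,
      ContinuousAlternatingMap.compContinuousLinearMap_apply]
    congr 1
    funext j
    refine Fin.cases ?_ (fun j => rfl) j
    exact (A.map_smul Complex.I (v i)).symm

theorem scaleArgs_neg_I (α : E [⋀^Fin k]→L[ℝ] ℂ) :
    scaleArgs (-Complex.I) α = (-1 : ℝ) ^ k • rot α := by
  have h : rot (scaleArgs (-Complex.I) α) = α := by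
    ext v
    rw [rot_apply]
    change α _ = α v
    congr 1
    funext i
    change -Complex.I • Complex.I • v i = v i
    rw [smul_smul]
    simp
  conv_rhs => rw [← h, rot_rot, smul_smul, ← mul_pow]
  simp

variable [FiniteDimensional ℝ F] [FiniteDimensional ℝ E]

variable (E F k) in
/-- `rot` as a linear map. -/
def rotₗ : (E [⋀^Fin k]→L[ℝ] F) →ₗ[ℝ] E [⋀^Fin k]→L[ℝ] F where
  toFun := rot
  map_add' := rot_add
  map_smul' := rot_smul

variable (E F k) in
/-- `rotDeriv` as a linear map. -/
def rotDerivₗ : (E [⋀^Fin k]→L[ℝ] F) →ₗ[ℝ] E [⋀^Fin k]→L[ℝ] F where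
  toFun := rotDeriv
  map_add' := rotDeriv_add
  map_smul' := rotDeriv_smul

theorem contDiffAt_rot {n : ℕ∞ω} {α : E → E [⋀^Fin k]→L[ℝ] F} {y : E} (h : ContDiffAt ℝ n α y) :
    ContDiffAt ℝ n (fun z => rot (α z)) y :=
  haveI := finiteDimensional_form (V := E) (F := F) k
  contDiffAt_linearMap_comp (rotₗ E F k) h

theorem contDiffAt_rotDeriv {n : ℕ∞ω} {α : E → E [⋀^Fin k]→L[ℝ] F} {y : E}
    (h : ContDiffAt ℝ n α y) : ContDiffAt ℝ n (fun z => rotDeriv (α z)) y :=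
  haveI := finiteDimensional_form (V := E) (F := F) k
  contDiffAt_linearMap_comp (rotDerivₗ E F k) h

/-- The commutator of the exterior derivative with the derivation defined by multiplication
by `i`. -/
theorem rotDeriv_extDeriv {α : E → E [⋀^Fin k]→L[ℝ] F} {y : E} (h : DifferentiableAt ℝ α y) :
    rotDeriv (extDeriv α y) = extDeriv (fun z => rotDeriv (α z)) y -
      (-1 : ℝ) ^ (k + 1) • rot (extDeriv (fun z => rot (α z)) y) := by
  have hfin := finiteDimensional_form (V := E) (F := F) k
  have b := Module.finBasis ℝ E
  have h1 : ∀ v, fderiv ℝ (fun z => rot (α z)) y v = rot (fderiv ℝ α y v) :=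
    fderiv_linearMap_comp (rotₗ E F k) h
  have h2 : ∀ v, fderiv ℝ (fun z => rotDeriv (α z)) y v = rotDeriv (fderiv ℝ α y v) :=
    fderiv_linearMap_comp (rotDerivₗ E F k) h
  have e1 : rotDeriv (extDeriv α y) = rotDerivₗ E F (k + 1) (extDeriv α y) := rfl
  have e2 : ∀ X : E [⋀^Fin (k + 1)]→L[ℝ] F, rot X = rotₗ E F (k + 1) X := fun _ => rfl
  rw [e1, e2, extDeriv_eq_sum b, extDeriv_eq_sum b, extDeriv_eq_sum b, map_sum, map_sum,
    Finset.smul_sum, ← Finset.sum_sub_distrib]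
  refine Finset.sum_congr rfl fun a _ => ?_
  -- On a term eᵃ ∧ ∂_aα the derivation also hits eᵃ. The extra term (eᵃ ∘ i) ∧ ∂_aα is, up to sign,
  -- the rotation of eᵃ ∧ rot(∂_aα).
  rw [h1, h2, ← e2, rot_cwedge (F := F), rot_rot, cwedge_smul, smul_smul, ← pow_add]
  change rotDeriv (cwedge _ _ : E [⋀^Fin (k + 1)]→L[ℝ] F) = _
  rw [rotDeriv_cwedge, Odd.neg_one_pow ⟨k, by ring⟩]
  module

end RotNatural

section EventuallyTarget

variable {E M : Type*} [NormedAddCommGroup E] [TopologicalSpace M] [ChartedSpace E M]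

theorem eventuallyEq_of_target {G : Type*} {x : M} {y : E} (hy : y ∈ (chartAt E x).target)
    {f g : E → G} (h : ∀ z ∈ (chartAt E x).target, f z = g z) : f =ᶠ[𝓝 y] g := by
  filter_upwards [(chartAt E x).open_target.mem_nhds hy] with z hz
  exact h z hz

end EventuallyTarget

section RotGlobal

variable {E M : Type*} [NormedAddCommGroup E] [NormedSpace ℂ E]
  [TopologicalSpace M] [ChartedSpace E M]
variable {F : Type*} [NormedField F] [NormedAlgebra ℝ F] {k : ℕ}

/-- The operator `d^c` on forms with arbitrary values. -/
def twistD (α : Form ℝ E M F k) : Form ℝ E M F (k + 1) :=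
  (-1 : ℝ) ^ (k + 1) • fun p => rot (extD (fun p => rot (α p)) p)

theorem dc_eq_twistD (α : Form ℝ E M ℂ k) : dc α = twistD α :=
  funext fun _ => scaleArgs_neg_I _

variable [IsManifold 𝓘(ℂ, E) ω M]

instance isManifold_complex_one : IsManifold 𝓘(ℂ, E) 1 M := IsManifold.of_le (n := ω) le_top

/-- Transition maps are holomorphic, so their derivatives commute with i; hence `rot` and `rotDeriv`
are compatible with charts. -/
theorem fderiv_chartTrans_restrictScalars {x x' : M} {y : E} (hy : y ∈ (chartAt E x).target)
    (hy' : (chartAt E x).symm y ∈ (chartAt E x').source) :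
    fderiv ℝ (chartTrans x x') y = (fderiv ℂ (chartTrans x x') y).restrictScalars ℝ :=
  ((contDiffAt_chartTrans ℂ 1 hy hy').differentiableAt one_ne_zero).fderiv_restrictScalars ℝ

theorem chartRep_toRealForm (Ω : Form ℂ E M ℂ k) {x : M} {y : E} (hy : y ∈ (chartAt E x).target) :
    chartRep x (toRealForm Ω) y = (chartRep x Ω y).restrictScalars ℝ := by
  rw [chartRep_eq _ hy, chartRep_eq _ hy,
    fderiv_chartTrans_restrictScalars hy (mem_chart_source E _)]
  rfl

theorem chartRep_rot (α : Form ℝ E M F k) {x : M} {y : E} (hy : y ∈ (chartAt E x).target) :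
    chartRep x (fun p => rot (α p)) y = rot (chartRep x α y) := by
  rw [chartRep_eq _ hy, chartRep_eq _ hy,
    fderiv_chartTrans_restrictScalars hy (mem_chart_source E _), rot_compContinuousLinearMap]

theorem chartRep_rotDeriv (α : Form ℝ E M F k) {x : M} {y : E} (hy : y ∈ (chartAt E x).target) :
    chartRep x (fun p => rotDeriv (α p)) y = rotDeriv (chartRep x α y) := by
  rw [chartRep_eq _ hy, chartRep_eq _ hy,
    fderiv_chartTrans_restrictScalars hy (mem_chart_source E _), rotDeriv_compContinuousLinearMap]

theorem isCn_toRealForm {Ω : Form ℂ E M ℂ k} (hΩ : IsHolomorphicForm Ω) :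
    IsCn ∞ (toRealForm Ω) := by
  refine isCn_of_contDiffAt fun x y hy => ?_
  have h1 : ContDiffAt ℂ ω (chartRep x Ω) y :=
    (hΩ x).contDiffAt ((chartAt E x).open_target.mem_nhds hy)
  have h2 : ContDiffAt ℝ ∞ (chartRep x Ω) y := (h1.restrict_scalars ℝ).of_le le_top
  have hL : ContDiff ℝ ∞ (fun a : E [⋀^Fin k]→L[ℂ] ℂ => a.restrictScalars ℝ) := by
    exact ContinuousLinearMap.contDiff (𝕜 := ℝ) (E := E [⋀^Fin k]→L[ℂ] ℂ) (F := E [⋀^Fin k]→L[ℝ] ℂ)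
      { toFun := fun a => a.restrictScalars ℝ
        map_add' := fun _ _ => rfl
        map_smul' := fun _ _ => rfl
        cont := ContinuousAlternatingMap.continuous_restrictScalars }
  exact ((hL.contDiffAt (x := chartRep x Ω y)).comp y h2).congr_of_eventuallyEq
    (eventuallyEq_of_target hy fun _ hz => chartRep_toRealForm Ω hz)

variable [FiniteDimensional ℂ E]

variable [FiniteDimensional ℝ F]

theorem IsCn.rot {α : Form ℝ E M F k} (hα : IsCn ∞ α) : IsCn ∞ (fun p => rot (α p)) :=
  isCn_of_contDiffAt fun _ _ hy => (contDiffAt_rot (hα.contDiffAt hy)).congr_of_eventuallyEq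
    (eventuallyEq_of_target hy fun _ hz => chartRep_rot α hz)

theorem IsCn.rotDeriv {α : Form ℝ E M F k} (hα : IsCn ∞ α) : IsCn ∞ (fun p => rotDeriv (α p)) :=
  isCn_of_contDiffAt fun _ _ hy => (contDiffAt_rotDeriv (hα.contDiffAt hy)).congr_of_eventuallyEq
    (eventuallyEq_of_target hy fun _ hz => chartRep_rotDeriv α hz)

/-- The flat commutator identity, read in the chart at each point. It converts the derivation part
of `J` into d^c. -/
theorem rotDeriv_extD {α : Form ℝ E M F k} (hα : IsCn ∞ α) :
    (fun p => rotDeriv (extD α p)) = extD (fun p => rotDeriv (α p)) - twistD α := by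
  funext p
  have hx := mem_chart_target E p
  have e1 := eventuallyEq_of_target hx fun _ hz => chartRep_rot α hz
  have e2 := eventuallyEq_of_target hx fun _ hz => chartRep_rotDeriv α hz
  rw [extD_apply, rotDeriv_extDeriv (hα.differentiableAt hx), Pi.sub_apply, extD_apply,
    e2.extDeriv_eq, twistD, Pi.smul_apply, extD_apply, e1.extDeriv_eq]

end RotGlobal

end GenCY

end

/-! ### The ∂∂̄-lemma in terms of d and d^c, for real forms. -/

noncomputable section

namespace GenCY

section TwistD

variable {E M : Type*} [NormedAddCommGroup E] [NormedSpace ℂ E]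
  [TopologicalSpace M] [ChartedSpace E M]
variable {F : Type*} [NormedField F] [NormedAlgebra ℝ F] {k : ℕ}

theorem twistD_eq_zero {α : Form ℝ E M F k} (h : extD (fun p => rot (α p)) = 0) :
    twistD α = 0 := by
  rw [twistD, h]
  funext p
  exact form_smul_zero _

theorem IsCn.complex_smul (c : ℂ) {α : Form ℝ E M ℂ k} (hα : IsCn ∞ α) : IsCn ∞ (c • α) :=
  IsCn.comp (c • ContinuousLinearMap.id ℝ ℂ) hα

variable [IsManifold 𝓘(ℂ, E) ω M]

theorem extD_complex_smul (c : ℂ) {α : Form ℝ E M ℂ k} (hα : IsCn ∞ α) :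
    extD (c • α) = c • extD α :=
  extD_comp (c • ContinuousLinearMap.id ℝ ℂ) hα

/-- ∂ and ∂̄ are combinations of d and d^c; dβ is closed, and d^c dβ is up to sign the rotation of d
rot dβ. -/
theorem del_extD_eq_zero {β : Form ℝ E M ℂ k} (hβ : IsCn ∞ β)
    (h : extD (fun p => rot (extD β p)) = 0) : del (extD β) = 0 ∧ delbar (extD β) = 0 := by
  rw [del, delbar, dc_eq_twistD, extD_extD hβ, twistD_eq_zero h]
  simp

variable [FiniteDimensional ℂ E]

theorem twistD_comp (L : ℂ →L[ℝ] F) {α : Form ℝ E M ℂ k} (hα : IsCn ∞ α) :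
    twistD (fun p => L.compContinuousAlternatingMap (α p)) =
      fun p => L.compContinuousAlternatingMap (twistD α p) := by
  have h : extD (fun p => rot (L.compContinuousAlternatingMap (α p))) =
      fun p => L.compContinuousAlternatingMap (extD (fun p => rot (α p)) p) :=
    extD_comp L hα.rot
  rw [twistD, h]
  funext p
  ext v
  exact (L.map_smul _ _).symm

variable [FiniteDimensional ℝ F]

theorem IsCn.twistD {α : Form ℝ E M F k} (hα : IsCn ∞ α) : IsCn ∞ (twistD α) :=
  hα.rot.extD.rot.smul _

theorem extD_twistD {α : Form ℝ E M F k} (hα : IsCn ∞ α) :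
    extD (twistD α) = -extD (fun p => rotDeriv (extD α p)) := by
  rw [rotDeriv_extD hα, extD_sub hα.rotDeriv.extD hα.twistD, extD_extD hα.rotDeriv, zero_sub,
    neg_neg]

/-- The commutator identity for dα, in which ddα = 0, combined with the derivative of the identity
for α. -/
theorem twistD_extD {α : Form ℝ E M F k} (hα : IsCn ∞ α) :
    twistD (extD α) = -extD (twistD α) := by
  have h := rotDeriv_extD hα.extD
  rw [extD_extD hα] at h
  have h0 : (fun p => rotDeriv ((0 : Form ℝ E M F (k + 1 + 1)) p)) = 0 := by
    funext p
    exact (rotDerivₗ E F (k + 1 + 1)).map_zero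
  rw [h0] at h
  rw [extD_twistD hα, neg_neg]
  exact (sub_eq_zero.mp h.symm).symm

theorem twistD_twistD {α : Form ℝ E M F k} (hα : IsCn ∞ α) : twistD (twistD α) = 0 := by
  have h1 : (fun p => rot (twistD α p)) = extD (fun p => rot (α p)) := by
    funext p
    change rot ((-1 : ℝ) ^ (k + 1) • rot (extD (fun p => rot (α p)) p)) = _
    rw [rot_smul, rot_rot, smul_smul, ← mul_pow]
    simp
  rw [twistD, h1, extD_extD hα.rot]
  funext p
  exact form_smul_zero _

theorem twistD_complex_smul (c : ℂ) {α : Form ℝ E M ℂ k} (hα : IsCn ∞ α) :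
    twistD (c • α) = c • twistD α :=
  twistD_comp (c • ContinuousLinearMap.id ℝ ℂ) hα

theorem twistD_sub {α β : Form ℝ E M F k} (hα : IsCn ∞ α) (hβ : IsCn ∞ β) :
    twistD (α - β) = twistD α - twistD β := by
  have h : (fun p => rot ((α - β) p)) = (fun p => rot (α p)) - fun p => rot (β p) := rfl
  rw [twistD, h, extD_sub hα.rot hβ.rot, twistD, twistD, ← smul_sub]
  rfl

/-- In ¼(d + i d^c)(d - i d^c) the squares vanish and the mixed terms add up, as d and d^c
anticommute. -/
theorem del_delbar {γ : Form ℝ E M ℂ k} (hγ : IsCn ∞ γ) :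
    del (delbar γ) = (-(Complex.I / 2)) • extD (twistD γ) := by
  have h1 : delbar γ = (1 / 2 : ℂ) • (extD γ - Complex.I • twistD γ) := by
    rw [delbar, dc_eq_twistD]
  have h2 := hγ.extD.sub (hγ.twistD.complex_smul Complex.I)
  rw [del, dc_eq_twistD, h1, extD_complex_smul _ h2, twistD_complex_smul _ h2,
    extD_sub hγ.extD (hγ.twistD.complex_smul _), twistD_sub hγ.extD (hγ.twistD.complex_smul _),
    extD_complex_smul _ hγ.twistD, twistD_complex_smul _ hγ.twistD, extD_extD hγ,
    twistD_twistD hγ, twistD_extD hγ]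
  module

theorem extD_rot_extD_ofRealForm {τ : Form ℝ E M ℝ k} (hτ : IsCn ∞ τ)
    (h : extD (fun p => rot (extD τ p)) = 0) :
    extD (fun p => rot (extD (fun p => ofRealForm (τ p)) p)) = 0 := by
  have h1 : extD (fun p => ofRealForm (τ p)) = fun p => ofRealForm (extD τ p) :=
    extD_comp Complex.ofRealCLM hτ
  have h2 : extD (fun p => ofRealForm (rot (extD τ p))) =
    fun p => ofRealForm (extD (fun p => rot (extD τ p)) p) := extD_comp Complex.ofRealCLM hτ.extD.rot
  rw [h1]
  refine h2.trans ?_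
  rw [h]
  funext p
  ext v
  simp [ofRealForm]

/-- The `∂∂̄`-lemma for real forms: `dd^c`-exactness. -/
theorem DelDelbarLemma.exists_extD_twistD (hM : DelDelbarLemma E M) {τ : Form ℝ E M ℝ (k + 1)}
    (hτ : IsCn ∞ τ) (h : extD (fun p => rot (extD τ p)) = 0) :
    ∃ ν : Form ℝ E M ℝ k, IsCn ∞ ν ∧ extD τ = extD (twistD ν) := by
  have hβ : IsCn ∞ (fun p => ofRealForm (τ p)) := hτ.comp Complex.ofRealCLM
  have h1 := del_extD_eq_zero hβ (extD_rot_extD_ofRealForm hτ h)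
  obtain ⟨γ, hγ, h2⟩ := hM.2 k _ hβ h1.1 h1.2
  -- Since ∂∂̄γ = -(i/2) dd^c γ, its real part is dd^c of ½ Im γ.
  have hν : IsCn ∞ (fun p => ((1 / 2 : ℝ) • Complex.imCLM).compContinuousAlternatingMap (γ p)) :=
    hγ.comp _
  refine ⟨_, hν, ?_⟩
  have h3 : extD (fun p => ofRealForm (τ p)) = fun p => ofRealForm (extD τ p) :=
    extD_comp Complex.ofRealCLM hτ
  rw [twistD_comp _ hγ, extD_comp _ hγ.twistD]
  rw [h3, del_delbar hγ] at h2
  funext p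
  have h4 := congrArg reForm (congrFun h2 p)
  rw [reForm_ofRealForm] at h4
  rw [h4]
  ext v
  simp [reForm]

theorem DelDelbarLemma.extD_eq_zero (hM : DelDelbarLemma E M) {τ : Form ℝ E M ℝ 0}
    (hτ : IsCn ∞ τ) (h : extD (fun p => rot (extD τ p)) = 0) : extD τ = 0 := by
  have hβ : IsCn ∞ (fun p => ofRealForm (τ p)) := hτ.comp Complex.ofRealCLM
  have h1 := del_extD_eq_zero hβ (extD_rot_extD_ofRealForm hτ h)
  have h2 := hM.1 _ hβ h1.1 h1.2
  have h3 : extD (fun p => ofRealForm (τ p)) = fun p => ofRealForm (extD τ p) :=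
    extD_comp Complex.ofRealCLM hτ
  rw [h3] at h2
  funext p
  have h4 := congrArg reForm (congrFun h2 p)
  rwa [reForm_ofRealForm] at h4

/-- In even degree d^c = -rot d rot, so d(`rotDeriv` dτ) = -dd^c τ = d rot d(rot τ), and the two
terms of the hypothesis combine into one for τ + rot τ. -/
theorem extD_rot_extD_add_rot {τ : Form ℝ E M ℝ k} (hτ : IsCn ∞ τ) (hk : Even k)
    (h : extD (fun p => rotDeriv (extD τ p) + rot (extD τ p)) = 0) :
    extD (fun p => rot (extD (fun p => τ p + rot (τ p)) p)) = 0 := by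
  have h1 : extD (fun p => τ p + rot (τ p)) = extD τ + extD (fun p => rot (τ p)) :=
    extD_add hτ hτ.rot
  have h2 := extD_add hτ.extD.rotDeriv hτ.extD.rot
  have h3 := extD_add hτ.extD.rot hτ.rot.extD.rot
  have e2 : ((fun p => rotDeriv (extD τ p)) + fun p => rot (extD τ p)) =
    fun p => rotDeriv (extD τ p) + rot (extD τ p) := rfl
  have e3 : ((fun p => rot (extD τ p)) + fun p => rot (extD (fun p => rot (τ p)) p)) =
    fun p => rot ((extD τ + extD (fun p => rot (τ p))) p) := rfl
  rw [e2] at h2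
  rw [e3] at h3
  have h4 := extD_twistD hτ
  rw [twistD, hk.add_one.neg_one_pow, extD_smul, neg_one_smul, neg_inj] at h4
  rw [h1, h3, h4]
  exact (add_comm _ _).trans (h2.symm.trans h)

/-- On an even form `τ` with `dJdτ = 0`, the exterior derivative is that of a form in
the `-1`-eigenspace of `rot`. -/
theorem DelDelbarLemma.exists_rot_eq_neg (hM : DelDelbarLemma E M) {τ : Form ℝ E M ℝ (k + 1)}
    (hτ : IsCn ∞ τ) (hk : Even (k + 1))
    (h : extD (fun p => rotDeriv (extD τ p) + rot (extD τ p)) = 0) :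
    ∃ η : Form ℝ E M ℝ (k + 1), IsCn ∞ η ∧ extD τ = extD η ∧ ∀ p, rot (η p) = -η p := by
  have hτ' : IsCn ∞ (fun p => τ p + rot (τ p)) := hτ.add hτ.rot
  obtain ⟨ν, hν, h1⟩ := hM.exists_extD_twistD hτ' (extD_rot_extD_add_rot hτ hk h)
  have hζ := hν.twistD
  have h2 : extD (fun p => τ p + rot (τ p)) = extD τ + extD (fun p => rot (τ p)) :=
    extD_add hτ hτ.rot
  have hrr : ∀ α : E [⋀^Fin (k + 1)]→L[ℝ] ℝ, rot (rot α) = α := fun α => by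
    rw [rot_rot, hk.neg_one_pow, one_smul]
  have h3 : (fun p => rot (twistD ν p)) = extD (fun p => rot (ν p)) := by
    funext p
    change rot ((-1 : ℝ) ^ (k + 1) • rot (extD (fun p => rot (ν p)) p)) = _
    rw [hk.neg_one_pow, one_smul, hrr]
  have h4 : extD (fun p => rot (twistD ν p)) = 0 := by rw [h3, extD_extD hν.rot]
  -- The derivatives of τ - rot τ and of d^c ν, the latter being d(τ + rot τ), add up to 2dτ.
  -- Subtracting rot d^c ν = d rot ν, which is closed, makes the form anti-invariant without
  -- changing its derivative.
  refine ⟨(1 / 2 : ℝ) • ((τ - fun p => rot (τ p)) + (twistD ν - fun p => rot (twistD ν p))),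
    ((hτ.sub hτ.rot).add (hζ.sub hζ.rot)).smul _, ?_, fun p => ?_⟩
  · rw [extD_smul, extD_add (hτ.sub hτ.rot) (hζ.sub hζ.rot), extD_sub hτ hτ.rot,
      extD_sub hζ hζ.rot, h4, ← h1, h2]
    module
  · change rot ((1 / 2 : ℝ) • ((τ p - rot (τ p)) + (twistD ν p - rot (twistD ν p)))) = _
    rw [rot_smul, rot_add, rot_sub, rot_sub, hrr, hrr]
    change _ = -((1 / 2 : ℝ) • ((τ p - rot (τ p)) + (twistD ν p - rot (twistD ν p))))
    module

end TwistD

end GenCY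

end

/-! ### The dd^J-lemma for a holomorphic volume form. -/

noncomputable section

namespace GenCY

section InfAction

variable {E M : Type*} [NormedAddCommGroup E] [NormedSpace ℝ E]

theorem infAction_zero (X : M → E) (ξ : Form ℝ E M ℝ 1) (φ : MixedForm E M ℂ) :
    infAction X ξ φ 0 = fun x => (reForm (φ 1 x)).curryLeft (X x) := rfl

theorem infAction_succ (X : M → E) (ξ : Form ℝ E M ℝ 1) (φ : MixedForm E M ℂ) (k : ℕ) :
    infAction X ξ φ (k + 1) = fun x => (reForm (φ (k + 2) x)).curryLeft (X x) +
      cwedge (toCovector (ξ x)) (reForm (φ k x)) := rfl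

end InfAction

section CaseHolomorphic

variable {E M : Type*} [NormedAddCommGroup E] [NormedSpace ℂ E]
variable {Ω : Form ℂ E M ℂ 3}

theorem ofDegree_toRealForm (Ω : Form ℂ E M ℂ 3) (x : M) :
    (fun j => ofDegree (toRealForm Ω) j x) = holSpinor (Ω x) := by
  funext j
  by_cases h : j = 3
  · subst h
    rw [ofDegree, Pi.single_eq_same, holSpinor_three]
    rfl
  · rw [ofDegree, Pi.single_eq_of_ne h, holSpinor_of_ne _ h]
    rfl

theorem reForm_ofDegree (Ω : Form ℂ E M ℂ 3) (x : M) (j : ℕ) :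
    reForm (ofDegree (toRealForm Ω) j x) = holRe (Ω x) j :=
  congrArg (fun φ : Spinor E ℂ => reForm (φ j)) (ofDegree_toRealForm Ω x)

theorem infAction_ofDegree_two (Ω : Form ℂ E M ℂ 3) (X : M → E) (ξ : Form ℝ E M ℝ 1) :
    infAction X ξ (ofDegree (toRealForm Ω)) 2 = fun x => (holRe (Ω x) 3).curryLeft (X x) := by
  funext x
  rw [infAction_succ]
  beta_reduce
  rw [reForm_ofDegree, reForm_ofDegree, holRe_of_ne _ (show 1 ≠ 3 by norm_num), cwedge_zero]
  exact add_zero _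

theorem infAction_ofDegree_four (Ω : Form ℂ E M ℂ 3) (X : M → E) (ξ : Form ℝ E M ℝ 1) :
    infAction X ξ (ofDegree (toRealForm Ω)) 4 =
      fun x => cwedge (toCovector (ξ x)) (holRe (Ω x) 3) := by
  funext x
  rw [infAction_succ]
  beta_reduce
  rw [reForm_ofDegree, reForm_ofDegree, holRe_of_ne _ (show 5 ≠ 3 by norm_num), form_zero_apply]
  exact zero_add _

theorem infAction_ofDegree_of_ne (Ω : Form ℂ E M ℂ 3) (X : M → E) (ξ : Form ℝ E M ℝ 1) (k : ℕ)
    (h2 : k ≠ 2) (h4 : k ≠ 4) : infAction X ξ (ofDegree (toRealForm Ω)) k = 0 := by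
  funext x
  cases k with
  | zero =>
    rw [infAction_zero]
    beta_reduce
    rw [reForm_ofDegree, holRe_of_ne _ (by norm_num), form_zero_apply]
    rfl
  | succ k =>
    rw [infAction_succ]
    beta_reduce
    rw [reForm_ofDegree, reForm_ofDegree, holRe_of_ne _ (by omega), holRe_of_ne _ (by omega),
      form_zero_apply, cwedge_zero]
    exact add_zero _

variable [FiniteDimensional ℂ E] [Fact (Module.finrank ℂ E = 3)]

theorem opJ_ofDegree (hΩ : ∀ x, Ω x ≠ 0) {σ : MixedForm E M ℝ} (hσ : HasParity 1 σ) (k : ℕ) :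
    opJ (ofDegree (toRealForm Ω)) σ k =
      (-(1 / 2) : ℝ) • fun x => rotDeriv (σ k x) + rot (σ k x) := by
  funext x
  have h := cplxStr_holSpinor (hΩ x) (σ := fun j => σ j x)
    (fun j hj => congrFun (hσ j (by omega)) x) k
  rw [← ofDegree_toRealForm Ω x] at h
  rw [opJ, ← funext (reForm_ofDegree Ω x)] at *
  exact h

theorem hasParity_mixedD {E M F : Type*} [NormedAddCommGroup E] [NormedSpace ℝ E]
    [NormedAddCommGroup F] [NormedSpace ℝ F] [TopologicalSpace M] [ChartedSpace E M]
    [IsManifold 𝓘(ℝ, E) ∞ M] {p : ℕ} {τ : MixedForm E M F} (hτ : HasParity p τ) :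
    HasParity (p + 1) (mixedD τ) := by
  intro k hk
  cases k with
  | zero => rfl
  | succ k =>
    have h : τ k = 0 := hτ k (by omega)
    rw [mixedD, h, extD_zero]

variable [TopologicalSpace M] [ChartedSpace E M] [IsManifold 𝓘(ℂ, E) ω M]

omit [FiniteDimensional ℂ E] [Fact (Module.finrank ℂ E = 3)] in
theorem isCn_reForm_toRealForm (hΩ : IsHolomorphicForm Ω) :
    IsCn ∞ (fun x => holRe (Ω x) 3) := by
  have h : IsCn ∞ (fun x => reForm (toRealForm Ω x)) := (isCn_toRealForm hΩ).comp Complex.reCLM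
  have e : (fun x => holRe (Ω x) 3) = fun x => reForm (toRealForm Ω x) := by
    funext x
    rw [holRe, holSpinor_three]
    rfl
  rwa [e]

/-- The vector exists at each point and is unique there, so the pointwise choices form a smooth
field. -/
theorem exists_curryLeft_holRe (hΩ : IsHolomorphicForm Ω) (hΩ0 : ∀ x, Ω x ≠ 0)
    {η : Form ℝ E M ℝ 2} (hη : IsCn ∞ η) (hrot : ∀ x, rot (η x) = -η x) :
    ∃ X : ∀ x : M, TangentSpace 𝓘(ℝ, E) x, ContMDiff 𝓘(ℝ, E) 𝓘(ℝ, E).tangent ∞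
      (fun x => (⟨x, X x⟩ : TangentBundle 𝓘(ℝ, E) M)) ∧
      ∀ x, (holRe (Ω x) 3).curryLeft (X x : E) = η x := by
  choose X hX using fun x => exists_curryLeft_eq_of_rot_eq_neg (hΩ0 x) (hrot x)
  refine ⟨X, ?_, fun x => (hX x).symm⟩
  refine contMDiff_of_curryLeft (isCn_reForm_toRealForm hΩ)
    (fun x v hv => eq_zero_of_curryLeft_holRe_eq_zero (hΩ0 x) hv) ?_
  rwa [← funext hX]

theorem exists_cwedge_holRe (hΩ : IsHolomorphicForm Ω) (hΩ0 : ∀ x, Ω x ≠ 0)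
    {η : Form ℝ E M ℝ 4} (hη : IsCn ∞ η) (hrot : ∀ x, rot (η x) = -η x) :
    ∃ ξ : Form ℝ E M ℝ 1, IsCn ∞ ξ ∧ ∀ x, cwedge (toCovector (ξ x)) (holRe (Ω x) 3) = η x := by
  choose ξ hξ using fun x => exists_cwedge_eq_of_rot_eq_neg (hΩ0 x) (hrot x)
  refine ⟨fun x => cwedge (ξ x) (oneForm E ℝ), ?_, fun x => by rw [toCovector_cwedge, ← hξ x]⟩
  have hw : ∀ (α : E [⋀^Fin 1]→L[ℝ] ℝ) x, wedge α (holRe (Ω x) 3) =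
      castDeg (Nat.add_comm 3 1) (cwedge (toCovector α) (holRe (Ω x) 3)) := fun α x => by
    rw [← wedge_one_form, castDeg_castDeg, castDeg_rfl]
  refine isCn_of_wedge (isCn_reForm_toRealForm hΩ) (fun x α hα => ?_) ?_
  · have h1 := congrArg (castDeg (Nat.add_comm 1 3)) hα
    rw [wedge_one_form] at h1
    have h2 := eq_zero_of_cwedge_holRe_eq_zero (hΩ0 x) h1
    rw [← cwedge_toCovector α, h2]
    exact LinearMap.map_zero₂ (cwedgeₗ _) _
  · have e : (fun p => wedge (cwedge (ξ p) (oneForm E ℝ)) (holRe (Ω p) 3)) =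
        fun p => castDeg (Nat.add_comm 3 1) (η p) := by
      funext p
      rw [hw, toCovector_cwedge, ← hξ p]
    rw [e]
    exact hη.castDeg _

/-- The formula for `J` turns the hypothesis into d(D + C)dτ = 0 in each degree separately. As ρ has
degree 3, the field X serves degree 2 and the covector field ξ serves degree 4, independently of
each other. -/
theorem ddjLemma_holomorphic (hΩ : IsHolomorphicForm Ω) (hΩ0 : ∀ x, Ω x ≠ 0)
    (hM : DelDelbarLemma E M) : DDJLemma 1 (ofDegree (toRealForm Ω)) := by
  intro τ hpar hτ hd
  have hodd : HasParity 1 (mixedD τ) := by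
    have h := hasParity_mixedD hpar
    intro k hk
    exact h k (by omega)
  have key : ∀ k, extD (fun p => rotDeriv (extD (τ k) p) + rot (extD (τ k) p)) = 0 := by
    intro k
    have h : extD (opJ (ofDegree (toRealForm Ω)) (mixedD τ) (k + 1)) = 0 := congrFun hd (k + 2)
    rw [opJ_ofDegree hΩ0 hodd, extD_smul] at h
    exact (smul_eq_zero.mp h).resolve_left (by norm_num)
  -- On functions rotation is trivial, so τ₀ + rot τ₀ = 2τ₀ and the ∂∂̄-lemma for 1-forms applies.
  have h0 : extD (τ 0) = 0 := by
    have h1 := extD_rot_extD_add_rot (hτ 0) Even.zero (key 0)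
    have h2 : (fun p => τ 0 p + rot (τ 0 p)) = (2 : ℝ) • τ 0 := by
      funext p
      have h3 : rot (τ 0 p) = τ 0 p := rot_of_degree_zero _
      rw [h3, Pi.smul_apply, two_smul]
    rw [h2] at h1
    have h4 := hM.extD_eq_zero ((hτ 0).smul 2) h1
    rw [extD_smul] at h4
    exact (smul_eq_zero.mp h4).resolve_left two_ne_zero
  obtain ⟨η₂, hη₂, h2, hr2⟩ := hM.exists_rot_eq_neg (hτ 2) (by decide) (key 2)
  obtain ⟨η₄, hη₄, h4, hr4⟩ := hM.exists_rot_eq_neg (hτ 4) (by decide) (key 4)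
  obtain ⟨X, hX, hXη⟩ := exists_curryLeft_holRe hΩ hΩ0 hη₂ hr2
  obtain ⟨ξ, hξ, hξη⟩ := exists_cwedge_holRe hΩ hΩ0 hη₄ hr4
  refine ⟨X, ξ, hX, hξ, ?_⟩
  have hI := infAction_ofDegree_of_ne Ω (fun x => (X x : E)) ξ
  have hI2 : infAction (fun x => (X x : E)) ξ (ofDegree (toRealForm Ω)) 2 = η₂ :=
    (infAction_ofDegree_two Ω _ ξ).trans (funext hXη)
  have hI4 : infAction (fun x => (X x : E)) ξ (ofDegree (toRealForm Ω)) 4 = η₄ :=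
    (infAction_ofDegree_four Ω _ ξ).trans (funext hξη)
  funext k
  cases k with
  | zero => rfl
  | succ k =>
    change extD (τ k) = extD _
    by_cases hk2 : k = 2
    · subst hk2
      rw [hI2, h2]
    by_cases hk4 : k = 4
    · subst hk4
      rw [hI4, h4]
    rw [hI k hk2 hk4, extD_zero]
    rcases Nat.lt_or_ge 5 k with h | h
    · funext x
      exact form_eq_zero (by omega) _
    by_cases hk : k % 2 = 1
    · rw [hpar k (by omega), extD_zero]
    · obtain rfl : k = 0 := by omega
      exact h0

end CaseHolomorphic

end GenCY

end

/-! ### Stokes' theorem in a vector space. -/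

noncomputable section

namespace GenCY

open Filter Topology MeasureTheory

section FlatStokes

variable {E : Type*} [NormedAddCommGroup E] [NormedSpace ℝ E] [FiniteDimensional ℝ E]
  [MeasurableSpace E] [BorelSpace E] (μ : Measure E) [μ.IsAddHaarMeasure]

/-- Integration by parts against the constant function 1. -/
theorem integral_fderiv_apply_eq_zero {g : E → ℝ} (hg : ContDiff ℝ 1 g) (hs : HasCompactSupport g)
    (v : E) : ∫ x, fderiv ℝ g x v ∂μ = 0 := by
  have h1 : Continuous fun x => fderiv ℝ g x v :=
    (hg.continuous_fderiv one_ne_zero).clm_apply continuous_const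
  have h2 : Integrable (fun x => fderiv ℝ g x v) μ :=
    h1.integrable_of_hasCompactSupport (hs.fderiv_apply ℝ v)
  have h3 : Integrable g μ := hg.continuous.integrable_of_hasCompactSupport hs
  have h := integral_mul_fderiv_eq_neg_fderiv_mul_of_integrable (μ := μ) (f := fun _ : E => (1 : ℝ))
    (g := g) (v := v) (by simp) (by simpa using h2) (by simpa using h3)
    (fun _ _ => differentiableAt_const _) (fun x _ => hg.differentiable one_ne_zero x)
  simpa using h

theorem integral_extDeriv_eq_zero {n : ℕ} {η : E → E [⋀^Fin n]→L[ℝ] ℝ} (hη : ContDiff ℝ 1 η)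
    (hs : HasCompactSupport η) (v : Fin (n + 1) → E) : ∫ y, extDeriv η y v ∂μ = 0 := by
  have happ : ∀ u : Fin n → E, ContDiff ℝ 1 fun y => η y u := fun u =>
    ((ContinuousAlternatingMap.apply ℝ E ℝ u).contDiff).comp hη
  have hsupp : ∀ u : Fin n → E, HasCompactSupport fun y => η y u := fun u =>
    hs.comp_left (g := fun α : E [⋀^Fin n]→L[ℝ] ℝ => α u) rfl
  have h1 : ∀ y, extDeriv η y v = ∑ i : Fin (n + 1),
      (-1 : ℤ) ^ (i : ℕ) • fderiv ℝ (fun y => η y (i.removeNth v)) y (v i) := fun y =>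
    extDeriv_apply (hη.differentiable one_ne_zero y) v
  have hint : ∀ i : Fin (n + 1), Integrable
      (fun y => fderiv ℝ (fun y => η y (i.removeNth v)) y (v i)) μ := fun i =>
    (((happ _).continuous_fderiv one_ne_zero).clm_apply
      continuous_const).integrable_of_hasCompactSupport ((hsupp _).fderiv_apply ℝ (v i))
  simp only [h1]
  simp only [zsmul_eq_mul]
  rw [integral_finsetSum _ fun i _ => (hint i).const_mul _]
  refine Finset.sum_eq_zero fun i _ => ?_
  rw [integral_const_mul, integral_fderiv_apply_eq_zero μ (happ _) (hsupp _), mul_zero]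

/-- Stokes' theorem on an open set with a locally constant sign. -/
theorem integral_sign_mul_extDeriv_eq_zero {n : ℕ} {U K : Set E} (hU : IsOpen U) (hK : IsCompact K)
    (hKU : K ⊆ U) {η : E → E [⋀^Fin n]→L[ℝ] ℝ} (hη : ∀ y ∈ U, ContDiffAt ℝ 1 η y)
    (hη0 : ∀ y ∈ U, y ∉ K → η y = 0) {r : E → ℝ} (hr : ContinuousOn r U) (hr0 : ∀ y ∈ U, r y ≠ 0)
    (v : Fin (n + 1) → E) :
    ∫ y in U, (SignType.sign (r y) : ℝ) * extDeriv η y v ∂μ = 0 := by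
  classical
  -- ζ is the signed form extended by zero. The sign is locally constant on U and η vanishes on U
  -- off the compact set K, so ζ is C¹ on the whole space.
  let ζ : E → E [⋀^Fin n]→L[ℝ] ℝ := fun y => if y ∈ U then (SignType.sign (r y) : ℝ) • η y else 0
  have hin : ∀ y ∈ U, ζ =ᶠ[𝓝 y] (SignType.sign (r y) : ℝ) • η := by
    intro y hy
    have h1 : ∀ᶠ z in 𝓝 y, SignType.sign (r z) = SignType.sign (r y) :=
      ((continuousAt_sign_of_ne_zero (hr0 y hy)).comp
        (hr.continuousAt (hU.mem_nhds hy))).eventually (f := SignType.sign ∘ r)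
          ((isOpen_discrete {SignType.sign (r y)}).mem_nhds rfl)
    filter_upwards [hU.mem_nhds hy, h1] with z hz hz'
    simp only [ζ, if_pos hz, hz', Pi.smul_apply]
  have hzero : ∀ y ∉ K, ζ y = 0 := by
    intro y hy
    by_cases hyU : y ∈ U
    · simp only [ζ, if_pos hyU, hη0 y hyU hy]
      exact form_smul_zero _
    · simp only [ζ, if_neg hyU]
  have hout : ∀ y ∉ K, ζ =ᶠ[𝓝 y] fun _ => 0 := by
    intro y hy
    filter_upwards [hK.isClosed.isOpen_compl.mem_nhds hy] with z hz
    exact hzero z hz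
  have hζ : ContDiff ℝ 1 ζ := by
    rw [contDiff_iff_contDiffAt]
    intro y
    by_cases hy : y ∈ U
    · exact ((hη y hy).const_smul (SignType.sign (r y) : ℝ)).congr_of_eventuallyEq (hin y hy)
    · exact contDiffAt_const.congr_of_eventuallyEq (hout y fun h => hy (hKU h))
  have hs : HasCompactSupport ζ := HasCompactSupport.intro hK hzero
  rw [← integral_extDeriv_eq_zero μ hζ hs v, ← setIntegral_eq_integral_of_forall_compl_eq_zero
    (s := U) (f := fun y => extDeriv ζ y v)]
  · refine setIntegral_congr_fun hU.measurableSet fun y hy => ?_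
    rw [(hin y hy).extDeriv_eq, extDeriv_smul]
    rfl
  · intro y hy
    rw [(hout y fun h => hy (hKU h)).extDeriv_eq]
    have h0 : extDeriv (fun _ : E => (0 : E [⋀^Fin n]→L[ℝ] ℝ)) y = 0 := by
      have h := extDeriv_smul (x := y) (0 : ℝ) (fun _ : E => (0 : E [⋀^Fin n]→L[ℝ] ℝ))
      rw [zero_smul, zero_smul] at h
      exact h
    rw [h0]
    rfl

end FlatStokes

section TopForms

variable {E : Type*} [NormedAddCommGroup E] [NormedSpace ℝ E]
  {ι : ℕ} (b : Module.Basis (Fin ι) ℝ E)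

theorem compContinuousLinearMap_basis (α : E [⋀^Fin ι]→L[ℝ] ℝ) (A : E →L[ℝ] E) :
    α.compContinuousLinearMap A b = A.det * α b := by
  have h := b.det_comp (A : E →ₗ[ℝ] E) b
  have h2 := congrArg (fun f : E [⋀^Fin ι]→ₗ[ℝ] ℝ => f (A ∘ b))
    (AlternatingMap.eq_smul_basis_det b α.toAlternatingMap)
  rw [b.det_self, mul_one] at h
  refine h2.trans ?_
  change α b * b.det ((A : E →ₗ[ℝ] E) ∘ b) = _
  rw [h, mul_comm]

end TopForms

end GenCY

end

/-! ### Integration of top forms, oriented by a volume form. -/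

noncomputable section

namespace GenCY

open Filter Topology MeasureTheory

section ChartIntegral

variable {E M : Type*} [NormedAddCommGroup E] [NormedSpace ℝ E] [FiniteDimensional ℝ E]
  [TopologicalSpace M] [ChartedSpace E M] [IsManifold 𝓘(ℝ, E) ∞ M] {n : ℕ}

theorem isCn_smul_of_contMDiff {χ : M → ℝ} (hχ : ContMDiff 𝓘(ℝ, E) 𝓘(ℝ, ℝ) ∞ χ)
    {α : Form ℝ E M ℝ n} (hα : IsCn ∞ α) : IsCn ∞ (fun p => χ p • α p) := by
  refine isCn_of_contDiffAt fun x y hy => ?_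
  have h1 : ContMDiffAt 𝓘(ℝ, E) 𝓘(ℝ, E) ∞ (chartAt E x).symm y :=
    (contMDiffOn_chart_symm (I := 𝓘(ℝ, E)) (n := ∞) (x := x)).contMDiffAt
      ((chartAt E x).open_target.mem_nhds hy)
  have h2 : ContDiffAt ℝ ∞ (χ ∘ (chartAt E x).symm) y :=
    (hχ.contMDiffAt.comp y h1).contDiffAt
  exact h2.smul (hα.contDiffAt hy)

theorem extD_sum {ι : Type*} (s : Finset ι) {α : ι → Form ℝ E M ℝ n} (h : ∀ i, IsCn ∞ (α i)) :
    IsCn ∞ (∑ i ∈ s, α i) ∧ extD (∑ i ∈ s, α i) = ∑ i ∈ s, extD (α i) := by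
  classical
  induction s using Finset.induction_on with
  | empty => exact ⟨isCn_zero, extD_zero⟩
  | insert a s ha ih =>
    rw [Finset.sum_insert ha, Finset.sum_insert ha]
    exact ⟨(h a).add ih.1, by rw [extD_add (h a) ih.1, ih.2]⟩

theorem chartRep_eq_zero {α : Form ℝ E M ℝ n} {x : M} {y : E} (h : α ((chartAt E x).symm y) = 0) :
    chartRep x α y = 0 := by
  rw [chartRep, h]
  rfl

theorem extD_eq_zero_of_notMem {α : Form ℝ E M ℝ n} {T : Set M} (hT : IsClosed T)
    (h : ∀ p ∉ T, α p = 0) {p : M} (hp : p ∉ T) : extD α p = 0 := by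
  have h1 : chartRep p α =ᶠ[𝓝 (chartAt E p p)] chartRep p 0 := by
    have h2 : ∀ᶠ y in 𝓝 (chartAt E p p), (chartAt E p).symm y ∈ Tᶜ :=
      ((chartAt E p).continuousAt_symm (mem_chart_target E p)).eventually
        (hT.isOpen_compl.mem_nhds (by rwa [(chartAt E p).left_inv (mem_chart_source E p)]))
    filter_upwards [h2] with y hy
    rw [chartRep_eq_zero (h _ hy), chartRep_eq_zero rfl]
  rw [extD_apply, h1.extDeriv_eq, ← extD_apply, extD_zero]
  rfl

variable (b : Module.Basis (Fin n) ℝ E)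

theorem chartRep_basis_ne_zero {ν : Form ℝ E M ℝ n} (hν : ∀ p, ν p b ≠ 0) {x : M} {y : E}
    (hy : y ∈ (chartAt E x).target) : chartRep x ν y b ≠ 0 := by
  rw [chartRep_eq _ hy, compContinuousLinearMap_basis]
  refine mul_ne_zero (fun h0 => ?_) (hν _)
  have h := congrArg ContinuousLinearMap.det (fderiv_chartTrans_inv (x' := (chartAt E x).symm y)
    hy (mem_chart_source E _))
  have h2 : ∀ A B : E →L[ℝ] E, (A.comp B).det = A.det * B.det := fun A B =>
    LinearMap.det_comp (A : E →ₗ[ℝ] E) (B : E →ₗ[ℝ] E)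
  rw [h2, h0, mul_zero] at h
  have h3 : (ContinuousLinearMap.id ℝ E).det = 1 := LinearMap.det_id
  rw [h3] at h
  exact zero_ne_one h

/-- The density of the `n`-form `κ` in the chart at `x`, for the orientation of `ν`. -/
def chartDensity (ν κ : Form ℝ E M ℝ n) (x : M) (y : E) : ℝ :=
  (SignType.sign (chartRep x ν y b) : ℝ) * chartRep x κ y b

theorem continuousOn_chartRep_apply {κ : Form ℝ E M ℝ n} (hκ : IsCn ∞ κ) (x : M) :
    ContinuousOn (fun y => chartRep x κ y b) (chartAt E x).target :=
  (ContinuousAlternatingMap.apply ℝ E ℝ b).continuous.comp_continuousOn (hκ x).continuousOn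

theorem continuousOn_chartDensity {ν κ : Form ℝ E M ℝ n} (hν : IsCn ∞ ν) (hν0 : ∀ p, ν p b ≠ 0)
    (hκ : IsCn ∞ κ) (x : M) : ContinuousOn (chartDensity b ν κ x) (chartAt E x).target := by
  refine ContinuousOn.mul (fun y hy => ?_) (continuousOn_chartRep_apply b hκ x)
  have h1 := (continuousAt_sign_of_ne_zero (chartRep_basis_ne_zero b hν0 hy)).comp_continuousWithinAt
    (f := fun y => chartRep x ν y b) (continuousOn_chartRep_apply b hν x y hy)
  exact (continuous_of_discreteTopology (f := fun s : SignType => (s : ℝ))).continuousAt.comp_continuousWithinAt h1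

theorem chartDensity_add (ν κ κ' : Form ℝ E M ℝ n) (x : M) :
    chartDensity b ν (κ + κ') x = chartDensity b ν κ x + chartDensity b ν κ' x := by
  funext y
  exact mul_add _ _ _

theorem chartDensity_eq_zero (ν : Form ℝ E M ℝ n) {κ : Form ℝ E M ℝ n} {x : M} {y : E}
    (h : κ ((chartAt E x).symm y) = 0) : chartDensity b ν κ x y = 0 := by
  rw [chartDensity, chartRep_eq_zero h]
  exact mul_zero _

theorem chartDensity_smul_self (ν : Form ℝ E M ℝ n) (g : M → ℝ) (x : M) (y : E) :
    chartDensity b ν (fun p => g p • ν p) x y =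
      g ((chartAt E x).symm y) * |chartRep x ν y b| := by
  have h : chartRep x (fun p => g p • ν p) y b = g ((chartAt E x).symm y) * chartRep x ν y b := rfl
  rw [chartDensity, h, ← sign_mul_self (chartRep x ν y b)]
  ring

/-- Both ν and κ acquire the determinant of the transition map, and the sign of the one turns that
of the other into an absolute value. So ν serves as orientation and the atlas need not be oriented.
-/
theorem chartDensity_chartTrans (ν κ : Form ℝ E M ℝ n) {x x' : M} {y : E}
    (hy : y ∈ (chartAt E x).target) (hy' : (chartAt E x).symm y ∈ (chartAt E x').source) :
    chartDensity b ν κ x y = |(fderiv ℝ (chartTrans x x') y).det| •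
      chartDensity b ν κ x' (chartTrans x x' y) := by
  rw [chartDensity, chartDensity, chartRep_chartTrans ν hy hy', chartRep_chartTrans κ hy hy',
    compContinuousLinearMap_basis, compContinuousLinearMap_basis, sign_mul, SignType.coe_mul,
    ← sign_mul_self, smul_eq_mul]
  ring

variable [MeasurableSpace E] [BorelSpace E] (μ : Measure E) [μ.IsAddHaarMeasure]

/-- The integral of an `n`-form over the chart at `x`, for the orientation of `ν`. -/
def chartIntegral (ν κ : Form ℝ E M ℝ n) (x : M) : ℝ :=
  ∫ y in (chartAt E x).target, chartDensity b ν κ x y ∂μ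

/-- Both integrals reduce to the overlap of the two charts, where the change of variables formula
identifies them. -/
theorem chartIntegral_eq_of_support (ν : Form ℝ E M ℝ n) {κ : Form ℝ E M ℝ n} {x x' : M}
    (h : ∀ p, p ∉ (chartAt E x).source → κ p = 0) (h' : ∀ p, p ∉ (chartAt E x').source → κ p = 0) :
    chartIntegral b μ ν κ x = chartIntegral b μ ν κ x' := by
  have hS : ∀ z z' : M, IsOpen ((chartAt E z).target ∩
      (chartAt E z).symm ⁻¹' (chartAt E z').source) := fun z z' =>
    (chartAt E z).isOpen_inter_preimage_symm (chartAt E z').open_source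
  have hred : ∀ z z' : M, (∀ p, p ∉ (chartAt E z').source → κ p = 0) →
      chartIntegral b μ ν κ z = ∫ y in (chartAt E z).target ∩
        (chartAt E z).symm ⁻¹' (chartAt E z').source, chartDensity b ν κ z y ∂μ := by
    intro z z' hz
    refine setIntegral_eq_of_subset_of_forall_sdiff_eq_zero (chartAt E z).open_target.measurableSet
      Set.inter_subset_left fun y hy => ?_
    exact chartDensity_eq_zero b ν (hz _ fun h1 => hy.2 ⟨hy.1, h1⟩)
  rw [hred x x' h', hred x' x h]
  have himg : chartTrans x x' '' ((chartAt E x).target ∩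
      (chartAt E x).symm ⁻¹' (chartAt E x').source) =
      (chartAt E x').target ∩ (chartAt E x').symm ⁻¹' (chartAt E x).source := by
    ext z
    constructor
    · rintro ⟨y, ⟨hy, hy'⟩, rfl⟩
      refine ⟨chartTrans_mem hy', ?_⟩
      rw [Set.mem_preimage, symm_chartTrans hy']
      exact (chartAt E x).map_target hy
    · rintro ⟨hz, hz'⟩
      refine ⟨chartTrans x' x z, ⟨chartTrans_mem hz', ?_⟩, ?_⟩
      · rw [Set.mem_preimage, symm_chartTrans hz']
        exact (chartAt E x').map_target hz
      · rw [chartTrans_chartTrans hz']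
        exact (chartAt E x').right_inv hz
  rw [← himg, integral_image_eq_integral_abs_det_fderiv_smul μ (hS x x').measurableSet
    (f' := fun y => fderiv ℝ (chartTrans x x') y)]
  · refine setIntegral_congr_fun (hS x x').measurableSet fun y hy => ?_
    exact chartDensity_chartTrans b ν κ hy.1 hy.2
  · intro y hy
    exact ((contDiffAt_chartTrans ℝ 1 hy.1 hy.2).differentiableAt
      one_ne_zero).hasFDerivAt.hasFDerivWithinAt
  · intro y hy z hz hyz
    have h1 := congrArg (chartTrans x' x) hyz
    rw [chartTrans_chartTrans hy.2, chartTrans_chartTrans hz.2] at h1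
    rwa [show chartTrans x x y = y from (chartAt E x).right_inv hy.1,
      show chartTrans x x z = z from (chartAt E x).right_inv hz.1] at h1

theorem integrableOn_chartDensity {ν κ : Form ℝ E M ℝ n} (hν : IsCn ∞ ν) (hν0 : ∀ p, ν p b ≠ 0)
    (hκ : IsCn ∞ κ) {x : M} {T : Set M} (hT : IsCompact T) (hTx : T ⊆ (chartAt E x).source)
    (hκT : ∀ p ∉ T, κ p = 0) :
    IntegrableOn (chartDensity b ν κ x) (chartAt E x).target μ := by
  have hK : IsCompact (chartAt E x '' T) :=
    hT.image_of_continuousOn ((chartAt E x).continuousOn.mono hTx)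
  have hsub : chartAt E x '' T ⊆ (chartAt E x).target := by
    rintro _ ⟨p, hp, rfl⟩
    exact (chartAt E x).map_source (hTx hp)
  have h1 : IntegrableOn (chartDensity b ν κ x) (chartAt E x '' T) μ :=
    ((continuousOn_chartDensity b hν hν0 hκ x).mono hsub).integrableOn_compact hK
  refine h1.of_forall_sdiff_eq_zero (chartAt E x).open_target.measurableSet fun y hy => ?_
  refine chartDensity_eq_zero b ν (hκT _ fun h => hy.2 ⟨_, h, (chartAt E x).right_inv hy.1⟩)

theorem chartIntegral_sum {ι : Type*} (s : Finset ι) {ν : Form ℝ E M ℝ n} {κ : ι → Form ℝ E M ℝ n}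
    {x : M} (h : ∀ i ∈ s, IntegrableOn (chartDensity b ν (κ i) x) (chartAt E x).target μ) :
    chartIntegral b μ ν (∑ i ∈ s, κ i) x = ∑ i ∈ s, chartIntegral b μ ν (κ i) x := by
  have h1 : chartDensity b ν (∑ i ∈ s, κ i) x = fun y => ∑ i ∈ s, chartDensity b ν (κ i) x y := by
    classical
    clear h
    induction s using Finset.induction_on with
    | empty =>
      funext y
      exact chartDensity_eq_zero b ν rfl
    | insert a s ha ih =>
      funext y
      rw [Finset.sum_insert ha, chartDensity_add, Pi.add_apply, ih, Finset.sum_insert ha]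
  rw [chartIntegral, h1, integral_finsetSum _ h]
  rfl

end ChartIntegral

section Stokes

variable {E M : Type*} [NormedAddCommGroup E] [NormedSpace ℝ E] [FiniteDimensional ℝ E]
  [TopologicalSpace M] [ChartedSpace E M] [IsManifold 𝓘(ℝ, E) ∞ M] {n : ℕ}
  (b : Module.Basis (Fin (n + 1)) ℝ E)
  [MeasurableSpace E] [BorelSpace E] (μ : Measure E) [μ.IsAddHaarMeasure]

theorem chartIntegral_extD_eq_zero {ν : Form ℝ E M ℝ (n + 1)} (hν : IsCn ∞ ν)
    (hν0 : ∀ p, ν p b ≠ 0) {θ : Form ℝ E M ℝ n} (hθ : IsCn ∞ θ) {x : M} {T : Set M}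
    (hT : IsCompact T) (hTx : T ⊆ (chartAt E x).source) (hθT : ∀ p ∉ T, θ p = 0) :
    chartIntegral b μ ν (extD θ) x = 0 := by
  have h := integral_sign_mul_extDeriv_eq_zero μ (chartAt E x).open_target
    (hT.image_of_continuousOn ((chartAt E x).continuousOn.mono hTx))
    (by
      rintro _ ⟨p, hp, rfl⟩
      exact (chartAt E x).map_source (hTx hp))
    (η := chartRep x θ) (fun y hy => (hθ.contDiffAt hy).of_le (by exact_mod_cast le_top))
    (fun y hy hyT => chartRep_eq_zero
      (hθT _ fun h => hyT ⟨_, h, (chartAt E x).right_inv hy⟩))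
    (continuousOn_chartRep_apply b hν x) (fun y hy => chartRep_basis_ne_zero b hν0 hy) b
  rw [← h, chartIntegral]
  refine setIntegral_congr_fun (chartAt E x).open_target.measurableSet fun y hy => ?_
  rw [chartDensity, chartRep_extD hθ hy]

omit [MeasurableSpace E] [BorelSpace E] in
/-- A multiple `g ν` of a volume form with `g ≥ 0` on a compact manifold which is exact
vanishes. -/
theorem eq_zero_of_extD_eq_smul [T2Space M] [CompactSpace M] {m : ℕ} (hm : n + 1 = m)
    (b : Module.Basis (Fin m) ℝ E) {ν : Form ℝ E M ℝ m} (hν : IsCn ∞ ν) (hν0 : ∀ p, ν p b ≠ 0)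
    {θ : Form ℝ E M ℝ n} (hθ : IsCn ∞ θ) {g : M → ℝ} (hg : ∀ p, 0 ≤ g p)
    (h : ∀ p, castDeg hm (extD θ p) = g p • ν p) (p : M) : g p = 0 := by
  subst hm
  replace h : extD θ = fun p => g p • ν p := funext h
  let _ : MeasurableSpace E := borel E
  have : BorelSpace E := ⟨rfl⟩
  let μ : Measure E := Measure.addHaar
  obtain ⟨χ, hχ⟩ := SmoothPartitionOfUnity.exists_isSubordinate_chartAt_source 𝓘(ℝ, E) M
  have hfin := χ.locallyFinite.finite_nonempty_of_compact
  set s := hfin.toFinset with hs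
  have hχs : ∀ i ∉ s, ∀ p, χ i p = 0 := by
    intro i hi p
    by_contra hne
    exact hi (hfin.mem_toFinset.mpr ⟨p, hne⟩)
  have hsum : ∀ p, ∑ i ∈ s, χ i p = 1 := by
    intro p
    rw [← χ.sum_eq_one (Set.mem_univ p)]
    refine (finsum_eq_sum_of_support_subset _ fun i hi => ?_).symm
    by_contra hne
    exact hi (hχs i hne p)
  have hT : ∀ i, IsCompact (tsupport (χ i)) := fun i => (isClosed_tsupport _).isCompact
  have hχT : ∀ i, ∀ p ∉ tsupport (χ i), χ i p = 0 := fun i p hp => image_eq_zero_of_notMem_tsupport hp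
  have hθi : ∀ i, IsCn ∞ (fun p => χ i p • θ p) := fun i =>
    isCn_smul_of_contMDiff (χ i).contMDiff hθ
  have hθ0 : ∀ i, ∀ p ∉ tsupport (χ i), χ i p • θ p = 0 := fun i p hp => by
    rw [hχT i p hp]
    exact form_zero_smul _
  have hκ0 : ∀ i, ∀ p ∉ tsupport (χ i), extD (fun p => χ i p • θ p) p = 0 := fun i p hp =>
    extD_eq_zero_of_notMem (isClosed_tsupport _) (hθ0 i) hp
  have hκsum : ∑ i ∈ s, extD (fun p => χ i p • θ p) = extD θ := by
    rw [← (extD_sum s hθi).2]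
    congr 1
    funext p
    rw [Finset.sum_apply, ← Finset.sum_smul, hsum, one_smul]
  -- The forms χ_j d(χ_i θ) are supported in both charts i and j. Summed over j in chart i they give
  -- the integral of d(χ_i θ), which is 0; summed over i in chart j they give the integral of χ_j g
  -- ν. Exchanging the sums makes the total of the latter vanish.
  have hprod : ∀ i j, IsCn ∞ (fun p => χ j p • extD (fun p => χ i p • θ p) p) := fun i j =>
    isCn_smul_of_contMDiff (χ j).contMDiff (hθi i).extD
  have hz1 : ∀ i j, ∀ p ∉ tsupport (χ i), χ j p • extD (fun p => χ i p • θ p) p = 0 :=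
    fun i j p hp => by
      rw [hκ0 i p hp]
      exact form_smul_zero _
  have hz2 : ∀ i j, ∀ p ∉ tsupport (χ j), χ j p • extD (fun p => χ i p • θ p) p = 0 :=
    fun i j p hp => by
      rw [hχT j p hp]
      exact form_zero_smul _
  have e1 : ∀ i, ∑ j ∈ s, chartIntegral b μ ν (fun p => χ j p • extD (fun p => χ i p • θ p) p) i =
      0 := by
    intro i
    rw [← chartIntegral_extD_eq_zero b μ hν hν0 (hθi i) (hT i) (hχ i) (hθ0 i),
      ← chartIntegral_sum b μ s fun j _ => integrableOn_chartDensity b μ hν hν0 (hprod i j) (hT i)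
        (hχ i) (hz1 i j)]
    congr 1
    funext p
    rw [Finset.sum_apply, ← Finset.sum_smul, hsum, one_smul]
  have e2 : ∀ i j, chartIntegral b μ ν (fun p => χ j p • extD (fun p => χ i p • θ p) p) i =
      chartIntegral b μ ν (fun p => χ j p • extD (fun p => χ i p • θ p) p) j := fun i j =>
    chartIntegral_eq_of_support b μ ν (fun p hp => hz1 i j p fun h => hp (hχ i h))
      (fun p hp => hz2 i j p fun h => hp (hχ j h))
  have hpi : ∀ j, (∑ i ∈ s, fun p => χ j p • extD (fun p => χ i p • θ p) p) =
      fun p => (χ j p * g p) • ν p := by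
    intro j
    funext p
    have h1 := congrFun hκsum p
    rw [Finset.sum_apply, h] at h1
    rw [Finset.sum_apply, ← Finset.smul_sum, h1, smul_smul]
  have e3 : ∑ j ∈ s, chartIntegral b μ ν (fun p => (χ j p * g p) • ν p) j = 0 := by
    have h1 : ∀ j, chartIntegral b μ ν (fun p => (χ j p * g p) • ν p) j =
        ∑ i ∈ s, chartIntegral b μ ν (fun p => χ j p • extD (fun p => χ i p • θ p) p) j := by
      intro j
      rw [← hpi, chartIntegral_sum b μ s fun i _ => integrableOn_chartDensity b μ hν hν0
        (hprod i j) (hT j) (hχ j) (hz2 i j)]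
    rw [Finset.sum_congr rfl fun j _ => (h1 j).trans (Finset.sum_congr rfl fun i _ =>
      (e2 i j).symm), Finset.sum_comm]
    exact Finset.sum_eq_zero fun i _ => e1 i
  have hnn : ∀ j y, 0 ≤ chartDensity b ν (fun p => (χ j p * g p) • ν p) j y := by
    intro j y
    rw [chartDensity_smul_self b ν (fun p => χ j p * g p)]
    exact mul_nonneg (mul_nonneg (χ.nonneg j _) (hg _)) (abs_nonneg _)
  -- The densities are nonnegative, so each integral vanishes, and then each density does by
  -- continuity.
  have e4 : ∀ j ∈ s, chartIntegral b μ ν (fun p => (χ j p * g p) • ν p) j = 0 :=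
    (Finset.sum_eq_zero_iff_of_nonneg fun j _ =>
      integral_nonneg fun y => hnn j y).mp e3
  -- No smoothness of g is assumed; that of χ_j g ν comes from its expression as a sum of the χ_j
  -- d(χ_i θ).
  have hsm : ∀ j, IsCn ∞ (fun p => (χ j p * g p) • ν p) := by
    intro j
    rw [← hpi]
    exact (extD_sum s fun i => hprod i j).1
  have e5 : ∀ j ∈ s, χ j p * g p = 0 := by
    intro j hj
    by_cases hp : p ∈ (chartAt E j).source
    · have hint : IntegrableOn (chartDensity b ν (fun p => (χ j p * g p) • ν p) j)
          (chartAt E j).target μ :=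
        integrableOn_chartDensity b μ hν hν0 (hsm j) (hT j) (hχ j) fun p hp => by
          rw [hχT j p hp, zero_mul]
          exact form_zero_smul _
      have h1 := (setIntegral_eq_zero_iff_of_nonneg_ae
        (Eventually.of_forall fun y => hnn j y) hint).mp (e4 j hj)
      have h2 := Measure.eqOn_open_of_ae_eq h1 (chartAt E j).open_target
        (continuousOn_chartDensity b hν hν0 (hsm j) j) continuousOn_const
      have h3 := h2 ((chartAt E j).map_source hp)
      rw [chartDensity_smul_self b ν (fun p => χ j p * g p), (chartAt E j).left_inv hp] at h3
      exact (mul_eq_zero.mp h3).resolve_right (abs_ne_zero.mpr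
        (chartRep_basis_ne_zero b hν0 ((chartAt E j).map_source hp)))
    · rw [hχT j p fun h => hp (hχ j h), zero_mul]
  have h6 : ∑ j ∈ s, χ j p * g p = 0 := Finset.sum_eq_zero e5
  rwa [← Finset.sum_mul, hsum, one_mul] at h6

end Stokes

end GenCY

end

/-! ### The dd^J-lemma for exp(iω). -/

noncomputable section

namespace GenCY

attribute [local irreducible] pairing clifford

section CaseSymplectic

variable {E M : Type*} [NormedAddCommGroup E] [NormedSpace ℝ E] [FiniteDimensional ℝ E]
  [Fact (Module.finrank ℝ E = 6)]
  [TopologicalSpace M] [ChartedSpace E M] [IsManifold 𝓘(ℝ, E) ∞ M] {w : Form ℝ E M ℝ 2}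

omit [Fact (Module.finrank ℝ E = 6)] in
theorem extD_wedge_of_closed {k l : ℕ} {α : Form ℝ E M ℝ k} {β : Form ℝ E M ℝ l} (hα : IsCn ∞ α)
    (hβ : IsCn ∞ β) (h : extD β = 0) :
    extD (fun p => wedge (α p) (β p)) =
      fun p => castDeg (Nat.succ_add k l) (wedge (extD α p) (β p)) := by
  rw [extD_wedge hα hβ]
  funext p
  rw [h, Pi.zero_apply, wedge_zero_right', form_smul_zero, add_zero]

theorem infAction_expI_one (X : M → E) (ξ : Form ℝ E M ℝ 1) :
    infAction X ξ (expI w) 1 = ξ := by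
  rw [infAction_succ]
  funext x
  have h2 : reForm (expI w 2 x) = 0 :=
    (congrFun (reForm_expForm_I (w x)) 2).trans (symRe_of_ne _ (by norm_num) (by norm_num))
  have h0 : reForm (expI w 0 x) = oneForm E ℝ :=
    (congrFun (reForm_expForm_I (w x)) 0).trans (symRe_zero _)
  rw [h2, h0, form_zero_apply]
  exact (zero_add _).trans (cwedge_toCovector (ξ x))

theorem infAction_expI_three (X : M → E) (ξ : Form ℝ E M ℝ 1) :
    infAction X ξ (expI w) 3 = fun x => -cwedge (symFlat (w x) (X x)) (w x) := by
  rw [infAction_succ]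
  funext x
  have h4 : reForm (expI w 4 x) = -(1 / 2 : ℝ) • formSq (w x) :=
    (congrFun (reForm_expForm_I (w x)) 4).trans (symRe_four _)
  have h2 : reForm (expI w 2 x) = 0 :=
    (congrFun (reForm_expForm_I (w x)) 2).trans (symRe_of_ne _ (by norm_num) (by norm_num))
  have h : ((-(1 / 2 : ℝ)) • formSq (w x)).curryLeft (X x) =
      (-(1 / 2 : ℝ)) • (formSq (w x)).curryLeft (X x) := rfl
  rw [h4, h2, cwedge_zero, add_zero, h, curryLeft_formSq]
  module

theorem infAction_expI_five (X : M → E) (ξ : Form ℝ E M ℝ 1) :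
    infAction X ξ (expI w) 5 = fun x => -(1 / 2 : ℝ) • cwedge (toCovector (ξ x)) (formSq (w x)) := by
  rw [infAction_succ]
  funext x
  have h4 : reForm (expI w 4 x) = -(1 / 2 : ℝ) • formSq (w x) :=
    (congrFun (reForm_expForm_I (w x)) 4).trans (symRe_four _)
  have h6 : reForm (expI w 6 x) = 0 :=
    (congrFun (reForm_expForm_I (w x)) 6).trans (symRe_of_ne _ (by norm_num) (by norm_num))
  rw [h4, h6, form_zero_apply, zero_add, cwedge_smul]

theorem infAction_expI_even (X : M → E) (ξ : Form ℝ E M ℝ 1) {k : ℕ} (hk : k % 2 = 0) :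
    infAction X ξ (expI w) k = 0 := by
  have hodd : ∀ j x, j % 2 = 1 → reForm (expI w j x) = 0 := fun j x hj =>
    (congrFun (reForm_expForm_I (w x)) j).trans (symRe_of_ne _ (by omega) (by omega))
  cases k with
  | zero =>
    rw [infAction_zero]
    funext x
    rw [hodd 1 x rfl, form_zero_apply]
    rfl
  | succ k =>
    rw [infAction_succ]
    funext x
    rw [hodd _ x (by omega), hodd k x (by omega), form_zero_apply, cwedge_zero, zero_add]
    rfl

/-- The vector field dual to a one-form under a symplectic form is smooth. -/
theorem IsSymplectic.exists_symFlat_eq (hw : IsSymplectic w) {η : Form ℝ E M ℝ 1}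
    (hη : IsCn ∞ η) : ∃ X : ∀ x : M, TangentSpace 𝓘(ℝ, E) x,
      ContMDiff 𝓘(ℝ, E) 𝓘(ℝ, E).tangent ∞
        (fun x => (⟨x, X x⟩ : TangentBundle 𝓘(ℝ, E) M)) ∧
      ∀ x, symFlat (w x) (X x : E) = toCovector (η x) := by
  have h : ∀ x, symFlat (w x) (symSharp (hw.nondegenerate x) (toCovector (η x))) =
    toCovector (η x) := fun x => symFlat_symSharp _ _
  refine ⟨fun x => symSharp (hw.nondegenerate x) (toCovector (η x)),
    contMDiff_of_curryLeft hw.smooth (fun x v hv => hw.nondegenerate x v fun u => ?_) ?_, h⟩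
  · have h1 := congrArg (fun α : E [⋀^Fin 1]→L[ℝ] ℝ => α ![u]) hv
    exact h1
  · have h2 : (fun p => (w p).curryLeft (symSharp (hw.nondegenerate p) (toCovector (η p)))) = η := by
      funext p
      rw [← cwedge_symFlat, h, cwedge_toCovector]
    exact (congrArg (IsCn ∞) h2).mpr hη

theorem IsSymplectic.isCn_formSq (hw : IsSymplectic w) : IsCn ∞ fun p => formSq (w p) :=
  hw.smooth.wedge hw.smooth

theorem IsSymplectic.isCn_formCube (hw : IsSymplectic w) : IsCn ∞ fun p => formCube (w p) :=
  hw.isCn_formSq.wedge hw.smooth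

theorem IsSymplectic.extD_formSq (hw : IsSymplectic w) : extD (fun p => formSq (w p)) = 0 := by
  refine (extD_wedge_of_closed hw.smooth hw.smooth hw.closed).trans ?_
  funext p
  rw [hw.closed, Pi.zero_apply, zero_wedge]
  rfl

/-- Division of a smooth `4`-form by a symplectic form. -/
theorem IsSymplectic.exists_wedge_eq (hw : IsSymplectic w) {χ : Form ℝ E M ℝ 4} (hχ : IsCn ∞ χ) :
    ∃ γ : Form ℝ E M ℝ 2, IsCn ∞ γ ∧ ∀ p, χ p = wedge (γ p) (w p) := by
  have hcomm : ∀ α β : E [⋀^Fin 2]→L[ℝ] ℝ, wedge α β = wedge β α := fun α β => by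
    have h := wedge_comm α β
    rw [castDeg_rfl] at h
    rw [h]
    norm_num
  choose γ hγ using fun p => wedge_surjective (hw.nondegenerate p) (χ p)
  have h : ∀ p, χ p = wedge (γ p) (w p) := fun p => by rw [hcomm, hγ]
  refine ⟨γ, isCn_of_wedge hw.smooth (fun x α' h' => ?_) ?_, h⟩
  · exact eq_zero_of_wedge_eq_zero (hw.nondegenerate x) ((hcomm _ _).trans h')
  · exact (funext h : χ = fun p => wedge (γ p) (w p)) ▸ hχ

/-- Division of a smooth `6`-form by the volume form of a symplectic form. -/
theorem IsSymplectic.exists_smul_formCube_eq (hw : IsSymplectic w) {χ : Form ℝ E M ℝ 6}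
    (hχ : IsCn ∞ χ) :
    ∃ s : M → ℝ, IsCn ∞ (fun p => s p • oneForm E ℝ) ∧ ∀ p, χ p = s p • formCube (w p) := by
  choose s hs using fun p => exists_smul_eq_of_ne_zero (formCube_ne_zero (hw.nondegenerate p)) (χ p)
  refine ⟨s, isCn_of_wedge hw.isCn_formCube (fun x α' h' => ?_) ?_, hs⟩
  · have h1 := wedge_of_degree_zero α' (formCube (w x))
    rw [h'] at h1
    have h2 : α' 0 = 0 :=
      (smul_eq_zero.mp h1.symm).resolve_right (formCube_ne_zero (hw.nondegenerate x))
    ext v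
    rw [Subsingleton.elim v 0]
    exact h2
  · have h : (fun p => wedge (s p • oneForm E ℝ) (formCube (w p))) = χ := by
      funext p
      rw [hs, wedge_smul_left]
      exact congrArg (s p • ·) (oneForm_wedge (formCube (w p)))
    exact h ▸ hχ

/-- On a compact symplectic manifold, a function `s` for which `s ω³` is exact vanishes if it is
closed. -/
theorem IsSymplectic.eq_zero_of_extD_eq [T2Space M] [CompactSpace M] (hw : IsSymplectic w)
    {s : M → ℝ} (hs : IsCn ∞ (fun p => s p • oneForm E ℝ))
    (hs0 : extD (fun p => s p • oneForm E ℝ) = 0) {θ : Form ℝ E M ℝ 5} (hθ : IsCn ∞ θ)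
    (h : extD θ = fun p => s p • formCube (w p)) (p : M) : s p = 0 := by
  -- As ds = 0, the form sθ is a primitive of s² ω³. This multiple of ω³ is nonnegative even if s
  -- has different signs on different components.
  let Sθ : Form ℝ E M ℝ 5 := fun p => wedge (s p • oneForm E ℝ) (θ p)
  have hSθ : IsCn ∞ Sθ := hs.wedge hθ
  have hd : extD Sθ =
      fun p => (s p * s p) • formCube (w p) := by
    refine (extD_wedge hs hθ).trans ?_
    funext p
    rw [hs0, h, Pi.zero_apply, zero_wedge, castDeg_zero, pow_zero, one_smul, wedge_smul_left,
      wedge_smul_right, smul_smul]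
    exact (zero_add _).trans (congrArg ((s p * s p) • ·) (oneForm_wedge (formCube (w p))))
  have h0 : ∀ p, formCube (w p) (sixBasis E) ≠ 0 := fun p h0 =>
    formCube_ne_zero (hw.nondegenerate p) (form_six_eq_zero h0)
  exact mul_self_eq_zero.mp (eq_zero_of_extD_eq_smul (m := 6) (g := fun p => s p * s p) rfl
    (sixBasis E) hw.isCn_formCube h0 hSθ (fun p => mul_self_nonneg (s p)) (fun p => congrFun hd p) p)

/-- With dτ₃ = γ ∧ ω and dτ₅ + ½ dτ₁ ∧ ω² = s ω³, the components of `J` dτ in degrees 0 and 2 are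
-3s and -γ. Both being closed, s vanishes by Stokes and γ = dη by the Lefschetz condition; ξ = τ₁
and ι(X)ω = -η then solve the equation. -/
theorem ddjLemma_symplectic [T2Space M] [CompactSpace M] (hw : IsSymplectic w)
    (hL : StrongLefschetz w) : DDJLemma 0 (expI w) := by
  intro τ hpar hτ hd
  have hσ : ∀ k, k % 2 = 1 → mixedD τ k = 0 := fun k hk =>
    hasParity_mixedD hpar k (by omega)
  obtain ⟨γ, hγ, hγw⟩ := hw.exists_wedge_eq (hτ 3).extD
  have hτ1 : IsCn ∞ fun p => wedge (τ 1 p) (formSq (w p)) := (hτ 1).wedge hw.isCn_formSq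
  let κ : Form ℝ E M ℝ 6 := fun p => wedge (mixedD τ 2 p) (formSq (w p))
  have hdτ1 : extD (fun p => (wedge (τ 1 p) (formSq (w p)) : E [⋀^Fin 5]→L[ℝ] ℝ)) = κ :=
    extD_wedge_of_closed (hτ 1) hw.isCn_formSq hw.extD_formSq
  -- Since ω² is closed, θ is a primitive of dτ₅ + ½ dτ₁ ∧ ω², the combination whose ratio to ω³ is
  -- what `J` shows in degree 0.
  let θ : Form ℝ E M ℝ 5 := τ 5 + (1 / 2 : ℝ) • fun p => wedge (τ 1 p) (formSq (w p))
  have hθ : IsCn ∞ θ := (hτ 5).add (hτ1.smul _)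
  have hdθ : extD θ = mixedD τ 6 + (1 / 2 : ℝ) • κ := by
    refine (extD_add (hτ 5) (hτ1.smul _)).trans ?_
    rw [extD_smul]
    exact congrArg (fun κ : Form ℝ E M ℝ 6 => mixedD τ 6 + (1 / 2 : ℝ) • κ) hdτ1
  obtain ⟨s, hs, hsw⟩ := hw.exists_smul_formCube_eq hθ.extD
  have hJ : ∀ x, opJ (expI w) (mixedD τ) 0 x = (-(3 * s x)) • oneForm E ℝ ∧
      opJ (expI w) (mixedD τ) 2 x = -γ x := by
    intro x
    have h6 := (congrFun hdθ x).symm.trans (hsw x)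
    have h := cplxStr_expForm_I (hw.nondegenerate x) (σ := fun j => mixedD τ j x)
      (fun k hk => congrFun (hσ k hk) x) rfl (γ := γ x) (s := s x) (hγw x) h6
    rw [← reForm_expForm_I] at h
    exact h
  have hs0 : extD (fun p => s p • oneForm E ℝ) = 0 := by
    have h1 : opJ (expI w) (mixedD τ) 0 = (-3 : ℝ) • fun p => s p • oneForm E ℝ := by
      funext x
      rw [(hJ x).1, Pi.smul_apply, smul_smul, neg_mul]
    have h2 : extD (opJ (expI w) (mixedD τ) 0) = 0 := congrFun hd 1
    rw [h1, extD_smul] at h2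
    exact (smul_eq_zero.mp h2).resolve_left (by norm_num)
  have hγ0 : extD γ = 0 := by
    have h1 : opJ (expI w) (mixedD τ) 2 = -γ := funext fun x => (hJ x).2
    have h2 : extD (opJ (expI w) (mixedD τ) 2) = 0 := congrFun hd 3
    rw [h1, extD_neg] at h2
    exact neg_eq_zero.mp h2
  have hs00 := hw.eq_zero_of_extD_eq hs hs0 hθ (funext hsw)
  obtain ⟨η, hη, hηγ⟩ := hL.injective γ ⟨hγ, hγ0⟩ ⟨τ 3, hτ 3, by
    funext p
    rw [hγw]
    have h := wedge_comm (γ p) (w p)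
    rw [castDeg_rfl] at h
    rw [h]
    norm_num⟩
  obtain ⟨X, hX, hXη⟩ := hw.exists_symFlat_eq hη.neg
  refine ⟨X, τ 1, hX, hτ 1, ?_⟩
  have hI1 : infAction (fun x => (X x : E)) (τ 1) (expI w) 1 = τ 1 := infAction_expI_one _ _
  have hI3 : infAction (fun x => (X x : E)) (τ 1) (expI w) 3 = fun p => wedge (η p) (w p) := by
    refine (infAction_expI_three _ _).trans (funext fun x => ?_)
    have h1 : toCovector ((-η) x) = -toCovector (η x) := rfl
    rw [hXη, h1, neg_cwedge, neg_neg]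
    exact (wedge_one_form (η x) (w x)).symm
  have hI5 : infAction (fun x => (X x : E)) (τ 1) (expI w) 5 =
      (-(1 / 2 : ℝ)) • fun p => wedge (τ 1 p) (formSq (w p)) := by
    refine (infAction_expI_five _ _).trans (funext fun x => ?_)
    exact congrArg (-(1 / 2 : ℝ) • ·) (wedge_one_form (τ 1 x) (formSq (w x))).symm
  funext k
  cases k with
  | zero => rfl
  | succ k =>
    change extD (τ k) = extD _
    rcases Nat.lt_or_ge 5 k with h | h
    · funext x
      exact (form_eq_zero (by omega) _).trans (form_eq_zero (by omega) _).symm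
    by_cases hk : k % 2 = 0
    · rw [hpar k (by omega)]
      exact congrArg extD (infAction_expI_even _ _ hk).symm
    obtain rfl | rfl | rfl : k = 1 ∨ k = 3 ∨ k = 5 := by omega
    · rw [hI1]
    · rw [hI3]
      refine Eq.trans ?_ (extD_wedge_of_closed hη hw.smooth hw.closed).symm
      funext p
      rw [hηγ]
      exact hγw p
    · rw [hI5]
      refine Eq.trans ?_ ((extD_smul _ _).trans (congrArg ((-(1 / 2 : ℝ)) • ·) hdτ1)).symm
      -- The vanishing of s is exactly the required relation dτ₅ = -½ dτ₁ ∧ ω².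
      have h1 : mixedD τ 6 + (1 / 2 : ℝ) • κ = 0 := by
        rw [← hdθ]
        funext p
        exact (hsw p).trans (by rw [hs00, form_zero_smul, Pi.zero_apply])
      exact (eq_neg_of_add_eq_zero_left h1).trans (neg_smul _ _).symm

end CaseSymplectic

end GenCY

end

theorem mainTheorem5 :
    (∀ (E M : Type*) [NormedAddCommGroup E] [NormedSpace ℂ E] [FiniteDimensional ℂ E]
      [Fact (Module.finrank ℂ E = 3)]
      [TopologicalSpace M] [T2Space M] [SecondCountableTopology M] [ChartedSpace E M]
      [IsManifold 𝓘(ℂ, E) ω M] (Ω : GenCY.Form ℂ E M ℂ 3),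
      GenCY.IsHolomorphicForm Ω → (∀ x, Ω x ≠ 0) → GenCY.DelDelbarLemma E M →
      GenCY.DDJLemma 1 (GenCY.ofDegree (GenCY.toRealForm Ω))) ∧
    (∀ (E M : Type*) [NormedAddCommGroup E] [NormedSpace ℝ E] [FiniteDimensional ℝ E]
      [Fact (Module.finrank ℝ E = 6)]
      [TopologicalSpace M] [T2Space M] [CompactSpace M] [ChartedSpace E M]
      [IsManifold 𝓘(ℝ, E) ∞ M] (w : GenCY.Form ℝ E M ℝ 2),
      GenCY.IsSymplectic w → GenCY.StrongLefschetz w →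
      GenCY.DDJLemma 0 (GenCY.expI w)) :=
  ⟨fun _ _ _ _ _ _ _ _ _ _ _ _ => GenCY.ddjLemma_holomorphic,
    fun _ _ _ _ _ _ _ _ _ _ _ _ => GenCY.ddjLemma_symplectic⟩
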